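/- **Setting.** Let $\Omega\subset\mathbb R^3$ be a bounded open set and $T>0$. For each $\varepsilon\in(0,\varepsilon_0)$ consider $N=N(\varepsilon)$ closed balls $B_{n,\varepsilon}(t)=\overline{B}(h_{n,\varepsilon}(t),r_\varepsilon)$, $n=1,\dots,N(\varepsilon)$, of common radius $r_\varepsilon>0$ and common mass density $\varrho_{\varepsilon,S}>0$, hence of mass $m_{n,\varepsilon}=\varrho_{\varepsilon,S}\,|B_{n,\varepsilon}|=\tfrac{4\pi}{3}r_\varepsilon^3\varrho_{\varepsilon,S}$, moving with the rigid velocities $$w_{n,\varepsilon}(t,x)=h_{n,\varepsilon}'(t)+\omega_{n,\varepsilon}(t)\wedge(x-h_{n,\varepsilon}(t)).$$ A weak solution of the fluid–structure interaction problem consists of $\varrho_\varepsilon,u_\varepsilon,h_{n,\varepsilon},\omega_{n,\varepsilon}$, with initial data $\varrho_{\varepsilon,0}=\varrho_\varepsilon(0,\cdot)$ and $u_{\varepsilon,0}\in L^2(\Omega;\mathbb R^3)$, such that (with $u_\varepsilon$ extended by $0$ outside $\Omega$ and $\mathbb D=\frac12(\nabla+\nabla^t)$): * *Regularity.* $\varrho_\varepsilon>0$,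 $\varrho_\varepsilon\in L^\infty((0,T)\times\mathbb R^3)\cap C([0,T];L^1(\Omega))$; $u_\varepsilon\in L^\infty(0,T;L^2(\Omega;\mathbb R^3))\cap L^2(0,T;W^{1,2}_0(\Omega;\mathbb R^3))$, $\operatorname{div}u_\varepsilon=0$; $h_{n,\varepsilon},\omega_{n,\varepsilon}\in W^{1,\infty}([0,T];\mathbb R^3)$. * *Compatibility.* $\varrho_\varepsilon(t,x)=\varrho_{\varepsilon,S}$ if $x\in\bigcup_nB_{n,\varepsilon}(t)$ and $\varrho_\varepsilon(t,x)=1$ otherwise, for $t\in[0,T]$; and $u_\varepsilon(t,\cdot)=w_{n,\varepsilon}(t,\cdot)$ a.e. on $B_{n,\varepsilon}(t)$ for all $n$ and a.a. $t\in(0,T)$. * *Mass conservation.* $\displaystyle\int_0^T\!\!\int_{\mathbb R^3}[\varrho_\varepsilon\partial_t\varphi+\varrho_\varepsilon u_\varepsilon\cdot\nabla\varphi]\,dx\,dt=-\int_{\mathbb R^3}\varrho_{\varepsilon,0}\,\varphi(0,\cdot)\,dx$ for all $\varphi\in C^1_c([0,T)\times\mathbb R^3)$. * *Momentum balance.* $$\int_0^T\!\!\int_\Omega\big[\varrho_\varepsilon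 u_\varepsilon\cdot\partial_t\varphi+\varrho_\varepsilon(u_\varepsilon\otimes u_\varepsilon):\nabla\varphi\big]\,dx\,dt=\int_0^T\!\!\int_\Omega\mathbb D u_\varepsilon:\mathbb D\varphi\,dx\,dt-\int_\Omega\varrho_{\varepsilon,0}\,u_{\varepsilon,0}\cdot\varphi(0,\cdot)\,dx$$ for all $\varphi\in C^1_c([0,T)\times\Omega;\mathbb R^3)$ with $\operatorname{div}\varphi=0$ such that, for every $t\in[0,T]$ and $n$, $\mathbb D\varphi(t,\cdot)=0$ on an open neighbourhood of $B_{n,\varepsilon}(t)$. * *Energy dissipation.* $\displaystyle\tfrac12\int_\Omega\varrho_\varepsilon|u_\varepsilon|^2(\tau,\cdot)\,dx+\int_0^\tau\!\!\int_\Omega|\mathbb D u_\varepsilon|^2\,dx\,dt\le\tfrac12\int_\Omega\varrho_{\varepsilon,0}|u_{\varepsilon,0}|^2\,dx$ for a.a. $\tau\in(0,T)$. **Proposition 2.3.** For every $\varepsilon\in(0,\varepsilon_0)$ let such a weak solution be given, and let the initial energies be bounded: $\int_\Omega\varrho_{\varepsilon,0}|u_{\varepsilon,0}|^2\,dx\le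 E_0$ with $E_0$ independent of $\varepsilon$. Suppose that $r_\varepsilon/\varepsilon\to0$ as $\varepsilon\to0$, and that for every $\varepsilon\in(0,\varepsilon_0)$ the centres satisfy $h_{n,\varepsilon}(0)\in\Omega$, $\operatorname{dist}[h_{n,\varepsilon}(0);\partial\Omega]>\varepsilon$ and $|h_{i,\varepsilon}(0)-h_{j,\varepsilon}(0)|>2\varepsilon$ for $i\ne j$. Suppose that the initial velocities $h'_{n,\varepsilon}(0)$ (one-sided derivatives at $t=0$) exist. If $$\sup_{n}\frac{|h_{n,\varepsilon}'(0)|}{\varepsilon}\to0\quad\text{and}\quad\sup_{n}\frac{r_\varepsilon^{1/2}}{\varepsilon\,m_{n,\varepsilon}}\to0\quad\text{as }\varepsilon\to0,$$ then there exist $\bar\varepsilon>0$ and a constant $C$, independent of $n$ and $\varepsilon$, such that for all $0<\varepsilon<\bar\varepsilon$ and all $n$ $$\|h_{n,\varepsilon}'-h_{n,\varepsilon}'(0)\|_{L^\infty(0,T)}+r_\varepsilon\|\omega_{n,\varepsilon}-\omega_{n,\varepsilon}(0)\|_{L^\infty(0,T)}\le C\,\frac{r_\varepsilon^{1/2}}{m_{n,\varepsilon}}.$$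 In particular no collisions occur on $[0,T]$: for $0<\varepsilon<\bar\varepsilon$ and $t\in[0,T]$ the balls $B_{n,\varepsilon}(t)$ are contained in $\Omega$ and pairwise disjoint. -/

import Mathlib

open MeasureTheory Set Filter Topology
open scoped ENNReal NNReal Matrix

noncomputable section

namespace FSI

/-- The physical space `ℝ³` with its Euclidean norm. -/
abbrev E3 : Type := EuclideanSpace ℝ (Fin 3)

/-- `3 × 3` real matrices. -/
abbrev M3 : Type := Matrix (Fin 3) (Fin 3) ℝ

/-- The vector product `a ∧ b` in `ℝ³`. -/
def cross (a b : E3) : E3 := WithLp.toLp 2 (crossProduct (WithLp.ofLp a) (WithLp.ofLp b))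

/-- The classical gradient of a vector field: `(∇φ)ᵢⱼ = ∂ⱼ φᵢ`. -/
def grad (φ : E3 → E3) (x : E3) : M3 :=
  Matrix.of fun i j => (fderiv ℝ φ x (EuclideanSpace.single j (1 : ℝ))) i

/-- The symmetric part `(A + Aᵀ) / 2` of a matrix. -/
def symPart (A : M3) : M3 := (1 / 2 : ℝ) • (A + Aᵀ)

/-- The contraction `A : B = ∑ᵢⱼ Aᵢⱼ Bᵢⱼ`. -/
def contract (A B : M3) : ℝ := ∑ i, ∑ j, A i j * B i j

/-- The tensor product `a ⊗ b`. -/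
def tensor (a b : E3) : M3 := Matrix.of fun i j => a i * b j

/-- `v` belongs to `W₀^{1,2}(Ω; ℝ³)`, with weak gradient `G`: the pair `(v, G)` is the limit in `L²`
of pairs `(φₖ, ∇φₖ)` with `φₖ` smooth and compactly supported in `Ω`. Functions on `Ω` are extended
by zero to the whole space (convergence in `L²(ℝ³)` makes `v` and `G` vanish a.e. outside `Ω`). -/
structure IsW012 (Ω : Set E3) (v : E3 → E3) (G : E3 → M3) : Prop where
  memLp : MemLp v 2 volume
  memLp_grad : ∀ i j, MemLp (fun x => G x i j) 2 volume
  approx : ∃ φ : ℕ → E3 → E3,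
    (∀ k, ContDiff ℝ (⊤ : ℕ∞) (φ k) ∧ HasCompactSupport (φ k) ∧ tsupport (φ k) ⊆ Ω) ∧
    Tendsto (fun k => eLpNorm (fun x => φ k x - v x) 2 volume) atTop (𝓝 0) ∧
    ∀ i j, Tendsto (fun k => eLpNorm (fun x => grad (φ k) x i j - G x i j) 2 volume)
      atTop (𝓝 0)

/-- The unknowns and data of the fluid-structure interaction problem (for one value of `ε`):
`N` balls of common radius `r` and common mass density `rhoS`, with centres `h n t` and angular
velocities `ω n t`; the density `rho`, the velocity `u` (extended by zero outside `Ω`) with its weak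
spatial gradient `gradU`, and the initial velocity `u0`. -/
structure State where
  N : ℕ
  r : ℝ
  rhoS : ℝ
  rho : ℝ → E3 → ℝ
  u : ℝ → E3 → E3
  gradU : ℝ → E3 → M3
  u0 : E3 → E3
  h : Fin N → ℝ → E3
  ω : Fin N → ℝ → E3

namespace State

/-- The (closed) ball occupied by the `n`-th body at time `t`. -/
def body (S : State) (n : Fin S.N) (t : ℝ) : Set E3 := Metric.closedBall (S.h n t) S.r

/-- The rigid velocity `w(t,x) = h'(t) + ω(t) ∧ (x - h(t))` of the `n`-th body. -/
def rigidVel (S : State) (n : Fin S.N) (t : ℝ) (x : E3) : E3 :=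
  deriv (S.h n) t + cross (S.ω n t) (x - S.h n t)

/-- The mass of the `n`-th body (density times volume; it is the same for all bodies). -/
def mass (S : State) (_n : Fin S.N) : ℝ := S.rhoS * volume.real (Metric.closedBall (0 : E3) S.r)

/-- The initial translational velocity `h'(0)` of the `n`-th body: the one-sided derivative. -/
def initVel (S : State) (T : ℝ) (n : Fin S.N) : E3 := derivWithin (S.h n) (Icc 0 T) 0

/-- The initial energy `∫_Ω ρ₀ |u₀|²`, where `ρ₀ = ρ(0, ·)`. -/
def initEnergy (S : State) (Ω : Set E3) : ℝ := ∫ x in Ω, S.rho 0 x * ‖S.u0 x‖ ^ 2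

end State

/-- Scalar test functions `φ ∈ C¹_c([0,T) × ℝ³)` (given as restrictions to `t ≥ 0` of `C¹` functions
with compact support in `(-∞,T) × ℝ³`). -/
structure IsScalarTest (T : ℝ) (φ : ℝ → E3 → ℝ) : Prop where
  contDiff : ContDiff ℝ 1 (fun p : ℝ × E3 => φ p.1 p.2)
  compact : HasCompactSupport (fun p : ℝ × E3 => φ p.1 p.2)
  support : tsupport (fun p : ℝ × E3 => φ p.1 p.2) ⊆ Iio T ×ˢ univ

/-- Test functions of the momentum balance: `φ ∈ C¹_c([0,T) × Ω; ℝ³)` (given as the restriction to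
`t ≥ 0` of a `C¹` function with compact support in `(-∞,T) × Ω`), `div φ = 0`, and at each time the
symmetric gradient of `φ` vanishes on an open neighbourhood of each body. -/
structure IsMomentumTest (Ω : Set E3) (T : ℝ) (S : State) (φ : ℝ → E3 → E3) : Prop where
  contDiff : ContDiff ℝ 1 (fun p : ℝ × E3 => φ p.1 p.2)
  compact : HasCompactSupport (fun p : ℝ × E3 => φ p.1 p.2)
  support : tsupport (fun p : ℝ × E3 => φ p.1 p.2) ⊆ Iio T ×ˢ Ω
  divFree : ∀ t ∈ Icc 0 T, ∀ x, (grad (φ t) x).trace = 0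
  rigid : ∀ t ∈ Icc 0 T, ∀ n : Fin S.N, ∃ U : Set E3, IsOpen U ∧ S.body n t ⊆ U ∧
    ∀ x ∈ U, symPart (grad (φ t) x) = 0

open Classical in
/-- Weak solutions of the fluid-structure interaction problem on `(0,T) × Ω`. -/
structure IsWeakSolution (Ω : Set E3) (T : ℝ) (S : State) : Prop where
  r_pos : 0 < S.r
  rhoS_pos : 0 < S.rhoS
  u0_memLp : MemLp S.u0 2 (volume.restrict Ω)
  -- regularity of the density: positive, in `L^∞((0,T) × ℝ³) ∩ C([0,T]; L¹(Ω))`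
  rho_pos : ∀ t ∈ Icc 0 T, ∀ x, 0 < S.rho t x
  rho_memLp : MemLp (fun p : ℝ × E3 => S.rho p.1 p.2) ∞ ((volume.restrict (Ioo 0 T)).prod volume)
  rho_integrable : ∀ t ∈ Icc 0 T, IntegrableOn (S.rho t) Ω
  rho_continuous : ∀ t ∈ Icc 0 T,
    Tendsto (fun s => eLpNorm (fun x => S.rho s x - S.rho t x) 1 (volume.restrict Ω))
      (𝓝[Icc 0 T] t) (𝓝 0)
  -- regularity of the velocity: in `L^∞(0,T; L²(Ω)) ∩ L²(0,T; W₀^{1,2}(Ω))`, divergence free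
  u_memLp : MemLp (fun p : ℝ × E3 => S.u p.1 p.2) 2 ((volume.restrict (Ioo 0 T)).prod volume)
  gradU_memLp : ∀ i j, MemLp (fun p : ℝ × E3 => S.gradU p.1 p.2 i j) 2
    ((volume.restrict (Ioo 0 T)).prod volume)
  u_bounded : ∃ M : ℝ≥0, ∀ᵐ t ∂(volume.restrict (Ioo 0 T)), eLpNorm (S.u t) 2 volume ≤ M
  u_sobolev : ∀ᵐ t ∂(volume.restrict (Ioo 0 T)), IsW012 Ω (S.u t) (S.gradU t)
  u_divFree : ∀ᵐ t ∂(volume.restrict (Ioo 0 T)), ∀ᵐ x, (S.gradU t x).trace = 0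
  -- regularity of the rigid motions: `W^{1,∞}([0,T])`, that is, Lipschitz continuous
  h_lipschitz : ∀ n, ∃ K : ℝ≥0, LipschitzOnWith K (S.h n) (Icc 0 T)
  ω_lipschitz : ∀ n, ∃ K : ℝ≥0, LipschitzOnWith K (S.ω n) (Icc 0 T)
  -- compatibility
  rho_eq : ∀ t ∈ Icc 0 T, ∀ x, S.rho t x = if ∃ n, x ∈ S.body n t then S.rhoS else 1
  u_rigid : ∀ᵐ t ∂(volume.restrict (Ioo 0 T)), ∀ n,
    ∀ᵐ x ∂(volume.restrict (S.body n t)), S.u t x = S.rigidVel n t x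
  -- mass conservation
  mass_conservation : ∀ φ : ℝ → E3 → ℝ, IsScalarTest T φ →
    ∫ t in Ioo 0 T, ∫ x, (S.rho t x * deriv (fun s => φ s x) t
      + S.rho t x * fderiv ℝ (φ t) x (S.u t x)) = - ∫ x, S.rho 0 x * φ 0 x
  -- momentum balance
  momentum_balance : ∀ φ : ℝ → E3 → E3, IsMomentumTest Ω T S φ →
    ∫ t in Ioo 0 T, ∫ x in Ω, (S.rho t x * inner ℝ (S.u t x) (deriv (fun s => φ s x) t)
      + S.rho t x * contract (tensor (S.u t x) (S.u t x)) (grad (φ t) x))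
    = (∫ t in Ioo 0 T, ∫ x in Ω, contract (symPart (S.gradU t x)) (symPart (grad (φ t) x)))
      - ∫ x in Ω, S.rho 0 x * inner ℝ (S.u0 x) (φ 0 x)
  -- energy dissipation
  energy : ∀ᵐ τ ∂(volume.restrict (Ioo 0 T)),
    1 / 2 * (∫ x in Ω, S.rho τ x * ‖S.u τ x‖ ^ 2)
      + (∫ t in Ioo 0 τ, ∫ x in Ω, contract (symPart (S.gradU t x)) (symPart (S.gradU t x)))
    ≤ 1 / 2 * S.initEnergy Ω

/-- The initial configuration is `ε`-separated: the centres lie in `Ω`, at mutual distances greater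
than `2ε` and at distance greater than `ε` from the boundary. -/
def IsSeparated (Ω : Set E3) (ε : ℝ) (S : State) : Prop :=
  (∀ n, S.h n 0 ∈ Ω ∧ ε < Metric.infDist (S.h n 0) (frontier Ω)) ∧
  ∀ i j, i ≠ j → 2 * ε < dist (S.h i 0) (S.h j 0)

/-- No collision on `[0,T]`: the bodies stay inside `Ω` and pairwise disjoint. -/
def NoCollision (Ω : Set E3) (T : ℝ) (S : State) : Prop :=
  ∀ t ∈ Icc 0 T, (∀ n, S.body n t ⊆ Ω) ∧ ∀ i j, i ≠ j → Disjoint (S.body i t) (S.body j t)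

end FSI

end

/-!
The bodies cannot collide before one of them has moved by a fraction of `ε`, so it suffices to
bound their velocities as long as each of them is isolated, that is, as long as a ball whose
radius is a fixed multiple of `r` around it lies in `Ω` and meets no other body; a continuation
argument (`displacement_le_of_velocity_bound`) then extends the bound to `[0,T]`.

For an isolated body with centre `h(t)` the momentum balance is tested with `ψ(t) V((x - h(t)) /
r)`, where `V` is solenoidal, compactly supported and equal to a rigid field `a + b ∧ y` near
the unit ball (`IsRigidProfile`). Since `h` is only Lipschitz in time, this test function is not
`C¹`; it is reached as a limit of test functions that follow the Steklov averages of `h`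
(`exists_contDiff_approx`, `integral_densities_of_isolated`). The outcome
(`ae_integral_momDensity_eq`) is that `F(t) = ∫ ρ u · V((x - h)/r)` is, for almost every `t`, a
constant minus the time integral of a force.

* On the body the fluid velocity is rigid, so that the body contributes `m h' · a + (J / r) ω ·
  b` to `F`, where `J ≈ m r²` is its moment of inertia; the surrounding fluid contributes at
  most `C r^{3/2}` by the energy bound (`abs_integral_momDensity_sub_le`).
* On the body the inertial force vanishes. In the annulus around it, where the density is `1`,
  it is of the order `r⁻¹ ∫ (|u|² + |h'|²)`, which is at most `C r ∫_Ω |𝔻u|²`: by the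
  inequalities of Sobolev and Korn the `L²` norm of `u` on a ball of radius `3r` gains a factor
  `r` (`exists_setIntegral_sq_le_symGrad`), and `h'` is the mean of `u` over the body.
* The viscous force is at most `C √r (1 + ∫_Ω |𝔻u|²)`, because the gradient of the test function
  is of order `1/r` on a ball of volume `≈ r³` (`abs_integral_stressDensity_le`).

The dissipation is integrable in time by the energy inequality, so `m h' · a + (J / r) ω · b` is
constant up to `C √r` (`exists_momentum_bound`). No compatibility between `u₀` and `h'(0)` is
needed: the same constant is compared with `h'(0)` by averaging `h'` over short intervals, and
with `ω(0)` by continuity (`exists_velocity_bound`).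
-/

noncomputable section

namespace FSI

/-! ### Sobolev and Korn inequalities at the scale of a body -/

section L2

variable {α E : Type*} [MeasurableSpace α] {μ : Measure α} [NormedAddCommGroup E]

lemma integral_sq_norm_eq_eLpNorm {f : α → E} (hf : MemLp f 2 μ) :
    ∫ x, ‖f x‖ ^ 2 ∂μ = (eLpNorm f 2 μ).toReal ^ 2 := by
  rw [hf.eLpNorm_eq_integral_rpow_norm (by norm_num) (by norm_num)]
  have h0 : 0 ≤ ∫ x, ‖f x‖ ^ 2 ∂μ := integral_nonneg fun x => by positivity
  have h2 : (∫ a, ‖f a‖ ^ (2 : ℝ≥0∞).toReal ∂μ) = ∫ x, ‖f x‖ ^ 2 ∂μ := by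
    congr 1; ext x; norm_num
  rw [h2, ENNReal.toReal_ofReal (by positivity), ← Real.rpow_natCast, ← Real.rpow_mul h0]
  norm_num

lemma tendsto_integral_sq_norm {f : ℕ → α → E} {g : α → E} (hf : ∀ k, MemLp (f k) 2 μ)
    (hg : MemLp g 2 μ)
    (h : Tendsto (fun k => eLpNorm (fun x => f k x - g x) 2 μ) atTop (𝓝 0)) :
    Tendsto (fun k => ∫ x, ‖f k x‖ ^ 2 ∂μ) atTop (𝓝 (∫ x, ‖g x‖ ^ 2 ∂μ)) := by
  have h1 := (Lp.tendsto_Lp_iff_tendsto_eLpNorm'' f hf g hg).2 h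
  have h2 := (h1.norm).pow 2
  simp only [Lp.norm_toLp] at h2
  simpa only [integral_sq_norm_eq_eLpNorm hg, fun k => integral_sq_norm_eq_eLpNorm (hf k)] using h2

end L2

section Korn

variable {E : Type*} [NormedAddCommGroup E] [NormedSpace ℝ E] [MeasurableSpace E] [BorelSpace E]
  [FiniteDimensional ℝ E]

/-- Mixed partial derivatives may be exchanged under the integral of a product: integrate by parts
twice and use the symmetry of the second derivative. -/
lemma integral_fderiv_mul_fderiv_comm {μ : Measure E} [μ.IsAddHaarMeasure] {f g : E → ℝ}
    (hf : ContDiff ℝ (⊤ : ℕ∞) f) (hfc : HasCompactSupport f) (hg : ContDiff ℝ (⊤ : ℕ∞) g)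
    (v w : E) :
    ∫ x, fderiv ℝ f x v * fderiv ℝ g x w ∂μ = ∫ x, fderiv ℝ f x w * fderiv ℝ g x v ∂μ := by
  have hdf : ∀ z, ContDiff ℝ (⊤ : ℕ∞) (fun x => fderiv ℝ f x z) := fun z =>
    (hf.fderiv_right (m := (⊤ : ℕ∞)) (by simp)).clm_apply contDiff_const
  have hdg : ∀ z, ContDiff ℝ (⊤ : ℕ∞) (fun x => fderiv ℝ g x z) := fun z =>
    (hg.fderiv_right (m := (⊤ : ℕ∞)) (by simp)).clm_apply contDiff_const
  have hdfc : ∀ z, HasCompactSupport (fun x => fderiv ℝ f x z) := fun z =>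
    hfc.fderiv_apply (𝕜 := ℝ) z
  have key : ∀ v w : E, ∫ x, fderiv ℝ f x v * fderiv ℝ g x w ∂μ
      = - ∫ x, f x * fderiv ℝ (fun y => fderiv ℝ g y w) x v ∂μ := by
    intro v w
    rw [eq_comm, neg_eq_iff_eq_neg,
      integral_mul_fderiv_eq_neg_fderiv_mul_of_integrable]
    · exact ((hdf v).continuous.mul (hdg w).continuous).integrable_of_hasCompactSupport
        ((hdfc v).mul_right)
    · refine (hf.continuous.mul ?_).integrable_of_hasCompactSupport (hfc.mul_right)
      exact ((hdg w).fderiv_right (m := 0) (by simp)).continuous.clm_apply continuous_const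
    · exact (hf.continuous.mul (hdg w).continuous).integrable_of_hasCompactSupport hfc.mul_right
    · exact fun x _ => (hf.differentiable (by simp)) x
    · exact fun x _ => ((hdg w).differentiable (by simp)) x
  rw [key, key]
  congr 2
  ext x
  have hd : DifferentiableAt ℝ (fderiv ℝ g) x :=
    (hg.fderiv_right (m := (⊤ : ℕ∞)) (by simp)).differentiable (by simp) x
  have e : ∀ v w : E, fderiv ℝ (fun y => fderiv ℝ g y w) x v = fderiv ℝ (fderiv ℝ g) x v w := by
    intro v w
    have : HasFDerivAt (fun y => fderiv ℝ g y w) _ x :=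
      hd.hasFDerivAt.clm_apply (hasFDerivAt_const w x)
    rw [this.fderiv]; simp
  rw [e, e, (hg.contDiffAt.isSymmSndFDerivAt (by
    simpa using WithTop.coe_le_coe.2 (le_top : (2 : ℕ∞) ≤ ⊤))) v w]

end Korn

lemma grad_apply {φ : E3 → E3} {x : E3} (h : DifferentiableAt ℝ φ x) (i j : Fin 3) :
    grad φ x i j = fderiv ℝ (fun y => φ y i) x (EuclideanSpace.single j 1) := by
  have : HasFDerivAt (fun y => φ y i) ((EuclideanSpace.proj i).comp (fderiv ℝ φ x)) x :=
    (EuclideanSpace.proj (𝕜 := ℝ) i).hasFDerivAt.comp x h.hasFDerivAt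
  rw [this.fderiv]; rfl

lemma continuous_grad_apply {φ : E3 → E3} (h : ContDiff ℝ 1 φ) (i j : Fin 3) :
    Continuous fun x => grad φ x i j := by
  have h1 : Continuous fun x => fderiv ℝ φ x (EuclideanSpace.single j 1) :=
    (h.continuous_fderiv (by simp)).clm_apply continuous_const
  exact (EuclideanSpace.proj (𝕜 := ℝ) i).continuous.comp h1

lemma hasCompactSupport_grad_apply {φ : E3 → E3} (h : HasCompactSupport φ) (i j : Fin 3) :
    HasCompactSupport fun x => grad φ x i j := by
  have h1 := h.fderiv_apply (𝕜 := ℝ) (EuclideanSpace.single j (1 : ℝ))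
  exact h1.comp_left (g := fun y : E3 => y i) rfl

/-- **Korn's inequality** for smooth compactly supported fields. -/
lemma integral_sq_grad_le {φ : E3 → E3} (hφ : ContDiff ℝ (⊤ : ℕ∞) φ) (hc : HasCompactSupport φ) :
    ∫ x, ∑ i, ∑ j, grad φ x i j ^ 2
      ≤ 2 * ∫ x, contract (symPart (grad φ x)) (symPart (grad φ x)) := by
  have hd : Differentiable ℝ φ := hφ.differentiable (by simp)
  have hφ1 : ContDiff ℝ 1 φ := hφ.of_le (by simp)
  have hcomp : ∀ i, ContDiff ℝ (⊤ : ℕ∞) (fun y => φ y i) := fun i =>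
    (EuclideanSpace.proj (𝕜 := ℝ) i).contDiff.comp hφ
  have hcompc : ∀ i, HasCompactSupport (fun y => φ y i) := fun i =>
    hc.comp_left (g := fun y : E3 => y i) rfl
  have hint : ∀ i j k l, Integrable fun x => grad φ x i j * grad φ x k l := fun i j k l =>
    ((continuous_grad_apply hφ1 i j).mul
      (continuous_grad_apply hφ1 k l)).integrable_of_hasCompactSupport
      ((hasCompactSupport_grad_apply hc i j).mul_right)
  have hswap : ∀ i j, ∫ x, grad φ x i j * grad φ x j i = ∫ x, grad φ x i i * grad φ x j j := by
    intro i j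
    simp only [grad_apply (hd _)]
    exact integral_fderiv_mul_fderiv_comm (hcomp i) (hcompc i) (hcomp j) _ _
  have hpt : ∀ x, 2 * contract (symPart (grad φ x)) (symPart (grad φ x))
      = (∑ i, ∑ j, grad φ x i j ^ 2) + ∑ i, ∑ j, grad φ x i j * grad φ x j i := by
    intro x
    simp only [contract, symPart, Matrix.smul_apply, Matrix.add_apply, Matrix.transpose_apply,
      smul_eq_mul, Fin.sum_univ_three]
    ring
  have hcross : ∫ x, ∑ i, ∑ j, grad φ x i j * grad φ x j i
      = ∫ x, (∑ i, grad φ x i i) ^ 2 := by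
    have : ∀ x, (∑ i, grad φ x i i) ^ 2 = ∑ i, ∑ j, grad φ x i i * grad φ x j j := fun x => by
      rw [sq, Finset.sum_mul_sum]
    simp only [this]
    rw [integral_finsetSum _ fun i _ => integrable_finsetSum _ fun j _ => hint _ _ _ _,
      integral_finsetSum _ fun i _ => integrable_finsetSum _ fun j _ => hint _ _ _ _]
    refine Finset.sum_congr rfl fun i _ => ?_
    rw [integral_finsetSum _ fun j _ => hint _ _ _ _, integral_finsetSum _ fun j _ => hint _ _ _ _]
    exact Finset.sum_congr rfl fun j _ => hswap i j
  rw [← integral_const_mul]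
  simp only [hpt]
  rw [integral_add, hcross]
  · have : 0 ≤ ∫ x, (∑ i, grad φ x i i) ^ 2 := integral_nonneg fun x => sq_nonneg _
    linarith
  · simp only [sq]
    exact integrable_finsetSum _ fun i _ => integrable_finsetSum _ fun j _ => hint _ _ _ _
  · exact integrable_finsetSum _ fun i _ => integrable_finsetSum _ fun j _ => hint _ _ _ _

lemma fderiv_apply_eq_sum (φ : E3 → E3) (x v : E3) (i : Fin 3) :
    (fderiv ℝ φ x v) i = ∑ j, grad φ x i j * v j := by
  have : v = ∑ j, v j • EuclideanSpace.single j (1 : ℝ) := by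
    ext k; simp [Finset.sum_apply, Pi.single_apply]
  conv_lhs => rw [this]
  simp [map_sum, grad, mul_comm, Finset.sum_apply]

lemma norm_fderiv_sq_le (φ : E3 → E3) (x : E3) :
    ‖fderiv ℝ φ x‖ ^ 2 ≤ ∑ i, ∑ j, grad φ x i j ^ 2 := by
  have h : ‖fderiv ℝ φ x‖ ≤ Real.sqrt (∑ i, ∑ j, grad φ x i j ^ 2) := by
    refine ContinuousLinearMap.opNorm_le_bound _ (Real.sqrt_nonneg _) fun v => ?_
    rw [EuclideanSpace.norm_eq v, ← Real.sqrt_mul (by positivity), EuclideanSpace.norm_eq]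
    refine Real.sqrt_le_sqrt ?_
    rw [Finset.sum_mul]
    refine Finset.sum_le_sum fun i _ => ?_
    simp only [Real.norm_eq_abs, sq_abs]
    rw [fderiv_apply_eq_sum]
    exact Finset.sum_mul_sq_le_sq_mul_sq _ _ _
  calc ‖fderiv ℝ φ x‖ ^ 2 ≤ Real.sqrt (∑ i, ∑ j, grad φ x i j ^ 2) ^ 2 := by gcongr
    _ = _ := Real.sq_sqrt (by positivity)

/-- The scale-invariant consequence of the Sobolev inequality `‖φ‖_{L⁶} ≤ C ‖∇φ‖_{L²}`: on a
ball of radius `3r`, the `L²` norm of `φ` gains a factor `r`. -/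
lemma exists_setIntegral_sq_le_grad : ∃ C : ℝ, 0 ≤ C ∧ ∀ φ : E3 → E3, ContDiff ℝ (⊤ : ℕ∞) φ →
    HasCompactSupport φ → ∀ (a : E3) (r : ℝ), 0 < r →
    ∫ x in Metric.ball a (3 * r), ‖φ x‖ ^ 2 ≤ C * r ^ 2 * ∫ x, ∑ i, ∑ j, grad φ x i j ^ 2 := by
  obtain ⟨c, hc6⟩ : ∃ c : ℝ≥0, ∀ φ : E3 → E3, ContDiff ℝ 1 φ → HasCompactSupport φ →
      eLpNorm φ 6 volume ≤ c * eLpNorm (fderiv ℝ φ) 2 volume := by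
    refine ⟨eLpNormLESNormFDerivOfEqInnerConst (volume : Measure E3) ((2 : ℝ≥0) : ℝ),
      fun φ hφ1 hc => ?_⟩
    have := eLpNorm_le_eLpNorm_fderiv_of_eq_inner (volume : Measure E3) hφ1 hc (p := 2) (p' := 6)
      (by norm_num) (by simp) (by simp; norm_num)
    exact_mod_cast this
  obtain ⟨b, hb0, hb⟩ : ∃ b : ℝ, 0 ≤ b ∧ volume (Metric.ball (0 : E3) 3) = ENNReal.ofReal b :=
    ⟨_, ENNReal.toReal_nonneg, (ENNReal.ofReal_toReal measure_ball_lt_top.ne).symm⟩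
  refine ⟨(c * b ^ (1 / 3 : ℝ)) ^ 2, by positivity, fun φ hφ hc a r hr => ?_⟩
  have hφ1 : ContDiff ℝ 1 φ := hφ.of_le (by simp)
  have hS := hc6 φ hφ1 hc
  have hm : MemLp φ 2 (volume.restrict (Metric.ball a (3 * r))) :=
    (hφ.continuous.memLp_of_hasCompactSupport hc).restrict _
  have hcd : HasCompactSupport (fderiv ℝ φ) := hc.fderiv (𝕜 := ℝ)
  have hmd : MemLp (fderiv ℝ φ) 2 volume :=
    (hφ1.continuous_fderiv (by simp)).memLp_of_hasCompactSupport hcd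
  have hvol : volume (Metric.ball a (3 * r)) = ENNReal.ofReal (r ^ 3 * b) := by
    rw [mul_comm, Measure.addHaar_ball_mul_of_pos _ _ hr, ENNReal.ofReal_mul (by positivity),
      hb]
    simp
  have hH : eLpNorm φ 2 (volume.restrict (Metric.ball a (3 * r)))
      ≤ eLpNorm φ 6 volume * ENNReal.ofReal (r * b ^ (1 / 3 : ℝ)) := by
    refine (eLpNorm_le_eLpNorm_mul_rpow_measure_univ (q := 6) (by norm_num)
      hm.aestronglyMeasurable).trans ?_
    rw [Measure.restrict_apply_univ, hvol,
      ENNReal.ofReal_rpow_of_nonneg (by positivity) (by norm_num)]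
    gcongr
    · exact Measure.restrict_le_self
    · have e : (1 / (2 : ℝ≥0∞).toReal - 1 / (6 : ℝ≥0∞).toReal) = 1 / 3 := by norm_num
      rw [e, Real.mul_rpow (by positivity) (by positivity), ← Real.rpow_natCast,
        ← Real.rpow_mul hr.le]
      norm_num
  have hfin : eLpNorm φ 2 (volume.restrict (Metric.ball a (3 * r)))
      ≤ ENNReal.ofReal ((c * b ^ (1 / 3 : ℝ)) * r) * eLpNorm (fderiv ℝ φ) 2 volume := by
    refine (hH.trans (mul_le_mul_left hS _)).trans (le_of_eq ?_)
    rw [mul_right_comm, mul_assoc (c : ℝ), mul_comm _ r,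
      ENNReal.ofReal_mul (by positivity) (p := (c : ℝ)),
      ENNReal.ofReal_coe_nnreal]
  rw [integral_sq_norm_eq_eLpNorm hm]
  have h2 := ENNReal.toReal_mono (ENNReal.mul_ne_top ENNReal.ofReal_ne_top hmd.2.ne) hfin
  rw [ENNReal.toReal_mul, ENNReal.toReal_ofReal (by positivity)] at h2
  calc _ ≤ ((c * b ^ (1 / 3 : ℝ)) * r * (eLpNorm (fderiv ℝ φ) 2 volume).toReal) ^ 2 :=
        pow_le_pow_left₀ ENNReal.toReal_nonneg h2 2
    _ = (c * b ^ (1 / 3 : ℝ)) ^ 2 * r ^ 2 * ∫ x, ‖fderiv ℝ φ x‖ ^ 2 := by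
      rw [integral_sq_norm_eq_eLpNorm hmd]; ring
    _ ≤ _ := by
      refine mul_le_mul_of_nonneg_left (integral_mono
        ((memLp_two_iff_integrable_sq_norm hmd.1).1 hmd) ?_
        fun x => norm_fderiv_sq_le φ x) (by positivity)
      · refine integrable_finsetSum _ fun i _ => integrable_finsetSum _ fun j _ => ?_
        simp only [sq]
        exact ((continuous_grad_apply hφ1 i j).mul
          (continuous_grad_apply hφ1 i j)).integrable_of_hasCompactSupport
          (hasCompactSupport_grad_apply hc i j).mul_right

/-- For `v ∈ W₀^{1,2}(Ω)`, Sobolev's and Korn's inequalities bound the `L²` norm of `v` on a ball of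
radius `3r` by `r` times the `L²(Ω)` norm of the symmetric gradient. -/
lemma exists_setIntegral_sq_le_symGrad : ∃ C : ℝ, 0 ≤ C ∧ ∀ (Ω : Set E3) (v : E3 → E3)
    (G : E3 → M3), IsOpen Ω → IsW012 Ω v G → ∀ (a : E3) (r : ℝ), 0 < r →
    ∫ x in Metric.ball a (3 * r), ‖v x‖ ^ 2
      ≤ C * r ^ 2 * ∫ x in Ω, contract (symPart (G x)) (symPart (G x)) := by
  obtain ⟨C, hC, hS⟩ := exists_setIntegral_sq_le_grad
  refine ⟨C * 2, by positivity, fun Ω v G hΩ hv a r hr => ?_⟩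
  obtain ⟨φ, hφ, hφv, hφG⟩ := hv.approx
  have hφ1 : ∀ k, ContDiff ℝ 1 (φ k) := fun k => (hφ k).1.of_le (by simp)
  have hl : Tendsto (fun k => ∫ x in Metric.ball a (3 * r), ‖φ k x‖ ^ 2) atTop
      (𝓝 (∫ x in Metric.ball a (3 * r), ‖v x‖ ^ 2)) := by
    refine tendsto_integral_sq_norm
      (fun k => ((hφ k).1.continuous.memLp_of_hasCompactSupport (hφ k).2.1).restrict _)
      (hv.memLp.restrict _) ?_
    exact tendsto_of_tendsto_of_tendsto_of_le_of_le tendsto_const_nhds hφv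
      (fun k => zero_le) fun k => eLpNorm_mono_measure _ Measure.restrict_le_self
  have hmg : ∀ k i j, MemLp (fun x => grad (φ k) x i j) 2 volume := fun k i j =>
    (continuous_grad_apply (hφ1 k) i j).memLp_of_hasCompactSupport
      (hasCompactSupport_grad_apply (hφ k).2.1 i j)
  have hsym : ∀ (A : M3) i j, symPart A i j = (1 / 2 : ℝ) * (A i j + A j i) := by
    intro A i j; simp [symPart]
  have hmsG : ∀ i j, MemLp (fun x => symPart (G x) i j) 2 (volume.restrict Ω) := fun i j => by
    simp only [hsym]
    exact (((hv.memLp_grad i j).add (hv.memLp_grad j i)).const_mul _).restrict _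
  have hmsφ : ∀ k i j, MemLp (fun x => symPart (grad (φ k) x) i j) 2 (volume.restrict Ω) :=
    fun k i j => by
    simp only [hsym]
    exact (((hmg k i j).add (hmg k j i)).const_mul _).restrict _
  have hcon : ∀ A : M3, contract A A = ∑ i, ∑ j, ‖A i j‖ ^ 2 := fun A => by
    simp [contract, sq]
  have hr' : Tendsto (fun k => ∫ x in Ω, contract (symPart (grad (φ k) x)) (symPart (grad (φ k) x)))
      atTop (𝓝 (∫ x in Ω, contract (symPart (G x)) (symPart (G x)))) := by
    simp only [hcon]
    have e : ∀ F : E3 → M3, (∀ i j, MemLp (fun x => F x i j) 2 (volume.restrict Ω)) →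
        ∫ x in Ω, ∑ i, ∑ j, ‖F x i j‖ ^ 2 = ∑ i, ∑ j, ∫ x in Ω, ‖F x i j‖ ^ 2 := by
      intro F hF
      have hi : ∀ i j, Integrable (fun x => ‖F x i j‖ ^ 2) (volume.restrict Ω) := fun i j =>
        (hF i j).integrable_norm_pow (by norm_num)
      rw [integral_finsetSum _ fun i _ => integrable_finsetSum _ fun j _ => hi i j]
      exact Finset.sum_congr rfl fun i _ => integral_finsetSum _ fun j _ => hi i j
    rw [e _ hmsG]
    simp only [fun k => e _ (hmsφ k)]
    refine tendsto_finsetSum _ fun i _ => tendsto_finsetSum _ fun j _ => ?_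
    refine tendsto_integral_sq_norm (fun k => hmsφ k i j) (hmsG i j) ?_
    have hb : ∀ k, eLpNorm (fun x => symPart (grad (φ k) x) i j - symPart (G x) i j) 2
        (volume.restrict Ω) ≤ eLpNorm (fun x => grad (φ k) x i j - G x i j) 2 volume
          + eLpNorm (fun x => grad (φ k) x j i - G x j i) 2 volume := by
      intro k
      refine (eLpNorm_mono_measure _ Measure.restrict_le_self).trans ?_
      refine le_trans (eLpNorm_mono (g := fun x => (grad (φ k) x i j - G x i j)
        + (grad (φ k) x j i - G x j i)) fun x => ?_) (eLpNorm_add_le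
          ((hmg k i j).sub (hv.memLp_grad i j)).aestronglyMeasurable
          ((hmg k j i).sub (hv.memLp_grad j i)).aestronglyMeasurable (by norm_num))
      rw [hsym, hsym, Real.norm_eq_abs, Real.norm_eq_abs]
      rw [show (1 / 2 : ℝ) * (grad (φ k) x i j + grad (φ k) x j i) - 1 / 2 * (G x i j + G x j i)
        = 1 / 2 * ((grad (φ k) x i j - G x i j) + (grad (φ k) x j i - G x j i)) by ring, abs_mul]
      rw [abs_of_nonneg (by norm_num : (0 : ℝ) ≤ 1 / 2)]
      linarith [abs_nonneg ((grad (φ k) x i j - G x i j) + (grad (φ k) x j i - G x j i))]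
    have h0 := (hφG i j).add (hφG j i)
    rw [add_zero] at h0
    exact tendsto_of_tendsto_of_tendsto_of_le_of_le tendsto_const_nhds h0 (fun k => zero_le) hb
  refine le_of_tendsto_of_tendsto' hl (hr'.const_mul _) fun k => ?_
  refine (hS (φ k) (hφ k).1 (hφ k).2.1 a r hr).trans ?_
  have hK := integral_sq_grad_le (hφ k).1 (hφ k).2.1
  have hrestr : ∫ x in Ω, contract (symPart (grad (φ k) x)) (symPart (grad (φ k) x))
      = ∫ x, contract (symPart (grad (φ k) x)) (symPart (grad (φ k) x)) := by
    refine setIntegral_eq_integral_of_forall_compl_eq_zero fun x hx => ?_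
    have h0 : fderiv ℝ (φ k) x = 0 := by
      by_contra h
      exact hx ((hφ k).2.2 (support_fderiv_subset ℝ h))
    have : grad (φ k) x = 0 := by ext i j; simp [grad, h0]
    simp [this, symPart, contract]
  rw [hrestr]
  calc _ ≤ C * r ^ 2 * (2 * ∫ x, contract (symPart (grad (φ k) x)) (symPart (grad (φ k) x))) := by
        gcongr
    _ = _ := by ring

/-! ### Rigid velocity fields on balls -/

section Cross

lemma cross_apply_zero (a b : E3) : cross a b 0 = a 1 * b 2 - a 2 * b 1 := by
  simp [cross, crossProduct]
lemma cross_apply_one (a b : E3) : cross a b 1 = a 2 * b 0 - a 0 * b 2 := by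
  simp [cross, crossProduct]
lemma cross_apply_two (a b : E3) : cross a b 2 = a 0 * b 1 - a 1 * b 0 := by
  simp [cross, crossProduct]

lemma inner_eq_sum (a b : E3) : inner ℝ a b = a 0 * b 0 + a 1 * b 1 + a 2 * b 2 := by
  simp [PiLp.inner_apply, Fin.sum_univ_three]; ring

/-- The vector product with a fixed first factor, as a continuous linear map. -/
def crossL (a : E3) : E3 →L[ℝ] E3 :=
  LinearMap.toContinuousLinearMap
    { toFun := cross a
      map_add' := fun x y => by simp [cross]
      map_smul' := fun c x => by simp [cross] }

@[simp] lemma crossL_apply (a b : E3) : crossL a b = cross a b := rfl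

lemma inner_cross_self (a b : E3) : inner ℝ a (cross b a) = 0 := by
  rw [inner_eq_sum, cross_apply_zero, cross_apply_one, cross_apply_two]; ring

lemma inner_cross_cross (w b y : E3) :
    inner ℝ (cross w y) (cross b y) = inner ℝ w b * ‖y‖ ^ 2 - inner ℝ w y * inner ℝ b y := by
  rw [← real_inner_self_eq_norm_sq]
  simp only [inner_eq_sum, cross_apply_zero, cross_apply_one, cross_apply_two]; ring

@[simp] lemma zero_cross (a : E3) : cross 0 a = 0 := by simp [cross]
lemma cross_smul (a : E3) (c : ℝ) (b : E3) : cross a (c • b) = c • cross a b :=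
  (crossL a).map_smul c b
lemma smul_cross (c : ℝ) (a b : E3) : cross (c • a) b = c • cross a b := by simp [cross]

end Cross

section Ball

lemma setIntegral_closedBall_comp_isometry {F : Type*} [NormedAddCommGroup F] [NormedSpace ℝ F]
    (L : E3 ≃ₗᵢ[ℝ] E3) (r : ℝ) (f : E3 → F) :
    ∫ y in Metric.closedBall (0 : E3) r, f (L y) = ∫ y in Metric.closedBall (0 : E3) r, f y := by
  have h := L.measurePreserving.setIntegral_preimage_emb
    L.toHomeomorph.measurableEmbedding f (Metric.closedBall (0 : E3) r)
  rw [← h]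
  congr 2
  ext y; simp

lemma integrableOn_closedBall {F : Type*} [NormedAddCommGroup F] {f : E3 → F}
    (hf : Continuous f) (a : E3) (r : ℝ) : IntegrableOn f (Metric.closedBall a r) :=
  hf.continuousOn.integrableOn_compact (isCompact_closedBall a r)

/-- The reflection of `ℝ³` in the `i`-th coordinate. -/
def flipCoord (i : Fin 3) : E3 ≃ₗᵢ[ℝ] E3 :=
  LinearIsometryEquiv.piLpCongrRight 2 fun k =>
    if k = i then LinearIsometryEquiv.neg ℝ else LinearIsometryEquiv.refl ℝ ℝ

lemma flipCoord_apply (i k : Fin 3) (y : E3) :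
    flipCoord i y k = if k = i then - y k else y k := by
  simp only [flipCoord, LinearIsometryEquiv.piLpCongrRight_apply]
  split_ifs <;> simp

lemma setIntegral_closedBall_coord (r : ℝ) (i : Fin 3) :
    ∫ y in Metric.closedBall (0 : E3) r, y i = 0 := by
  have h := setIntegral_closedBall_comp_isometry (flipCoord i) r (fun y => y i)
  simp only [flipCoord_apply, if_true, integral_neg] at h
  linarith

lemma setIntegral_closedBall_coord_mul (r : ℝ) {i j : Fin 3} (hij : i ≠ j) :
    ∫ y in Metric.closedBall (0 : E3) r, y i * y j = 0 := by
  have h := setIntegral_closedBall_comp_isometry (flipCoord i) r (fun y => y i * y j)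
  simp only [flipCoord_apply, if_true, if_neg hij.symm, neg_mul, integral_neg] at h
  linarith

lemma setIntegral_closedBall_coord_sq (r : ℝ) (i j : Fin 3) :
    ∫ y in Metric.closedBall (0 : E3) r, y i * y i
      = ∫ y in Metric.closedBall (0 : E3) r, y j * y j := by
  have h := setIntegral_closedBall_comp_isometry
    (LinearIsometryEquiv.piLpCongrLeft 2 ℝ ℝ (Equiv.swap i j)) r (fun y => y j * y j)
  rw [← h]
  simp [Equiv.piCongrLeft', LinearIsometryEquiv.piLpCongrLeft_apply]

lemma setIntegral_closedBall_inner (r : ℝ) (p : E3) :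
    ∫ y in Metric.closedBall (0 : E3) r, inner ℝ p y = 0 := by
  have hi : ∀ k (c : ℝ), Integrable (fun y : E3 => c * y k)
      (volume.restrict (Metric.closedBall (0 : E3) r)) := fun k c =>
    integrableOn_closedBall (by fun_prop) _ _
  have e : ∀ y : E3, inner ℝ p y = ∑ k, p k * y k := fun y => by
    rw [inner_eq_sum, Fin.sum_univ_three]
  simp only [e]
  rw [integral_finsetSum _ fun k _ => hi k _]
  simp only [integral_const_mul, setIntegral_closedBall_coord]
  simp

/-- The moment of inertia of the ball of radius `r` with unit density:
`(2/3) ∫_{|y| ≤ r} |y|² dy`. -/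
def ballInertia (r : ℝ) : ℝ := 2 / 3 * ∫ y in Metric.closedBall (0 : E3) r, ‖y‖ ^ 2

lemma setIntegral_closedBall_inner_mul_inner (r : ℝ) (w b : E3) :
    ∫ y in Metric.closedBall (0 : E3) r, inner ℝ w y * inner ℝ b y
      = inner ℝ w b * (1 / 3 * ∫ y in Metric.closedBall (0 : E3) r, ‖y‖ ^ 2) := by
  have hi : ∀ k l (c : ℝ), Integrable (fun y : E3 => c * (y k * y l))
      (volume.restrict (Metric.closedBall (0 : E3) r)) := fun k l c =>
    integrableOn_closedBall (by fun_prop) _ _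
  have hi' : ∀ k l, Integrable (fun y : E3 => y k * y l)
      (volume.restrict (Metric.closedBall (0 : E3) r)) := fun k l =>
    integrableOn_closedBall (by fun_prop) _ _
  have e1 : ∀ y : E3, inner ℝ w y * inner ℝ b y = ∑ k, ∑ l, (w k * b l) * (y k * y l) := by
    intro y; simp only [inner_eq_sum, Fin.sum_univ_three]; ring
  have e2 : ∀ y : E3, ‖y‖ ^ 2 = ∑ k, y k * y k := by
    intro y; rw [← real_inner_self_eq_norm_sq, inner_eq_sum, Fin.sum_univ_three]
  simp only [e1, e2]
  rw [integral_finsetSum _ fun k _ => integrable_finsetSum _ fun l _ => hi _ _ _,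
    integral_finsetSum _ fun k _ => hi' k k]
  simp only [fun k => integral_finsetSum Finset.univ
      fun l (_ : l ∈ Finset.univ) => hi k l (w k * b l),
    integral_const_mul]
  simp only [Fin.sum_univ_three]
  rw [setIntegral_closedBall_coord_mul r (i := 0) (j := 1) (by decide),
    setIntegral_closedBall_coord_mul r (i := 0) (j := 2) (by decide),
    setIntegral_closedBall_coord_mul r (i := 1) (j := 0) (by decide),
    setIntegral_closedBall_coord_mul r (i := 1) (j := 2) (by decide),
    setIntegral_closedBall_coord_mul r (i := 2) (j := 0) (by decide),
    setIntegral_closedBall_coord_mul r (i := 2) (j := 1) (by decide),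
    setIntegral_closedBall_coord_sq r 1 0, setIntegral_closedBall_coord_sq r 2 0, inner_eq_sum]
  ring

lemma setIntegral_closedBall_translate {F : Type*} [NormedAddCommGroup F] [NormedSpace ℝ F]
    (a : E3) (r : ℝ) (f : E3 → F) :
    ∫ x in Metric.closedBall a r, f (x - a) = ∫ y in Metric.closedBall (0 : E3) r, f y := by
  have h := (measurePreserving_sub_right (volume : Measure E3) a).setIntegral_preimage_emb
    (Homeomorph.subRight a).measurableEmbedding f (Metric.closedBall (0 : E3) r)
  rw [← h]
  congr 2
  ext y; simp [dist_eq_norm]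

/-- The inner product in `L²` of two rigid velocity fields on a ball: the translational and the
rotational parts are orthogonal. -/
lemma setIntegral_inner_rigid (a p q w b : E3) (r : ℝ) :
    ∫ x in Metric.closedBall a r, inner ℝ (p + cross w (x - a)) (q + cross b (x - a))
      = volume.real (Metric.closedBall (0 : E3) r) * inner ℝ p q
        + ballInertia r * inner ℝ w b := by
  rw [setIntegral_closedBall_translate a r fun y => inner ℝ (p + cross w y) (q + cross b y)]
  have h1 : ∀ y : E3, inner ℝ (p + cross w y) (q + cross b y) = inner ℝ p q
      + (inner ℝ ((crossL b).adjoint p + (crossL w).adjoint q) y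
        + (inner ℝ w b * ‖y‖ ^ 2 - inner ℝ w y * inner ℝ b y)) := by
    intro y
    rw [inner_add_left, inner_add_left, ContinuousLinearMap.adjoint_inner_left,
      ContinuousLinearMap.adjoint_inner_left, inner_add_right, inner_add_right, inner_cross_cross,
      crossL_apply, crossL_apply, real_inner_comm (cross w y) q]
    ring
  simp only [h1]
  have i1 : IntegrableOn (fun y : E3 => (inner ℝ w y * inner ℝ b y : ℝ))
    (Metric.closedBall (0 : E3) r) := integrableOn_closedBall (by fun_prop) _ _
  have i2 : IntegrableOn (fun y : E3 => (inner ℝ w b * ‖y‖ ^ 2 : ℝ))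
    (Metric.closedBall (0 : E3) r) := integrableOn_closedBall (by fun_prop) _ _
  have i3 : IntegrableOn
    (fun y : E3 => (inner ℝ ((crossL b).adjoint p + (crossL w).adjoint q) y : ℝ))
    (Metric.closedBall (0 : E3) r) := integrableOn_closedBall (by fun_prop) _ _
  have i5 : IntegrableOn (fun y : E3 => (inner ℝ w b * ‖y‖ ^ 2 - inner ℝ w y * inner ℝ b y : ℝ))
    (Metric.closedBall (0 : E3) r) := i2.sub i1
  have i6 : IntegrableOn (fun y : E3 => (inner ℝ ((crossL b).adjoint p + (crossL w).adjoint q) y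
      + (inner ℝ w b * ‖y‖ ^ 2 - inner ℝ w y * inner ℝ b y) : ℝ))
    (Metric.closedBall (0 : E3) r) := i3.add i5
  have i4 : IntegrableOn (fun _ : E3 => (inner ℝ p q : ℝ))
    (Metric.closedBall (0 : E3) r) := integrableOn_closedBall (by fun_prop) _ _
  rw [integral_add i4 i6, integral_add i3 i5, integral_sub i2 i1,
    setIntegral_closedBall_inner, setIntegral_closedBall_inner_mul_inner, integral_const_mul,
    setIntegral_const, ballInertia]
  simp only [smul_eq_mul]
  ring

lemma exists_ballInertia_eq : ∃ c : ℝ, 0 < c ∧ ∀ r : ℝ, 0 < r →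
    ballInertia r = c * r ^ 2 * volume.real (Metric.closedBall (0 : E3) r) := by
  set v : ℝ := volume.real (Metric.closedBall (0 : E3) 1) with hv
  have hvpos : 0 < v := by
    rw [hv, measureReal_def]
    exact ENNReal.toReal_pos (Metric.measure_closedBall_pos _ _ one_pos).ne'
      measure_closedBall_lt_top.ne
  have hpos : 0 < ∫ y in Metric.closedBall (0 : E3) 1, ‖y‖ ^ 2 := by
    rw [setIntegral_pos_iff_support_of_nonneg_ae (Eventually.of_forall fun y => by positivity)
      (integrableOn_closedBall (by fun_prop) _ _)]
    have : Metric.closedBall (0 : E3) 1 \ {0}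
        ⊆ (Function.support fun y : E3 => ‖y‖ ^ 2) ∩ Metric.closedBall 0 1 := by
      rintro y ⟨hy, hy0⟩
      exact ⟨by simpa using hy0, hy⟩
    refine lt_of_lt_of_le ?_ (measure_mono this)
    rw [measure_sdiff_null (measure_singleton _)]
    exact Metric.measure_closedBall_pos _ _ one_pos
  refine ⟨2 / 3 * (∫ y in Metric.closedBall (0 : E3) 1, ‖y‖ ^ 2) / v, by positivity,
    fun r hr => ?_⟩
  have h1 := Measure.setIntegral_comp_smul_of_pos (volume : Measure E3) (fun y => ‖y‖ ^ 2)
    (Metric.closedBall (0 : E3) 1) hr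
  rw [smul_closedBall _ _ zero_le_one, smul_zero, Real.norm_of_nonneg hr.le, mul_one] at h1
  simp only [norm_smul, mul_pow, Real.norm_of_nonneg hr.le, integral_const_mul,
    finrank_euclideanSpace, Fintype.card_fin, smul_eq_mul] at h1
  rw [Measure.addHaar_real_closedBall' _ _ hr.le, ballInertia, ← hv, finrank_euclideanSpace,
    Fintype.card_fin]
  field_simp at h1 ⊢
  linarith

end Ball

/-! ### Solenoidal rigid profiles -/

/-- A `C¹` solenoidal field on `ℝ³`, supported in the ball of radius `√8 < 3`, that coincides with
the rigid field `y ↦ a + b ∧ y` on the ball of radius `2`. Rescaled to the size of a body, such a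
field is the spatial part of a test function that is rigid near this body. -/
structure IsRigidProfile (a b : E3) (V : E3 → E3) : Prop where
  contDiff : ContDiff ℝ 1 V
  eq_zero : ∀ y, 8 ≤ ‖y‖ ^ 2 → V y = 0
  trace_grad : ∀ y, (grad V y).trace = 0
  eq_rigid : ∀ y, ‖y‖ < 2 → V y = a + cross b y

namespace IsRigidProfile

variable {a b : E3} {V : E3 → E3} (hV : IsRigidProfile a b V)
include hV

lemma differentiable : Differentiable ℝ V := hV.contDiff.differentiable (by simp)

lemma fderiv_eq_crossL {y : E3} (hy : ‖y‖ < 2) : fderiv ℝ V y = crossL b := by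
  have h : V =ᶠ[𝓝 y] fun y => a + crossL b y := by
    filter_upwards [(isOpen_lt continuous_norm continuous_const).mem_nhds hy] with z hz
    exact hV.eq_rigid z hz
  rw [h.fderiv_eq]
  exact ((crossL b).hasFDerivAt.const_add a).fderiv

lemma eq_zero_of_le {y : E3} (hy : 3 ≤ ‖y‖) : V y = 0 := hV.eq_zero y (by nlinarith)

lemma fderiv_eq_zero {y : E3} (hy : 3 ≤ ‖y‖) : fderiv ℝ V y = 0 := by
  have hy' : y ∈ {z : E3 | 8 < ‖z‖ ^ 2} := by show 8 < ‖y‖ ^ 2; nlinarith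
  have h : V =ᶠ[𝓝 y] fun _ => 0 := by
    filter_upwards [(isOpen_lt continuous_const (continuous_norm.pow 2)).mem_nhds hy'] with z hz
    exact hV.eq_zero z (le_of_lt hz)
  rw [h.fderiv_eq]; simp

lemma hasCompactSupport : HasCompactSupport V := by
  refine HasCompactSupport.intro (isCompact_closedBall (0 : E3) 3) fun y hy => ?_
  rw [mem_closedBall_zero_iff, not_le] at hy
  exact hV.eq_zero_of_le hy.le

lemma exists_bound : ∃ K : ℝ, 0 < K ∧ ∀ y, ‖V y‖ ≤ K ∧ ‖fderiv ℝ V y‖ ≤ K := by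
  obtain ⟨K₁, h1⟩ := hV.contDiff.continuous.bounded_above_of_compact_support hV.hasCompactSupport
  obtain ⟨K₂, h2⟩ := (hV.contDiff.continuous_fderiv (by simp)).bounded_above_of_compact_support
    (hV.hasCompactSupport.fderiv (𝕜 := ℝ))
  refine ⟨max 1 (max K₁ K₂), by positivity, fun y => ⟨(h1 y).trans ?_, (h2 y).trans ?_⟩⟩ <;> simp

end IsRigidProfile

/-- A smooth cutoff in the variable `s = |y|²`: it is `1` for `s ≤ 5` and `0` for `s ≥ 8`. -/
def cutoff (s : ℝ) : ℝ := Real.smoothTransition ((8 - s) / 3)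

lemma cutoff_contDiff {n : ℕ∞} : ContDiff ℝ n cutoff :=
  Real.smoothTransition.contDiff.comp (by fun_prop)

lemma cutoff_eq_one {s : ℝ} (h : s ≤ 5) : cutoff s = 1 :=
  Real.smoothTransition.one_of_one_le (by linarith)

lemma cutoff_eq_zero {s : ℝ} (h : 8 ≤ s) : cutoff s = 0 :=
  Real.smoothTransition.zero_of_nonpos (by linarith)

lemma deriv_cutoff_of_lt {s : ℝ} (h : s < 5) : deriv cutoff s = 0 := by
  have : cutoff =ᶠ[𝓝 s] fun _ => 1 := by
    filter_upwards [Iio_mem_nhds h] with x hx using cutoff_eq_one (le_of_lt hx)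
  rw [this.deriv_eq]; simp

lemma deriv_cutoff_of_le {s : ℝ} (h : 8 ≤ s) : deriv cutoff s = 0 := by
  have hc : Continuous (deriv cutoff) :=
    (cutoff_contDiff (n := 1)).continuous_deriv (by simp)
  have hsub : closure (Ioi (8 : ℝ)) ⊆ {x | deriv cutoff x = 0} := by
    refine closure_minimal (fun x hx => ?_) (isClosed_eq hc continuous_const)
    have : cutoff =ᶠ[𝓝 x] fun _ => 0 := by
      filter_upwards [Ioi_mem_nhds hx] with z hz using cutoff_eq_zero (le_of_lt hz)
    show deriv cutoff x = 0
    rw [this.deriv_eq]; simp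
  exact hsub (by rw [closure_Ioi]; exact h)

lemma trace_grad_eq {V : E3 → E3} {V' : E3 →L[ℝ] E3} {y : E3} (h : HasFDerivAt V V' y) :
    (grad V y).trace = ∑ i, V' (EuclideanSpace.single i 1) i := by
  simp [Matrix.trace, grad, h.fderiv]

lemma hasFDerivAt_comp_norm_sq {p : ℝ → ℝ} (hp : ContDiff ℝ 1 p) (y : E3) :
    HasFDerivAt (fun y : E3 => p (‖y‖ ^ 2)) (deriv p (‖y‖ ^ 2) • (2 • innerSL ℝ y)) y :=
  ((hp.differentiable (by simp) _).hasDerivAt).comp_hasFDerivAt y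
    (hasStrictFDerivAt_norm_sq y).hasFDerivAt

/-- A solenoidal field that is the constant `a` near the origin, namely
`½ curl (χ(|y|²) a ∧ y) = (χ + |y|² χ') a - χ' (a · y) y`. -/
lemma exists_translation_profile (a : E3) : ∃ V, IsRigidProfile a 0 V := by
  have hχ1 : ContDiff ℝ 1 (deriv cutoff) :=
    ((contDiff_succ_iff_deriv (n := 1)).1 (cutoff_contDiff (n := 2))).2.2
  have hχd : Differentiable ℝ (deriv cutoff) := hχ1.differentiable (by simp)
  have hχd0 : Differentiable ℝ cutoff := (cutoff_contDiff (n := 1)).differentiable (by simp)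
  set p : ℝ → ℝ := fun s => cutoff s + s * deriv cutoff s with hp_def
  have hp : ContDiff ℝ 1 p := cutoff_contDiff.add (contDiff_id.mul hχ1)
  have hp' : ∀ s, deriv p s = 2 * deriv cutoff s + s * deriv (deriv cutoff) s := by
    intro s
    have := (hχd0 s).hasDerivAt.add ((hasDerivAt_id s).mul (hχd s).hasDerivAt)
    rw [show p = cutoff + id * deriv cutoff from rfl, this.deriv]
    simp; ring
  refine ⟨fun y => p (‖y‖ ^ 2) • a - (deriv cutoff (‖y‖ ^ 2) * inner ℝ a y) • y, ?_, ?_, ?_, ?_⟩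
  · have h2 : ContDiff ℝ 1 fun y : E3 => ‖y‖ ^ 2 := contDiff_norm_sq ℝ
    exact ((hp.comp h2).smul contDiff_const).sub
      (((hχ1.comp h2).mul (contDiff_const.inner ℝ contDiff_id)).smul contDiff_id)
  · intro y hy
    simp [hp_def, cutoff_eq_zero hy, deriv_cutoff_of_le hy]
  · intro y
    have h := ((hasFDerivAt_comp_norm_sq hp y).smul_const a).sub
      (((hasFDerivAt_comp_norm_sq hχ1 y).mul ((innerSL ℝ a).hasFDerivAt (x := y))).smul
        (hasFDerivAt_id y))
    refine (trace_grad_eq h).trans ?_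
    have hy2 : ‖y‖ ^ 2 = y 0 * y 0 + y 1 * y 1 + y 2 * y 2 := by
      rw [← real_inner_self_eq_norm_sq, inner_eq_sum]
    simp only [Fin.sum_univ_three, hp']
    simp [inner_eq_sum]
    rw [hy2]
    ring
  · intro y hy
    have : ‖y‖ ^ 2 < 5 := by nlinarith [norm_nonneg y]
    simp [hp_def, cutoff_eq_one this.le, deriv_cutoff_of_lt this]

/-- A solenoidal field that is the rotation `b ∧ y` near the origin. -/
lemma exists_rotation_profile (b : E3) : ∃ V, IsRigidProfile 0 b V := by
  refine ⟨fun y => cutoff (‖y‖ ^ 2) • crossL b y, ?_, ?_, ?_, ?_⟩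
  · exact (cutoff_contDiff.comp (contDiff_norm_sq ℝ)).smul (crossL b).contDiff
  · intro y hy
    simp [cutoff_eq_zero hy]
  · intro y
    have h := (hasFDerivAt_comp_norm_sq cutoff_contDiff y).smul ((crossL b).hasFDerivAt (x := y))
    refine (trace_grad_eq h).trans ?_
    simp only [Fin.sum_univ_three]
    simp [cross_apply_zero, cross_apply_one, cross_apply_two, inner_eq_sum]
    ring
  · intro y hy
    have : ‖y‖ ^ 2 < 5 := by nlinarith [norm_nonneg y]
    simp [cutoff_eq_one this.le]

/-! ### Lipschitz curves and weak derivatives in time -/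

section Lipschitz

variable {F : Type*} [NormedAddCommGroup F] [NormedSpace ℝ F]

/-- **Steklov averages.** A Lipschitz curve on `[0,T]`, extended by constants, is a uniform limit of
`C¹` curves whose derivatives are bounded by the Lipschitz constant and converge at every point of
differentiability in `(0,T)`. -/
lemma exists_contDiff_approx [CompleteSpace F] {T : ℝ} (hT : 0 < T) {K : ℝ≥0} {h : ℝ → F}
    (hh : LipschitzOnWith K h (Icc 0 T)) :
    ∃ g : ℕ → ℝ → F, (∀ k, ContDiff ℝ 1 (g k)) ∧
      (∀ k t, ‖g k t - h (projIcc 0 T hT.le t)‖ ≤ K * (1 / (k + 1))) ∧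
      (∀ k t, ‖deriv (g k) t‖ ≤ K) ∧
      ∀ t ∈ Ioo 0 T, DifferentiableAt ℝ h t →
        Tendsto (fun k => deriv (g k) t) atTop (𝓝 (deriv h t)) := by
  set e : ℝ → F := fun t => h (projIcc 0 T hT.le t) with he
  have hlip : LipschitzWith K e := by
    have h1 : LipschitzWith (K * 1) e :=
      (lipschitzOnWith_iff_restrict.1 hh).comp (LipschitzWith.projIcc hT.le)
    simpa using h1
  have hcont : Continuous e := hlip.continuous
  set P : ℝ → F := fun t => ∫ s in (0 : ℝ)..t, e s with hP
  have hPd : ∀ t, HasDerivAt P (e t) t := fun t => (hcont.integral_hasStrictDerivAt 0 t).hasDerivAt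
  have hP1 : ContDiff ℝ 1 P := by
    rw [contDiff_one_iff_deriv]
    refine ⟨fun t => (hPd t).differentiableAt, ?_⟩
    rw [show deriv P = e from funext fun t => (hPd t).deriv]
    exact hcont
  have hk : ∀ k : ℕ, (0 : ℝ) < 1 / (k + 1) := fun k => by positivity
  have hg : ∀ (k : ℕ) t, HasDerivAt
      (fun t => ((1 : ℝ) / (k + 1))⁻¹ • (P (t + 1 / (k + 1)) - P t))
      (((1 : ℝ) / (k + 1))⁻¹ • (e (t + 1 / (k + 1)) - e t)) t := fun k t =>
    (((hPd _).comp_add_const t (1 / ((k : ℝ) + 1))).sub (hPd t)).const_smul _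
  refine ⟨fun k t => ((1 : ℝ) / (k + 1))⁻¹ • (P (t + 1 / (k + 1)) - P t), fun k => ?_,
    fun k t => ?_, fun k t => ?_, fun t ht hd => ?_⟩
  · exact contDiff_const.smul ((hP1.comp (contDiff_id.add contDiff_const)).sub hP1)
  · have hi : ∀ a b, IntervalIntegrable e volume a b := fun a b => hcont.intervalIntegrable a b
    have e1 : P (t + 1 / (k + 1)) - P t = ∫ s in t..(t + 1 / (k + 1)), e s :=
      intervalIntegral.integral_interval_sub_left (hi _ _) (hi _ _)
    have e2 : ((1 : ℝ) / (k + 1))⁻¹ • (P (t + 1 / (k + 1)) - P t) - e t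
        = ((1 : ℝ) / (k + 1))⁻¹ • ∫ s in t..(t + 1 / (k + 1)), (e s - e t) := by
      rw [intervalIntegral.integral_sub (hi _ _) intervalIntegrable_const, e1, smul_sub,
        intervalIntegral.integral_const, add_sub_cancel_left, smul_smul,
        inv_mul_cancel₀ (hk k).ne', one_smul]
    have e3 : ‖∫ s in t..(t + 1 / (k + 1)), (e s - e t)‖
        ≤ (K * (1 / (k + 1))) * |t + 1 / (k + 1) - t| := by
      refine intervalIntegral.norm_integral_le_of_norm_le_const fun s hs => ?_
      rw [uIoc_of_le (by linarith [hk k])] at hs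
      refine (hlip.norm_sub_le _ _).trans ?_
      gcongr
      rw [Real.norm_eq_abs, abs_le]
      constructor <;> linarith [hs.1, hs.2, hk k]
    show ‖((1 : ℝ) / (k + 1))⁻¹ • (P (t + 1 / (k + 1)) - P t) - e t‖ ≤ _
    rw [e2, norm_smul, norm_inv, Real.norm_of_nonneg (hk k).le]
    rw [add_sub_cancel_left, abs_of_pos (hk k)] at e3
    rw [inv_mul_le_iff₀ (hk k)]
    linarith
  · rw [(hg k t).deriv, norm_smul, norm_inv, Real.norm_of_nonneg (hk k).le, inv_mul_le_iff₀ (hk k)]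
    refine (hlip.norm_sub_le _ _).trans ?_
    rw [add_sub_cancel_left, Real.norm_of_nonneg (hk k).le, mul_comm]
  · have heq : e =ᶠ[𝓝 t] h := by
      filter_upwards [Ioo_mem_nhds ht.1 ht.2] with s hs
      simp [he, projIcc_of_mem hT.le (Ioo_subset_Icc_self hs)]
    have hed : HasDerivAt e (deriv h t) t := hd.hasDerivAt.congr_of_eventuallyEq heq
    have h0 : Tendsto (fun k : ℕ => (1 : ℝ) / (k + 1)) atTop (𝓝[>] 0) :=
      tendsto_nhdsWithin_iff.2 ⟨tendsto_one_div_add_atTop_nhds_zero_nat,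
        Eventually.of_forall fun k => hk k⟩
    have := hed.tendsto_slope_zero_right.comp h0
    refine this.congr fun k => ?_
    exact (hg k t).deriv.symm

lemma ae_differentiableAt_Ioo_of_lipschitzOn [FiniteDimensional ℝ F] {T : ℝ} {K : ℝ≥0}
    {h : ℝ → F} (hh : LipschitzOnWith K h (Icc 0 T)) :
    ∀ᵐ t ∂(volume.restrict (Ioo 0 T)), DifferentiableAt ℝ h t := by
  filter_upwards [hh.mono Ioo_subset_Icc_self |>.ae_differentiableWithinAt measurableSet_Ioo,
    ae_restrict_mem measurableSet_Ioo] with t ht htm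
  exact ht.differentiableAt (Ioo_mem_nhds htm.1 htm.2)

lemma norm_deriv_le_of_lipschitzOn_Icc {T : ℝ} {K : ℝ≥0} {h : ℝ → F}
    (hh : LipschitzOnWith K h (Icc 0 T)) {t : ℝ} (ht : t ∈ Ioo 0 T) : ‖deriv h t‖ ≤ K :=
  norm_deriv_le_of_lipschitzOn (Icc_mem_nhds ht.1 ht.2) hh

/-- The mean value inequality for Lipschitz curves, from a bound on the derivative that holds almost
everywhere. -/
lemma norm_sub_sub_smul_le_of_ae_deriv {f : ℝ → E3} {τ M : ℝ} {K : ℝ≥0} {c : E3}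
    (hf : LipschitzOnWith K f (Icc 0 τ))
    (hM : ∀ᵐ t ∂(volume.restrict (Ioo 0 τ)), ‖deriv f t - c‖ ≤ M) {t : ℝ} (ht : t ∈ Icc 0 τ) :
    ‖f t - f 0 - t • c‖ ≤ M * t := by
  set d := f t - f 0 - t • c with hd
  have hsub : Icc 0 t ⊆ Icc 0 τ := Icc_subset_Icc_right ht.2
  have hL : LipschitzOnWith (‖innerSL ℝ d‖₊ * K) (fun s => innerSL ℝ d (f s)) (uIcc 0 t) := by
    rw [uIcc_of_le ht.1]
    exact (innerSL ℝ d).lipschitz.comp_lipschitzOnWith (hf.mono hsub)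
  have hAC := hL.absolutelyContinuousOnInterval
  have h1 := hAC.integral_deriv_eq_sub
  have hM' : ∀ᵐ s ∂(volume.restrict (Ioc 0 t)),
      deriv (fun s => innerSL ℝ d (f s)) s ≤ inner ℝ d c + ‖d‖ * M := by
    rw [restrict_Ioo_eq_restrict_Ioc.symm]
    have hr : ∀ᵐ s ∂(volume.restrict (Ioo 0 t)), ‖deriv f s - c‖ ≤ M :=
      ae_restrict_of_ae_restrict_of_subset (Ioo_subset_Ioo_right ht.2) hM
    filter_upwards [hr, ae_differentiableAt_Ioo_of_lipschitzOn (hf.mono hsub)] with s hs hs'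
    have : HasDerivAt (fun s => innerSL ℝ d (f s)) (innerSL ℝ d (deriv f s)) s :=
      (innerSL ℝ d).hasFDerivAt.comp_hasDerivAt s hs'.hasDerivAt
    rw [this.deriv, innerSL_apply_apply]
    have h2 : inner ℝ d (deriv f s) = inner ℝ d c + inner ℝ d (deriv f s - c) := by
      rw [inner_sub_right]; ring
    rw [h2]
    gcongr
    exact (real_inner_le_norm _ _).trans (by gcongr)
  have h3 : ∫ s in (0 : ℝ)..t, deriv (fun s => innerSL ℝ d (f s)) s
      ≤ ∫ s in (0 : ℝ)..t, (inner ℝ d c + ‖d‖ * M) := by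
    refine intervalIntegral.integral_mono_ae_restrict ht.1 hAC.intervalIntegrable_deriv
      intervalIntegrable_const ?_
    rwa [← restrict_Ioc_eq_restrict_Icc]
  rw [h1, intervalIntegral.integral_const, smul_eq_mul, sub_zero, innerSL_apply_apply,
    innerSL_apply_apply] at h3
  have h4 : ‖d‖ ^ 2 = inner ℝ d (f t) - inner ℝ d (f 0) - t * inner ℝ d c := by
    rw [← real_inner_self_eq_norm_sq]
    conv_lhs => rw [hd, ← hd, inner_sub_right, inner_sub_right, inner_smul_right]
  have h5 : ‖d‖ * ‖d‖ ≤ ‖d‖ * (M * t) := by nlinarith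
  rcases (norm_nonneg d).eq_or_lt with h0 | h0
  · rw [← h0]
    rcases ht.1.eq_or_lt with h00 | h00
    · simp [← h00]
    · have hne : (ae (volume.restrict (Ioo 0 τ))).NeBot := by
        rw [ae_neBot, Ne, Measure.restrict_eq_zero, Real.volume_Ioo]
        simpa using h00.trans_le ht.2
      obtain ⟨s, hs⟩ := hM.exists
      have := (norm_nonneg _).trans hs
      positivity
  · exact le_of_mul_le_mul_left h5 h0

end Lipschitz

section Distribution

/-- If `∫₀ᵀ (ψ' F - ψ H) = - ψ(0) A` for all `C¹` functions `ψ` with compact support in `(-∞, τ)`,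
then `F(t) = A - ∫₀ᵗ H` for almost all `t ∈ (0, τ)`. -/
lemma ae_eq_sub_integral_of_weak_deriv {F H : ℝ → ℝ} {T τ A : ℝ} (hτ : τ ≤ T)
    (hF : IntegrableOn F (Ioo 0 T)) (hH : IntegrableOn H (Ioo 0 T))
    (hweak : ∀ ψ : ℝ → ℝ, ContDiff ℝ 1 ψ → HasCompactSupport ψ → tsupport ψ ⊆ Iio τ →
      ∫ t in Ioo 0 T, (deriv ψ t * F t - ψ t * H t) = - (ψ 0 * A)) :
    ∀ᵐ t ∂(volume.restrict (Ioo 0 τ)), F t = A - ∫ s in (0 : ℝ)..t, H s := by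
  rcases le_or_gt τ 0 with hτ0 | hτ0
  · simp [Ioo_eq_empty_of_le hτ0]
  have hT : 0 < T := hτ0.trans_le hτ
  have hsub : Ioo 0 τ ⊆ Ioo 0 T := Ioo_subset_Ioo_right hτ
  set P : ℝ → ℝ := fun t => ∫ s in (0 : ℝ)..t, H s with hP
  have hHi : IntervalIntegrable H volume 0 T :=
    (intervalIntegrable_iff_integrableOn_Ioo_of_le hT.le).2 hH
  have hPac : AbsolutelyContinuousOnInterval P 0 T :=
    hHi.absolutelyContinuousOnInterval_intervalIntegral left_mem_uIcc
  have hPc : ContinuousOn P (Icc 0 T) := by simpa [uIcc_of_le hT.le] using hPac.continuousOn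
  have hPi : IntegrableOn P (Ioo 0 T) := (hPc.integrableOn_Icc).mono_set Ioo_subset_Icc_self
  have hPd : ∀ᵐ t ∂(volume.restrict (Ioo 0 T)), deriv P t = H t := by
    rw [ae_restrict_iff' measurableSet_Ioo]
    filter_upwards [hHi.ae_hasDerivAt_integral] with t ht htm
    exact (ht (by rw [uIcc_of_le hT.le]; exact Ioo_subset_Icc_self htm) 0 left_mem_uIcc).deriv
  have hG : IntegrableOn (fun t => F t - A + P t) (Ioo 0 T) :=
    (hF.sub (integrableOn_const (by simp))).add hPi
  have key : ∀ᵐ t, t ∈ Ioo 0 τ → F t - A + P t = 0 := by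
    refine isOpen_Ioo.ae_eq_zero_of_integral_contDiff_smul_eq_zero
      (hG.mono_set hsub).locallyIntegrableOn fun θ hθ hθc hθs => ?_
    have hθcont : Continuous θ := hθ.continuous
    have hθi : ∀ a b, IntervalIntegrable θ volume a b := fun a b => hθcont.intervalIntegrable a b
    have hθ0 : ∀ t, t ∉ Ioo 0 τ → θ t = 0 := fun t ht =>
      image_eq_zero_of_notMem_tsupport fun h => ht (hθs h)
    -- the primitive of `θ` that vanishes for `t ≥ τ`
    set q : ℝ → ℝ := fun t => ∫ s in τ..t, θ s with hq
    have hqd : ∀ t, HasDerivAt q (θ t) t := fun t =>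
      (hθcont.integral_hasStrictDerivAt τ t).hasDerivAt
    have hq1 : ContDiff ℝ 1 q := by
      rw [contDiff_one_iff_deriv]
      refine ⟨fun t => (hqd t).differentiableAt, ?_⟩
      rw [show deriv q = θ from funext fun t => (hqd t).deriv]
      exact hθcont
    obtain ⟨b, hbτ, hb⟩ : ∃ b < τ, ∀ t, b ≤ t → θ t = 0 := by
      rcases (tsupport θ).eq_empty_or_nonempty with h | h
      · refine ⟨τ - 1, by linarith, fun t _ => ?_⟩
        exact image_eq_zero_of_notMem_tsupport (by simp [h])
      · obtain ⟨m, hm, hmax⟩ := hθc.exists_isMaxOn h (continuous_id.continuousOn)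
        refine ⟨(m + τ) / 2, by linarith [(hθs hm).2], fun t ht => ?_⟩
        refine image_eq_zero_of_notMem_tsupport fun h' => ?_
        have h1 : t ≤ m := hmax h'
        linarith [(hθs hm).2]
    have hqb : ∀ t, b ≤ t → q t = 0 := by
      intro t ht
      refine intervalIntegral.integral_zero_ae (Eventually.of_forall fun s hs => hb s ?_)
      rcases le_total τ t with h | h
      · rw [uIoc_of_le h] at hs; linarith [hs.1]
      · rw [uIoc_of_ge h] at hs; linarith [hs.1]
    -- `q` is constant, but not zero, for negative times, where a cutoff makes it a test function
    set η : ℝ → ℝ := fun t => Real.smoothTransition (t + 2) with hη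
    have hη1 : ContDiff ℝ 1 η := Real.smoothTransition.contDiff.comp (by fun_prop)
    set ψ : ℝ → ℝ := fun t => η t * q t with hψ
    have hψsupp : tsupport ψ ⊆ Icc (-2) b := by
      refine closure_minimal (fun t ht => ?_) isClosed_Icc
      by_contra hcon
      refine ht ?_
      rw [mem_Icc, not_and_or, not_le, not_le] at hcon
      rcases hcon with h | h
      · simp [hψ, hη, Real.smoothTransition.zero_of_nonpos (by linarith : t + 2 ≤ 0)]
      · simp [hψ, hqb t h.le]
    have hψq : ∀ t, -1 < t → ψ =ᶠ[𝓝 t] q := fun t ht => by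
      filter_upwards [Ioi_mem_nhds ht] with s hs
      have hs : -1 < s := hs
      simp [hψ, hη, Real.smoothTransition.one_of_one_le (by linarith : 1 ≤ s + 2)]
    have hw := hweak ψ (hη1.mul hq1)
      (HasCompactSupport.of_support_subset_isCompact isCompact_Icc
        ((subset_tsupport _).trans hψsupp))
      (hψsupp.trans fun t ht => lt_of_le_of_lt ht.2 hbτ)
    have e1 : ∫ t in Ioo 0 T, (deriv ψ t * F t - ψ t * H t)
        = ∫ t in Ioo 0 T, (θ t * F t - q t * H t) := by
      refine setIntegral_congr_fun measurableSet_Ioo fun t ht => ?_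
      have h1 := hψq t (by linarith [ht.1])
      show deriv ψ t * F t - ψ t * H t = θ t * F t - q t * H t
      rw [h1.deriv_eq, h1.eq_of_nhds, (hqd t).deriv]
    obtain ⟨M, hM⟩ := hθcont.bounded_above_of_compact_support hθc
    have hbθ : ∀ {G : ℝ → ℝ}, IntegrableOn G (Ioo 0 T) →
        IntegrableOn (fun t => θ t * G t) (Ioo 0 T) := fun hG' =>
      hG'.bdd_mul hθcont.aestronglyMeasurable (Eventually.of_forall hM)
    have hqH : IntegrableOn (fun t => q t * H t) (Ioo 0 T) := by
      have hqc : ContinuousOn q (Icc 0 T) := hq1.continuous.continuousOn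
      obtain ⟨M', hM'⟩ := isCompact_Icc.exists_bound_of_continuousOn hqc
      exact Integrable.bdd_mul hH hq1.continuous.aestronglyMeasurable
        (ae_restrict_of_forall_mem measurableSet_Ioo fun t ht => hM' t (Ioo_subset_Icc_self ht))
    have hθint : ∫ t in Ioo 0 T, θ t = - q 0 := by
      rw [← integral_Ioc_eq_integral_Ioo, ← intervalIntegral.integral_of_le hT.le,
        intervalIntegral.integral_eq_sub_of_hasDerivAt (fun t _ => hqd t) (hθi _ _),
        hqb T (hbτ.le.trans hτ), zero_sub]
    have hparts : ∫ t in Ioo 0 T, q t * H t = - ∫ t in Ioo 0 T, θ t * P t := by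
      have h1 := (hq1.contDiffOn (s := uIcc 0 T)).absolutelyContinuousOnInterval
        |>.integral_mul_deriv_eq_deriv_mul hPac
      rw [hqb T (hbτ.le.trans hτ), intervalIntegral.integral_of_le hT.le,
        intervalIntegral.integral_of_le hT.le, integral_Ioc_eq_integral_Ioo,
        integral_Ioc_eq_integral_Ioo, show P 0 = 0 from intervalIntegral.integral_same] at h1
      have h2 : ∫ t in Ioo 0 T, q t * H t = ∫ t in Ioo 0 T, q t * deriv P t := by
        refine integral_congr_ae ?_
        filter_upwards [hPd] with t ht
        rw [ht]
      rw [h2, h1]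
      simp [(hqd _).deriv]
    have e2 : ∫ t, θ t • (F t - A + P t) = ∫ t in Ioo 0 T, θ t • (F t - A + P t) := by
      refine (setIntegral_eq_integral_of_forall_compl_eq_zero fun t ht => ?_).symm
      rw [hθ0 t fun h => ht (hsub h), zero_smul]
    have hψ0 : ψ 0 = q 0 := (hψq 0 (by norm_num)).eq_of_nhds
    rw [e1, integral_sub (hbθ hF) hqH, hparts, hψ0] at hw
    rw [e2]
    have e3 : ∀ t, θ t • (F t - A + P t) = θ t * F t - A * θ t + θ t * P t := fun t => by
      rw [smul_eq_mul]; ring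
    simp only [e3]
    have hθI : IntegrableOn (fun t => A * θ t) (Ioo 0 T) :=
      ((hθcont.integrable_of_hasCompactSupport hθc).const_mul A).integrableOn
    have hFA : IntegrableOn (fun t => θ t * F t - A * θ t) (Ioo 0 T) := (hbθ hF).sub hθI
    rw [integral_add hFA (hbθ hPi), integral_sub (hbθ hF) hθI, integral_const_mul, hθint]
    linarith
  rw [ae_restrict_iff' measurableSet_Ioo]
  filter_upwards [key] with t ht htm
  have := ht htm
  linarith

end Distribution

/-! ### Test functions that follow a body -/

lemma contract_tensor_grad (φ : E3 → E3) (x v : E3) :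
    contract (tensor v v) (grad φ x) = inner ℝ v (fderiv ℝ φ x v) := by
  simp only [inner_eq_sum, fderiv_apply_eq_sum, contract, tensor, Fin.sum_univ_three,
    Matrix.of_apply]
  ring

lemma contract_smul_right (c : ℝ) (A B : M3) : contract A (c • B) = c * contract A B := by
  simp only [contract, Matrix.smul_apply, smul_eq_mul, Finset.mul_sum]
  exact Finset.sum_congr rfl fun i _ => Finset.sum_congr rfl fun j _ => by ring

lemma symPart_smul (c : ℝ) (A : M3) : symPart (c • A) = c • symPart A := by
  simp only [symPart, Matrix.transpose_smul, ← smul_add, smul_comm c]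

lemma symPart_apply (A : M3) (i j : Fin 3) : symPart A i j = 1 / 2 * (A i j + A j i) := by
  simp [symPart]

lemma abs_grad_apply_le (φ : E3 → E3) (x : E3) (i j : Fin 3) :
    |grad φ x i j| ≤ ‖fderiv ℝ φ x‖ := by
  have h1 : |grad φ x i j| ≤ ‖fderiv ℝ φ x (EuclideanSpace.single j 1)‖ :=
    PiLp.norm_apply_le (fderiv ℝ φ x (EuclideanSpace.single j 1)) i
  refine h1.trans ((ContinuousLinearMap.le_opNorm _ _).trans (by simp))

lemma abs_symPart_grad_apply_le (φ : E3 → E3) (x : E3) (i j : Fin 3) :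
    |symPart (grad φ x) i j| ≤ ‖fderiv ℝ φ x‖ := by
  rw [symPart_apply, abs_mul, abs_of_nonneg (by norm_num : (0 : ℝ) ≤ 1 / 2)]
  have := abs_add_le (grad φ x i j) (grad φ x j i)
  linarith [abs_grad_apply_le φ x i j, abs_grad_apply_le φ x j i]

lemma IsRigidProfile.symPart_grad_eq_zero {a b : E3} {V : E3 → E3} (hV : IsRigidProfile a b V)
    {y : E3} (hy : ‖y‖ < 2 ∨ 3 ≤ ‖y‖) : symPart (grad V y) = 0 := by
  rcases hy with hy | hy
  · ext i j
    rw [symPart_apply]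
    simp only [grad, hV.fderiv_eq_crossL hy, crossL_apply, Matrix.of_apply, Matrix.zero_apply]
    fin_cases i <;> fin_cases j <;>
      simp [cross_apply_zero, cross_apply_one, cross_apply_two]
  · ext i j
    simp [symPart_apply, grad, hV.fderiv_eq_zero hy]

/-- The field `V` transported to the ball of radius `r` centred at `c`. -/
def rescale (V : E3 → E3) (r : ℝ) (c x : E3) : E3 := V (r⁻¹ • (x - c))

lemma hasFDerivAt_rescale {V : E3 → E3} (hV : Differentiable ℝ V) (r : ℝ) (c x : E3) :
    HasFDerivAt (rescale V r c) (r⁻¹ • fderiv ℝ V (r⁻¹ • (x - c))) x := by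
  have h1 : HasFDerivAt (fun x : E3 => r⁻¹ • (x - c)) (r⁻¹ • ContinuousLinearMap.id ℝ E3) x :=
    ((hasFDerivAt_id x).sub_const c).const_smul r⁻¹
  have h2 := (hV (r⁻¹ • (x - c))).hasFDerivAt.comp x h1
  convert! h2 using 1
  ext v; simp

section TestFunction

variable {V : E3 → E3} {ψ : ℝ → ℝ} {g : ℝ → E3}

lemma grad_smul_rescale (hV : Differentiable ℝ V) (s r : ℝ) (c x : E3) :
    grad (fun z => s • rescale V r c z) x = (s * r⁻¹) • grad V (r⁻¹ • (x - c)) := by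
  have h : HasFDerivAt (fun z => s • rescale V r c z) _ x :=
    (hasFDerivAt_rescale hV r c x).const_smul s
  ext i j
  simp [grad, h.fderiv, mul_assoc]

lemma hasDerivAt_smul_rescale (hV : Differentiable ℝ V) {t : ℝ} {ψ' : ℝ} {g' : E3}
    (hψ : HasDerivAt ψ ψ' t) (hg : HasDerivAt g g' t) (r : ℝ) (x : E3) :
    HasDerivAt (fun s => ψ s • rescale V r (g s) x)
      (ψ' • rescale V r (g t) x - (ψ t * r⁻¹) • fderiv ℝ V (r⁻¹ • (x - g t)) g') t := by
  have h1 : HasDerivAt (fun s => r⁻¹ • (x - g s)) (r⁻¹ • (- g')) t :=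
    (hg.const_sub x).const_smul r⁻¹
  have h2 := hψ.smul ((hV (r⁻¹ • (x - g t))).hasFDerivAt.comp_hasDerivAt t h1)
  convert! h2 using 1
  simp only [map_smul, map_neg, smul_neg, smul_smul, Function.comp_def]
  rw [add_comm, ← sub_eq_add_neg]
  rfl

end TestFunction

/-- Up to time `τ` the `n`-th body is isolated: it stays away from the boundary of `Ω` and from the
other bodies, by a fixed multiple of its radius. -/
structure IsIsolated (Ω : Set E3) (S : State) (n : Fin S.N) (τ : ℝ) : Prop where
  subset : ∀ t ∈ Icc 0 τ, Metric.closedBall (S.h n t) (4 * S.r) ⊆ Ω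
  dist : ∀ t ∈ Icc 0 τ, ∀ j, j ≠ n → 5 * S.r < dist (S.h j t) (S.h n t)

/-- A rigid profile that follows a curve close to the centre of an isolated body is an admissible
test function. -/
lemma isMomentumTest_rescale {Ω : Set E3} {S : State} {n : Fin S.N} {T τ : ℝ} (hT : 0 < T)
    (hτ0 : 0 < τ) (hτ : τ ≤ T) (hr : 0 < S.r) (hiso : IsIsolated Ω S n τ)
    {a b : E3} {V : E3 → E3} (hV : IsRigidProfile a b V) {g : ℝ → E3} (hg : ContDiff ℝ 1 g)
    (hgh : ∀ t, ‖g t - S.h n (projIcc 0 T hT.le t)‖ < S.r)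
    {ψ : ℝ → ℝ} (hψ : ContDiff ℝ 1 ψ) (hψc : HasCompactSupport ψ) (hψs : tsupport ψ ⊆ Iio τ) :
    IsMomentumTest Ω T S (fun t x => ψ t • rescale V S.r (g t) x) := by
  have hgh' : ∀ t ∈ Icc 0 T, ‖g t - S.h n t‖ < S.r := fun t ht => by
    have := hgh t; rwa [projIcc_of_mem hT.le ht] at this
  have hsupp : Function.support (fun p : ℝ × E3 => ψ p.1 • rescale V S.r (g p.1) p.2)
      ⊆ (fun p : ℝ × E3 => (p.1, p.2 + g p.1)) ''
        (tsupport ψ ×ˢ Metric.closedBall 0 (3 * S.r)) := by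
    rintro ⟨t, x⟩ h
    simp only [Function.mem_support, ne_eq, smul_eq_zero, not_or] at h
    refine ⟨(t, x - g t), ⟨subset_tsupport _ h.1, ?_⟩, by simp⟩
    rw [mem_closedBall_zero_iff]
    by_contra hc
    refine h.2 (hV.eq_zero_of_le ?_)
    rw [norm_smul, norm_inv, Real.norm_of_nonneg hr.le, le_inv_mul_iff₀ hr]
    linarith
  have hcpt : IsCompact ((fun p : ℝ × E3 => (p.1, p.2 + g p.1)) ''
      (tsupport ψ ×ˢ Metric.closedBall 0 (3 * S.r))) :=
    (hψc.isCompact.prod (isCompact_closedBall _ _)).image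
      (continuous_fst.prodMk (continuous_snd.add (hg.continuous.comp continuous_fst)))
  constructor
  · have h1 : ContDiff ℝ 1 fun p : ℝ × E3 => S.r⁻¹ • (p.2 - g p.1) :=
      (contDiff_snd.sub (hg.comp contDiff_fst)).const_smul _
    have h2 : ContDiff ℝ 1 fun p : ℝ × E3 => ψ p.1 := hψ.comp contDiff_fst
    exact h2.smul (hV.contDiff.comp h1)
  · exact HasCompactSupport.of_support_subset_isCompact hcpt hsupp
  · refine (closure_minimal hsupp hcpt.isClosed).trans ?_
    rintro _ ⟨⟨t, z⟩, ⟨ht, hz⟩, rfl⟩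
    have htτ : t < τ := hψs ht
    refine ⟨htτ.trans_le hτ, hiso.subset (projIcc 0 T hT.le t) ⟨(projIcc 0 T hT.le t).2.1, ?_⟩ ?_⟩
    · rw [coe_projIcc]
      exact max_le hτ0.le ((min_le_right _ _).trans htτ.le)
    · rw [Metric.mem_closedBall, dist_eq_norm]
      rw [mem_closedBall_zero_iff] at hz
      simp only
      calc ‖z + g t - S.h n (projIcc 0 T hT.le t)‖
          = ‖z + (g t - S.h n (projIcc 0 T hT.le t))‖ := by rw [add_sub_assoc]
        _ ≤ 3 * S.r + S.r := (norm_add_le _ _).trans (add_le_add hz (hgh t).le)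
        _ = 4 * S.r := by ring
  · intro t _ x
    rw [grad_smul_rescale hV.differentiable, Matrix.trace_smul, hV.trace_grad, smul_zero]
  · intro t ht j
    have hfar : ∀ x, (‖x - g t‖ < 2 * S.r ∨ 3 * S.r ≤ ‖x - g t‖) →
        symPart (grad (fun z => ψ t • rescale V S.r (g t) z) x) = 0 := by
      intro x hx
      rw [grad_smul_rescale hV.differentiable, symPart_smul, hV.symPart_grad_eq_zero, smul_zero]
      rw [norm_smul, norm_inv, Real.norm_of_nonneg hr.le, le_inv_mul_iff₀ hr, inv_mul_lt_iff₀ hr]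
      rwa [mul_comm S.r 2, mul_comm S.r 3]
    -- beyond `τ` the bodies are not under control, but there the test function vanishes
    by_cases hψt : ψ t = 0
    · refine ⟨univ, isOpen_univ, subset_univ _, fun x _ => ?_⟩
      rw [grad_smul_rescale hV.differentiable, hψt, zero_mul, zero_smul]
      simp [symPart]
    have htτ : t < τ := hψs (subset_tsupport _ hψt)
    by_cases hj : j = n
    · subst hj
      refine ⟨Metric.ball (g t) (2 * S.r), Metric.isOpen_ball, fun x hx => ?_, fun x hx => ?_⟩
      · rw [State.body, Metric.mem_closedBall] at hx
        have h1 := hgh' t ht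
        rw [← dist_eq_norm, dist_comm] at h1
        rw [Metric.mem_ball]
        linarith [dist_triangle x (S.h j t) (g t)]
      · exact hfar x (Or.inl (by rwa [Metric.mem_ball, dist_eq_norm] at hx))
    · refine ⟨{x | 3 * S.r < ‖x - g t‖}, isOpen_lt continuous_const (by fun_prop),
        fun x hx => ?_, fun x hx => hfar x (Or.inr (le_of_lt hx))⟩
      rw [State.body, Metric.mem_closedBall] at hx
      have h1 := hgh' t ht
      rw [← dist_eq_norm] at h1
      have h2 := hiso.dist t ⟨ht.1, htτ.le⟩ j hj
      show 3 * S.r < ‖x - g t‖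
      rw [← dist_eq_norm]
      have h3 := dist_triangle (S.h j t) x (S.h n t)
      have h4 := dist_triangle x (g t) (S.h n t)
      rw [dist_comm] at hx
      linarith

/-! ### Densities in the momentum balance -/

/-- The momentum density `ρ u · V((x - c)/r)` tested with a profile centred at `c`. -/
def momDensity (S : State) (V : E3 → E3) (t : ℝ) (x c : E3) : ℝ :=
  S.rho t x * inner ℝ (S.u t x) (rescale V S.r c x)

/-- The inertial force density tested with a profile centred at `c` that moves with velocity `w`. -/
def inertiaDensity (S : State) (V : E3 → E3) (t : ℝ) (x c w : E3) : ℝ :=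
  S.r⁻¹ * (S.rho t x * (inner ℝ (S.u t x) (fderiv ℝ V (S.r⁻¹ • (x - c)) w)
    - inner ℝ (S.u t x) (fderiv ℝ V (S.r⁻¹ • (x - c)) (S.u t x))))

/-- The viscous stress tested with a profile centred at `c`. -/
def stressDensity (S : State) (V : E3 → E3) (t : ℝ) (x c : E3) : ℝ :=
  S.r⁻¹ * contract (symPart (S.gradU t x)) (symPart (grad V (S.r⁻¹ • (x - c))))

/-- The restriction of Lebesgue measure to the space-time cylinder `(0,T) × Ω`. -/
def cylinder (Ω : Set E3) (T : ℝ) : Measure (ℝ × E3) :=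
  (volume.restrict (Ioo 0 T)).prod (volume.restrict Ω)

lemma isFiniteMeasure_cylinder {Ω : Set E3} (hΩb : Bornology.IsBounded Ω) (T : ℝ) :
    IsFiniteMeasure (cylinder Ω T) := by
  have h1 : IsFiniteMeasure (volume.restrict Ω) := ⟨by
    rw [Measure.restrict_apply_univ]; exact hΩb.measure_lt_top⟩
  unfold cylinder; infer_instance

lemma cylinder_le (Ω : Set E3) (T : ℝ) :
    cylinder Ω T ≤ (volume.restrict (Ioo 0 T)).prod volume := by
  have h := Measure.prod_restrict (μ := volume.restrict (Ioo (0 : ℝ) T))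
    (ν := (volume : Measure E3)) univ Ω
  rw [Measure.restrict_univ] at h
  rw [cylinder, h]
  exact Measure.restrict_le_self

lemma ae_cylinder_fst {Ω : Set E3} {T : ℝ} {p : ℝ → Prop}
    (h : ∀ᵐ t ∂(volume.restrict (Ioo 0 T)), p t) : ∀ᵐ q ∂(cylinder Ω T), p q.1 :=
  Measure.quasiMeasurePreserving_fst.ae h

lemma aestronglyMeasurable_smul_sub {Ω : Set E3} {T : ℝ} {c : ℝ → E3}
    (hc : AEStronglyMeasurable c (volume.restrict (Ioo 0 T))) (s : ℝ) :
    AEStronglyMeasurable (fun p : ℝ × E3 => s • (p.2 - c p.1)) (cylinder Ω T) := by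
  have h1 : AEStronglyMeasurable (fun p : ℝ × E3 => c p.1) (cylinder Ω T) := hc.comp_fst
  have h2 : AEStronglyMeasurable (fun p : ℝ × E3 => p.2) (cylinder Ω T) :=
    measurable_snd.aestronglyMeasurable
  exact (h2.sub h1).const_smul s

/-- An integrable majorant of the densities. -/
def majorant (S : State) (p : ℝ × E3) : ℝ :=
  ‖S.u p.1 p.2‖ + ‖S.u p.1 p.2‖ ^ 2 + ∑ i, ∑ j, |symPart (S.gradU p.1 p.2) i j|

section Bounds

variable {S : State} {V : E3 → E3} {K R : ℝ}

lemma sum_abs_nonneg (S : State) (p : ℝ × E3) :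
    0 ≤ ∑ i, ∑ j, |symPart (S.gradU p.1 p.2) i j| :=
  Finset.sum_nonneg fun _ _ => Finset.sum_nonneg fun _ _ => abs_nonneg _

lemma majorant_nonneg (S : State) (p : ℝ × E3) : 0 ≤ majorant S p := by
  have := sum_abs_nonneg S p
  unfold majorant; positivity

lemma abs_contract_le_sum {A B : M3} (hB : ∀ i j, |B i j| ≤ K) :
    |contract A B| ≤ K * ∑ i, ∑ j, |A i j| := by
  rw [contract, Finset.mul_sum]
  refine (Finset.abs_sum_le_sum_abs _ _).trans (Finset.sum_le_sum fun i _ => ?_)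
  rw [Finset.mul_sum]
  refine (Finset.abs_sum_le_sum_abs _ _).trans (Finset.sum_le_sum fun j _ => ?_)
  rw [abs_mul, mul_comm]
  exact mul_le_mul_of_nonneg_right (hB i j) (abs_nonneg _)

lemma abs_momDensity_le (hK : ∀ y, ‖V y‖ ≤ K) {t : ℝ} {x : E3} (hR : |S.rho t x| ≤ R) (c : E3) :
    |momDensity S V t x c| ≤ R * K * ‖S.u t x‖ := by
  have hR0 : 0 ≤ R := (abs_nonneg _).trans hR
  rw [momDensity, abs_mul, mul_assoc]
  gcongr
  refine (abs_real_inner_le_norm _ _).trans ?_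
  rw [mul_comm]
  gcongr
  exact hK _

lemma abs_inertiaDensity_le (hr : 0 < S.r) (hK : ∀ y, ‖fderiv ℝ V y‖ ≤ K) {t : ℝ} {x : E3}
    (hR : |S.rho t x| ≤ R) (c w : E3) :
    |inertiaDensity S V t x c w|
      ≤ S.r⁻¹ * (R * (K * (‖S.u t x‖ * ‖w‖ + ‖S.u t x‖ ^ 2))) := by
  have hR0 : 0 ≤ R := (abs_nonneg _).trans hR
  have hin : ∀ z, |inner ℝ (S.u t x) (fderiv ℝ V (S.r⁻¹ • (x - c)) z)| ≤ K * (‖S.u t x‖ * ‖z‖) := by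
    intro z
    refine (abs_real_inner_le_norm _ _).trans ?_
    have h1 : ‖fderiv ℝ V (S.r⁻¹ • (x - c)) z‖ ≤ K * ‖z‖ :=
      (ContinuousLinearMap.le_opNorm _ _).trans (by gcongr; exact hK _)
    calc ‖S.u t x‖ * ‖fderiv ℝ V (S.r⁻¹ • (x - c)) z‖ ≤ ‖S.u t x‖ * (K * ‖z‖) := by gcongr
      _ = _ := by ring
  rw [inertiaDensity, abs_mul, abs_of_pos (inv_pos.2 hr), abs_mul]
  gcongr
  refine (abs_sub _ _).trans ?_
  have h1 := hin w
  have h2 := hin (S.u t x)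
  nlinarith

lemma abs_stressDensity_le (hr : 0 < S.r) (hK : ∀ y, ‖fderiv ℝ V y‖ ≤ K) (t : ℝ) (x c : E3) :
    |stressDensity S V t x c| ≤ S.r⁻¹ * (K * ∑ i, ∑ j, |symPart (S.gradU t x) i j|) := by
  rw [stressDensity, abs_mul, abs_of_pos (inv_pos.2 hr)]
  gcongr
  exact abs_contract_le_sum fun i j => (abs_symPart_grad_apply_le V _ i j).trans (hK _)

end Bounds

namespace IsWeakSolution

variable {Ω : Set E3} {T : ℝ} {S : State} (hS : IsWeakSolution Ω T S)
include hS

lemma abs_rho_le {t : ℝ} (ht : t ∈ Icc 0 T) (x : E3) : |S.rho t x| ≤ max 1 S.rhoS := by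
  rw [hS.rho_eq t ht]
  split_ifs
  · rw [abs_of_pos hS.rhoS_pos]; exact le_max_right _ _
  · rw [abs_one]; exact le_max_left _ _

lemma memLp_u_cylinder : MemLp (fun p : ℝ × E3 => S.u p.1 p.2) 2 (cylinder Ω T) :=
  hS.u_memLp.mono_measure (cylinder_le Ω T)

lemma memLp_symGrad_cylinder (i j : Fin 3) :
    MemLp (fun p : ℝ × E3 => symPart (S.gradU p.1 p.2) i j) 2 (cylinder Ω T) := by
  simp only [symPart_apply]
  exact (((hS.gradU_memLp i j).add (hS.gradU_memLp j i)).const_mul _).mono_measure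
    (cylinder_le Ω T)

lemma aestronglyMeasurable_rho :
    AEStronglyMeasurable (fun p : ℝ × E3 => S.rho p.1 p.2) (cylinder Ω T) :=
  hS.rho_memLp.1.mono_measure (cylinder_le Ω T)

lemma integrable_majorant (hΩb : Bornology.IsBounded Ω) :
    Integrable (majorant S) (cylinder Ω T) := by
  have := isFiniteMeasure_cylinder hΩb T
  have h1 := hS.memLp_u_cylinder
  refine ((h1.integrable (by norm_num)).norm.add
    ((memLp_two_iff_integrable_sq_norm h1.1).1 h1)).add ?_
  refine integrable_finsetSum _ fun i _ => integrable_finsetSum _ fun j _ => ?_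
  exact ((hS.memLp_symGrad_cylinder i j).integrable (by norm_num)).abs

/-- All densities are bounded by one integrable function, uniformly in the position and the velocity
of the profile. -/
lemma exists_density_bounds {V : E3 → E3} {K : ℝ}
    (hK : ∀ y, ‖V y‖ ≤ K ∧ ‖fderiv ℝ V y‖ ≤ K) (L : ℝ) :
    ∃ C : ℝ, 0 ≤ C ∧ ∀ t ∈ Icc 0 T, ∀ x c w : E3, ‖w‖ ≤ L →
      |momDensity S V t x c| ≤ C * majorant S (t, x) ∧
      |inertiaDensity S V t x c w| ≤ C * majorant S (t, x) ∧
      |stressDensity S V t x c| ≤ C * majorant S (t, x) := by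
  set R := max 1 S.rhoS
  have hR1 : 1 ≤ R := le_max_left _ _
  have hK0 : 0 ≤ K := (norm_nonneg _).trans (hK 0).1
  have hr := hS.r_pos
  refine ⟨max (R * K) (S.r⁻¹ * (R * (K * (max 1 L)))), by positivity, fun t ht x c w hw => ?_⟩
  have hρ := hS.abs_rho_le ht x
  have hm0 := majorant_nonneg S (t, x)
  have hs0 : 0 ≤ ∑ i, ∑ j, |symPart (S.gradU t x) i j| := sum_abs_nonneg S (t, x)
  have hmaj : majorant S (t, x) = ‖S.u t x‖ + ‖S.u t x‖ ^ 2
    + ∑ i, ∑ j, |symPart (S.gradU t x) i j| := rfl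
  have hsq := sq_nonneg ‖S.u t x‖
  have hn := norm_nonneg (S.u t x)
  refine ⟨?_, ?_, ?_⟩
  · refine (abs_momDensity_le (fun y => (hK y).1) hρ c).trans ?_
    refine mul_le_mul (le_max_left _ _) (by rw [hmaj]; linarith) hn (by positivity)
  · refine (abs_inertiaDensity_le hr (fun y => (hK y).2) hρ c w).trans ?_
    refine le_trans ?_ (mul_le_mul_of_nonneg_right (le_max_right _ _) hm0)
    rw [mul_assoc, mul_assoc, mul_assoc]
    gcongr
    have h1 : ‖S.u t x‖ * ‖w‖ ≤ ‖S.u t x‖ * max 1 L := by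
      gcongr; exact hw.trans (le_max_right _ _)
    have h2 : ‖S.u t x‖ ^ 2 ≤ max 1 L * ‖S.u t x‖ ^ 2 :=
      le_mul_of_one_le_left hsq (le_max_left _ _)
    have h3 : 0 ≤ max 1 L * ∑ i, ∑ j, |symPart (S.gradU t x) i j| := by positivity
    rw [hmaj]
    linarith
  · refine (abs_stressDensity_le hr (fun y => (hK y).2) t x c).trans ?_
    refine le_trans ?_ (mul_le_mul_of_nonneg_right (le_max_right _ _) hm0)
    rw [mul_assoc]
    refine mul_le_mul_of_nonneg_left ?_ (inv_pos.2 hr).le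
    have h1 : (1 : ℝ) * K ≤ R * (K * max 1 L) := by
      have : K ≤ K * max 1 L := le_mul_of_one_le_right hK0 (le_max_left _ _)
      nlinarith
    rw [one_mul] at h1
    exact mul_le_mul h1 (show _ ≤ majorant S (t, x) by rw [hmaj]; linarith) hs0 (by positivity)

variable {V : E3 → E3} (hV : ContDiff ℝ 1 V)
include hV

lemma aestronglyMeasurable_momDensity {c : ℝ → E3}
    (hc : AEStronglyMeasurable c (volume.restrict (Ioo 0 T))) :
    AEStronglyMeasurable (fun p : ℝ × E3 => momDensity S V p.1 p.2 (c p.1)) (cylinder Ω T) := by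
  have hy := aestronglyMeasurable_smul_sub (Ω := Ω) hc S.r⁻¹
  exact hS.aestronglyMeasurable_rho.mul
    (hS.memLp_u_cylinder.1.inner (hV.continuous.comp_aestronglyMeasurable hy))

lemma aestronglyMeasurable_inertiaDensity {c w : ℝ → E3}
    (hc : AEStronglyMeasurable c (volume.restrict (Ioo 0 T)))
    (hw : AEStronglyMeasurable w (volume.restrict (Ioo 0 T))) :
    AEStronglyMeasurable (fun p : ℝ × E3 => inertiaDensity S V p.1 p.2 (c p.1) (w p.1))
      (cylinder Ω T) := by
  have hy := aestronglyMeasurable_smul_sub (Ω := Ω) hc S.r⁻¹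
  have hD := (hV.continuous_fderiv (by simp)).comp_aestronglyMeasurable hy
  have happ : ∀ {z : ℝ × E3 → E3}, AEStronglyMeasurable z (cylinder Ω T) → AEStronglyMeasurable
      (fun p : ℝ × E3 => fderiv ℝ V (S.r⁻¹ • (p.2 - c p.1)) (z p)) (cylinder Ω T) := fun hz =>
    isBoundedBilinearMap_apply.continuous.comp_aestronglyMeasurable (hD.prodMk hz)
  have hu := hS.memLp_u_cylinder.1
  exact (hS.aestronglyMeasurable_rho.mul
    ((hu.inner (happ hw.comp_fst)).sub (hu.inner (happ hu)))).const_mul _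

lemma aestronglyMeasurable_stressDensity {c : ℝ → E3}
    (hc : AEStronglyMeasurable c (volume.restrict (Ioo 0 T))) :
    AEStronglyMeasurable (fun p : ℝ × E3 => stressDensity S V p.1 p.2 (c p.1)) (cylinder Ω T) := by
  have hy := aestronglyMeasurable_smul_sub (Ω := Ω) hc S.r⁻¹
  have hcont : ∀ i j, Continuous fun y => symPart (grad V y) i j := fun i j => by
    simp only [symPart_apply]
    exact continuous_const.mul ((continuous_grad_apply hV i j).add (continuous_grad_apply hV j i))
  refine AEStronglyMeasurable.const_mul ?_ _
  refine Finset.aestronglyMeasurable_fun_sum _ fun i _ =>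
    Finset.aestronglyMeasurable_fun_sum _ fun j _ => ?_
  exact (hS.memLp_symGrad_cylinder i j).1.mul ((hcont i j).comp_aestronglyMeasurable hy)

/-- The densities that follow a measurable curve are integrable. -/
lemma integrable_densities (hΩb : Bornology.IsBounded Ω) {K : ℝ}
    (hK : ∀ y, ‖V y‖ ≤ K ∧ ‖fderiv ℝ V y‖ ≤ K) {c w : ℝ → E3} {L : ℝ}
    (hc : AEStronglyMeasurable c (volume.restrict (Ioo 0 T)))
    (hw : AEStronglyMeasurable w (volume.restrict (Ioo 0 T)))
    (hL : ∀ t ∈ Ioo 0 T, ‖w t‖ ≤ L) :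
    Integrable (fun p : ℝ × E3 => momDensity S V p.1 p.2 (c p.1)) (cylinder Ω T) ∧
    Integrable (fun p : ℝ × E3 => inertiaDensity S V p.1 p.2 (c p.1) (w p.1)) (cylinder Ω T) ∧
    Integrable (fun p : ℝ × E3 => stressDensity S V p.1 p.2 (c p.1)) (cylinder Ω T) := by
  obtain ⟨C, -, hC⟩ := hS.exists_density_bounds hK L
  have hmem : ∀ᵐ p ∂(cylinder Ω T), p.1 ∈ Ioo 0 T :=
    ae_cylinder_fst (ae_restrict_mem measurableSet_Ioo)
  have hint := (hS.integrable_majorant hΩb).const_mul C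
  refine ⟨hint.mono' (hS.aestronglyMeasurable_momDensity hV hc) ?_,
    hint.mono' (hS.aestronglyMeasurable_inertiaDensity hV hc hw) ?_,
    hint.mono' (hS.aestronglyMeasurable_stressDensity hV hc) ?_⟩ <;>
  filter_upwards [hmem] with p hp
  · exact (hC p.1 (Ioo_subset_Icc_self hp) p.2 (c p.1) (w p.1) (hL _ hp)).1
  · exact (hC p.1 (Ioo_subset_Icc_self hp) p.2 (c p.1) (w p.1) (hL _ hp)).2.1
  · exact (hC p.1 (Ioo_subset_Icc_self hp) p.2 (c p.1) (w p.1) (hL _ hp)).2.2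

end IsWeakSolution

/-! ### The momentum balance along the motion of a body -/

namespace IsWeakSolution

variable {Ω : Set E3} {T : ℝ} {S : State} (hS : IsWeakSolution Ω T S)
include hS

/-- The momentum balance for a profile that follows a `C¹` curve, as one space-time integral. -/
lemma integral_densities_of_test (hΩb : Bornology.IsBounded Ω) {V : E3 → E3} (hV : ContDiff ℝ 1 V)
    {K L : ℝ} (hK : ∀ y, ‖V y‖ ≤ K ∧ ‖fderiv ℝ V y‖ ≤ K) {g : ℝ → E3} (hg : ContDiff ℝ 1 g)
    (hgL : ∀ t, ‖deriv g t‖ ≤ L) {ψ : ℝ → ℝ} (hψ : ContDiff ℝ 1 ψ) (hψc : HasCompactSupport ψ)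
    (htest : IsMomentumTest Ω T S (fun t x => ψ t • rescale V S.r (g t) x)) :
    ∫ p, (deriv ψ p.1 * momDensity S V p.1 p.2 (g p.1)
        - ψ p.1 * (inertiaDensity S V p.1 p.2 (g p.1) (deriv g p.1)
          + stressDensity S V p.1 p.2 (g p.1))) ∂(cylinder Ω T)
      = - (ψ 0 * ∫ x in Ω, S.rho 0 x * inner ℝ (S.u0 x) (rescale V S.r (g 0) x)) := by
  have hVd : Differentiable ℝ V := hV.differentiable (by simp)
  have hψd : Differentiable ℝ ψ := hψ.differentiable (by simp)
  have hgd : Differentiable ℝ g := hg.differentiable (by simp)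
  obtain ⟨i1, i2, i3⟩ := hS.integrable_densities hV hΩb hK
    (hg.continuous.aestronglyMeasurable (μ := volume.restrict (Ioo 0 T)))
    ((hg.continuous_deriv (by simp)).aestronglyMeasurable) (fun t _ => hgL t)
  obtain ⟨M₀, hM₀⟩ := hψ.continuous.bounded_above_of_compact_support hψc
  obtain ⟨M₁, hM₁⟩ := (hψ.continuous_deriv (by simp)).bounded_above_of_compact_support hψc.deriv
  have m0 : AEStronglyMeasurable (fun p : ℝ × E3 => ψ p.1) (cylinder Ω T) :=
    (hψ.continuous.comp continuous_fst).aestronglyMeasurable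
  have m1 : AEStronglyMeasurable (fun p : ℝ × E3 => deriv ψ p.1) (cylinder Ω T) :=
    ((hψ.continuous_deriv (by simp)).comp continuous_fst).aestronglyMeasurable
  have j1 := i1.bdd_mul m1 (Eventually.of_forall fun p => hM₁ p.1)
  have j2 := i2.bdd_mul m0 (Eventually.of_forall fun p => hM₀ p.1)
  have j3 := i3.bdd_mul m0 (Eventually.of_forall fun p => hM₀ p.1)
  have hbal := hS.momentum_balance _ htest
  have e1 : ∀ t x, S.rho t x * inner ℝ (S.u t x) (deriv (fun s => ψ s • rescale V S.r (g s) x) t)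
      + S.rho t x * contract (tensor (S.u t x) (S.u t x))
        (grad (fun z => ψ t • rescale V S.r (g t) z) x)
      = deriv ψ t * momDensity S V t x (g t)
        - ψ t * inertiaDensity S V t x (g t) (deriv g t) := by
    intro t x
    rw [(hasDerivAt_smul_rescale hVd (hψd t).hasDerivAt (hgd t).hasDerivAt S.r x).deriv,
      grad_smul_rescale hVd, contract_smul_right, contract_tensor_grad, inner_sub_right,
      inner_smul_right, inner_smul_right, momDensity, inertiaDensity]
    ring
  have e2 : ∀ t x, contract (symPart (S.gradU t x))
      (symPart (grad (fun z => ψ t • rescale V S.r (g t) z) x))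
      = ψ t * stressDensity S V t x (g t) := by
    intro t x
    rw [grad_smul_rescale hVd, symPart_smul, contract_smul_right, stressDensity]
    ring
  have e3 : ∫ x in Ω, S.rho 0 x * inner ℝ (S.u0 x) (ψ 0 • rescale V S.r (g 0) x)
      = ψ 0 * ∫ x in Ω, S.rho 0 x * inner ℝ (S.u0 x) (rescale V S.r (g 0) x) := by
    rw [← integral_const_mul]
    congr 1; ext x
    rw [inner_smul_right]; ring
  simp only [e1, e2, e3] at hbal
  have p1 := integral_prod _ (j1.sub j2)
  have p2 := integral_prod _ j3
  simp only [Pi.sub_apply] at p1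
  rw [← p1, ← p2] at hbal
  have hI : ∀ p : ℝ × E3, deriv ψ p.1 * momDensity S V p.1 p.2 (g p.1)
        - ψ p.1 * (inertiaDensity S V p.1 p.2 (g p.1) (deriv g p.1)
          + stressDensity S V p.1 p.2 (g p.1))
      = (deriv ψ p.1 * momDensity S V p.1 p.2 (g p.1)
        - ψ p.1 * inertiaDensity S V p.1 p.2 (g p.1) (deriv g p.1))
        - ψ p.1 * stressDensity S V p.1 p.2 (g p.1) := fun p => by ring
  simp only [hI]
  have := integral_sub (j1.sub j2) j3
  simp only [Pi.sub_apply] at this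
  rw [this]
  unfold cylinder
  linarith

/-- The momentum balance for a profile that follows an isolated body: the centre is only Lipschitz
in time, so that this is the limit of the balances for profiles that follow its Steklov
averages. -/
lemma integral_densities_of_isolated (hΩb : Bornology.IsBounded Ω)
    (hT : 0 < T) {n : Fin S.N} {τ : ℝ} (hτ0 : 0 < τ) (hτ : τ ≤ T) (hiso : IsIsolated Ω S n τ)
    {a b : E3} {V : E3 → E3} (hV : IsRigidProfile a b V)
    {ψ : ℝ → ℝ} (hψ : ContDiff ℝ 1 ψ) (hψc : HasCompactSupport ψ) (hψs : tsupport ψ ⊆ Iio τ) :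
    ∫ p, (deriv ψ p.1 * momDensity S V p.1 p.2 (S.h n p.1)
        - ψ p.1 * (inertiaDensity S V p.1 p.2 (S.h n p.1) (deriv (S.h n) p.1)
          + stressDensity S V p.1 p.2 (S.h n p.1))) ∂(cylinder Ω T)
      = - (ψ 0 * ∫ x in Ω, S.rho 0 x * inner ℝ (S.u0 x) (rescale V S.r (S.h n 0) x)) := by
  obtain ⟨L, hL⟩ := hS.h_lipschitz n
  obtain ⟨K, hK0, hK⟩ := hV.exists_bound
  obtain ⟨g, hg1, hgh, hgL, hgd⟩ := exists_contDiff_approx hT hL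
  have hr := hS.r_pos
  have hV1 := hV.contDiff
  have hVD : Continuous (fderiv ℝ V) := hV1.continuous_fderiv (by simp)
  have hgt : ∀ t ∈ Icc 0 T, Tendsto (fun k => g k t) atTop (𝓝 (S.h n t)) := by
    intro t ht
    rw [tendsto_iff_norm_sub_tendsto_zero]
    have h1 : Tendsto (fun k : ℕ => (L : ℝ) * (1 / ((k : ℝ) + 1))) atTop (𝓝 0) := by
      simpa using (tendsto_one_div_add_atTop_nhds_zero_nat (𝕜 := ℝ)).const_mul (L : ℝ)
    refine squeeze_zero (fun k => norm_nonneg _) (fun k => ?_) h1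
    have := hgh k t
    rwa [projIcc_of_mem hT.le ht] at this
  have hclose : ∀ᶠ k : ℕ in atTop, ∀ t, ‖g k t - S.h n (projIcc 0 T hT.le t)‖ < S.r := by
    have h1 : Tendsto (fun k : ℕ => (L : ℝ) * (1 / ((k : ℝ) + 1))) atTop (𝓝 0) := by
      simpa using (tendsto_one_div_add_atTop_nhds_zero_nat (𝕜 := ℝ)).const_mul (L : ℝ)
    filter_upwards [h1.eventually_lt_const hr] with k hk t
    exact (hgh k t).trans_lt hk
  obtain ⟨M₀, hM₀⟩ := hψ.continuous.bounded_above_of_compact_support hψc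
  obtain ⟨M₁, hM₁⟩ := (hψ.continuous_deriv (by simp)).bounded_above_of_compact_support hψc.deriv
  have m0 : AEStronglyMeasurable (fun p : ℝ × E3 => ψ p.1) (cylinder Ω T) :=
    (hψ.continuous.comp continuous_fst).aestronglyMeasurable
  have m1 : AEStronglyMeasurable (fun p : ℝ × E3 => deriv ψ p.1) (cylinder Ω T) :=
    ((hψ.continuous_deriv (by simp)).comp continuous_fst).aestronglyMeasurable
  have hmem : ∀ᵐ p ∂(cylinder Ω T), p.1 ∈ Ioo 0 T :=
    ae_cylinder_fst (ae_restrict_mem measurableSet_Ioo)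
  have hdiff : ∀ᵐ p ∂(cylinder Ω T), DifferentiableAt ℝ (S.h n) p.1 :=
    ae_cylinder_fst (ae_differentiableAt_Ioo_of_lipschitzOn hL)
  obtain ⟨C, hC0, hC⟩ := hS.exists_density_bounds hK (L : ℝ)
  have hres : ∀ {t}, t ∈ Icc 0 T → ∀ x, Tendsto (fun k => S.r⁻¹ • (x - g k t)) atTop
      (𝓝 (S.r⁻¹ • (x - S.h n t))) := fun ht x => (tendsto_const_nhds.sub (hgt _ ht)).const_smul _
  have hlhs : Tendsto (fun k => ∫ p, (deriv ψ p.1 * momDensity S V p.1 p.2 (g k p.1)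
        - ψ p.1 * (inertiaDensity S V p.1 p.2 (g k p.1) (deriv (g k) p.1)
          + stressDensity S V p.1 p.2 (g k p.1))) ∂(cylinder Ω T)) atTop
      (𝓝 (∫ p, (deriv ψ p.1 * momDensity S V p.1 p.2 (S.h n p.1)
        - ψ p.1 * (inertiaDensity S V p.1 p.2 (S.h n p.1) (deriv (S.h n) p.1)
          + stressDensity S V p.1 p.2 (S.h n p.1))) ∂(cylinder Ω T))) := by
    refine tendsto_integral_of_dominated_convergence
      (fun p => (M₁ + M₀ * 2) * (C * majorant S p)) (fun k => ?_)
      (((hS.integrable_majorant hΩb).const_mul C).const_mul _) (fun k => ?_) ?_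
    · have mc := (hg1 k).continuous.aestronglyMeasurable (μ := volume.restrict (Ioo 0 T))
      have mw : AEStronglyMeasurable (deriv (g k)) (volume.restrict (Ioo 0 T)) :=
        ((hg1 k).continuous_deriv (by simp)).aestronglyMeasurable
      exact (m1.mul (hS.aestronglyMeasurable_momDensity hV1 mc)).sub
        (m0.mul ((hS.aestronglyMeasurable_inertiaDensity hV1 mc mw).add
          (hS.aestronglyMeasurable_stressDensity hV1 mc)))
    · filter_upwards [hmem] with p hp
      obtain ⟨c1, c2, c3⟩ := hC p.1 (Ioo_subset_Icc_self hp) p.2 (g k p.1) _ (hgL k p.1)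
      have b0 := hM₀ p.1
      have b1 := hM₁ p.1
      rw [Real.norm_eq_abs] at b0 b1
      have hB : 0 ≤ C * majorant S p := mul_nonneg hC0 (majorant_nonneg S p)
      have k1 : |deriv ψ p.1 * momDensity S V p.1 p.2 (g k p.1)| ≤ M₁ * (C * majorant S p) := by
        rw [abs_mul]; exact mul_le_mul b1 c1 (abs_nonneg _) ((abs_nonneg _).trans b1)
      have k2 : |ψ p.1 * (inertiaDensity S V p.1 p.2 (g k p.1) (deriv (g k) p.1)
          + stressDensity S V p.1 p.2 (g k p.1))| ≤ M₀ * (2 * (C * majorant S p)) := by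
        rw [abs_mul]
        refine mul_le_mul b0 ?_ (abs_nonneg _) ((abs_nonneg _).trans b0)
        exact (abs_add_le _ _).trans (by rw [two_mul]; exact add_le_add c2 c3)
      rw [Real.norm_eq_abs]
      refine (abs_sub _ _).trans ((add_le_add k1 k2).trans (le_of_eq (by ring)))
    · filter_upwards [hmem, hdiff] with p hp hd
      have hpI := Ioo_subset_Icc_self hp
      have hy := hres hpI p.2
      have hw := hgd p.1 hp hd
      have tV : Tendsto (fun k => rescale V S.r (g k p.1) p.2) atTop
          (𝓝 (rescale V S.r (S.h n p.1) p.2)) := (hV1.continuous.tendsto _).comp hy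
      have tD : Tendsto (fun k => fderiv ℝ V (S.r⁻¹ • (p.2 - g k p.1))) atTop
          (𝓝 (fderiv ℝ V (S.r⁻¹ • (p.2 - S.h n p.1)))) := (hVD.tendsto _).comp hy
      have tA : ∀ {w : ℕ → E3} {w₀ : E3}, Tendsto w atTop (𝓝 w₀) →
          Tendsto (fun k => fderiv ℝ V (S.r⁻¹ • (p.2 - g k p.1)) (w k)) atTop
            (𝓝 (fderiv ℝ V (S.r⁻¹ • (p.2 - S.h n p.1)) w₀)) := fun hw =>
        ((isBoundedBilinearMap_apply (𝕜 := ℝ) (E := E3) (F := E3)).continuous.tendsto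
          (_, _)).comp (tD.prodMk_nhds hw)
      have hgr : ∀ i j, Tendsto (fun k => grad V (S.r⁻¹ • (p.2 - g k p.1)) i j) atTop
          (𝓝 (grad V (S.r⁻¹ • (p.2 - S.h n p.1)) i j)) := fun i j =>
        ((continuous_grad_apply hV1 i j).tendsto _).comp hy
      have t1 : Tendsto (fun k => momDensity S V p.1 p.2 (g k p.1)) atTop
          (𝓝 (momDensity S V p.1 p.2 (S.h n p.1))) :=
        (tendsto_const_nhds.inner tV).const_mul _
      have t2 : Tendsto (fun k => inertiaDensity S V p.1 p.2 (g k p.1) (deriv (g k) p.1)) atTop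
          (𝓝 (inertiaDensity S V p.1 p.2 (S.h n p.1) (deriv (S.h n) p.1))) :=
        (((tendsto_const_nhds.inner (tA hw)).sub
          (tendsto_const_nhds.inner (tA tendsto_const_nhds))).const_mul _).const_mul _
      have t3 : Tendsto (fun k => stressDensity S V p.1 p.2 (g k p.1)) atTop
          (𝓝 (stressDensity S V p.1 p.2 (S.h n p.1))) := by
        refine Tendsto.const_mul _
          (tendsto_finsetSum _ fun i _ => tendsto_finsetSum _ fun j _ => ?_)
        simp only [symPart_apply (grad V _)]
        exact (((hgr i j).add (hgr j i)).const_mul _).const_mul _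
      exact (t1.const_mul _).sub ((t2.add t3).const_mul _)
  have hrhs : Tendsto
      (fun k => ∫ x in Ω, S.rho 0 x * inner ℝ (S.u0 x) (rescale V S.r (g k 0) x)) atTop
      (𝓝 (∫ x in Ω, S.rho 0 x * inner ℝ (S.u0 x) (rescale V S.r (S.h n 0) x))) := by
    have h0 : (0 : ℝ) ∈ Icc 0 T := left_mem_Icc.2 hT.le
    have hfin : IsFiniteMeasure (volume.restrict Ω) := ⟨by
      rw [Measure.restrict_apply_univ]; exact hΩb.measure_lt_top⟩
    refine tendsto_integral_of_dominated_convergence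
      (fun x => max 1 S.rhoS * (‖S.u0 x‖ * K)) (fun k => ?_)
      (((hS.u0_memLp.integrable (by norm_num)).norm.mul_const _).const_mul _) (fun k => ?_) ?_
    · refine (hS.rho_integrable 0 h0).1.mul (hS.u0_memLp.1.inner ?_)
      have : Continuous fun x : E3 => S.r⁻¹ • (x - g k 0) := by fun_prop
      exact (hV1.continuous.comp this).aestronglyMeasurable
    · refine Eventually.of_forall fun x => ?_
      rw [Real.norm_eq_abs, abs_mul]
      refine mul_le_mul (hS.abs_rho_le h0 x) ?_ (abs_nonneg _) (by positivity)
      exact (abs_real_inner_le_norm _ _).trans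
        (mul_le_mul_of_nonneg_left (hK _).1 (norm_nonneg _))
    · refine Eventually.of_forall fun x => ?_
      exact (tendsto_const_nhds.inner ((hV1.continuous.tendsto _).comp (hres h0 x))).const_mul _
  refine tendsto_nhds_unique hlhs ((hrhs.const_mul (ψ 0)).neg.congr' ?_)
  filter_upwards [hclose] with k hk
  exact (hS.integral_densities_of_test hΩb hV1 hK (hg1 k) (hgL k) hψ hψc
    (isMomentumTest_rescale hT hτ0 hτ hr hiso hV (hg1 k) hk hψ hψc hψs)).symm

/-- The momentum seen by a profile that follows an isolated body is absolutely continuous in time;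
its derivative is minus the force. -/
lemma ae_integral_momDensity_eq (hΩb : Bornology.IsBounded Ω)
    (hT : 0 < T) {n : Fin S.N} {τ : ℝ} (hτ0 : 0 < τ) (hτ : τ ≤ T) (hiso : IsIsolated Ω S n τ)
    {a b : E3} {V : E3 → E3} (hV : IsRigidProfile a b V) :
    IntegrableOn (fun t => ∫ x in Ω, (inertiaDensity S V t x (S.h n t) (deriv (S.h n) t)
      + stressDensity S V t x (S.h n t))) (Ioo 0 T) ∧
    ∀ᵐ t ∂(volume.restrict (Ioo 0 τ)), ∫ x in Ω, momDensity S V t x (S.h n t)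
      = (∫ x in Ω, S.rho 0 x * inner ℝ (S.u0 x) (rescale V S.r (S.h n 0) x))
        - ∫ s in (0 : ℝ)..t, ∫ x in Ω, (inertiaDensity S V s x (S.h n s) (deriv (S.h n) s)
          + stressDensity S V s x (S.h n s)) := by
  obtain ⟨L, hL⟩ := hS.h_lipschitz n
  obtain ⟨K, hK0, hK⟩ := hV.exists_bound
  have mc : AEStronglyMeasurable (S.h n) (volume.restrict (Ioo 0 T)) :=
    (hL.continuousOn.mono Ioo_subset_Icc_self).aestronglyMeasurable measurableSet_Ioo
  have mw : AEStronglyMeasurable (deriv (S.h n)) (volume.restrict (Ioo 0 T)) :=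
    (measurable_deriv _).aestronglyMeasurable
  obtain ⟨i1, i2, i3⟩ := hS.integrable_densities hV.contDiff hΩb hK mc mw
    (fun t ht => norm_deriv_le_of_lipschitzOn_Icc hL ht)
  have i23 := i2.add i3
  simp only [cylinder] at i1 i23
  have hF : IntegrableOn (fun t => ∫ x in Ω, momDensity S V t x (S.h n t)) (Ioo 0 T) :=
    i1.integral_prod_left
  have hH : IntegrableOn (fun t => ∫ x in Ω, (inertiaDensity S V t x (S.h n t) (deriv (S.h n) t)
      + stressDensity S V t x (S.h n t))) (Ioo 0 T) := i23.integral_prod_left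
  refine ⟨hH, ae_eq_sub_integral_of_weak_deriv hτ hF hH fun ψ hψ hψc hψs => ?_⟩
  rw [← hS.integral_densities_of_isolated hΩb hT hτ0 hτ hiso hV hψ hψc hψs]
  obtain ⟨M₀, hM₀⟩ := hψ.continuous.bounded_above_of_compact_support hψc
  obtain ⟨M₁, hM₁⟩ := (hψ.continuous_deriv (by simp)).bounded_above_of_compact_support hψc.deriv
  have m0 : AEStronglyMeasurable (fun p : ℝ × E3 => ψ p.1) (cylinder Ω T) :=
    (hψ.continuous.comp continuous_fst).aestronglyMeasurable
  have m1 : AEStronglyMeasurable (fun p : ℝ × E3 => deriv ψ p.1) (cylinder Ω T) :=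
    ((hψ.continuous_deriv (by simp)).comp continuous_fst).aestronglyMeasurable
  have j1 := i1.bdd_mul m1 (Eventually.of_forall fun p => hM₁ p.1)
  have j2 := i23.bdd_mul m0 (Eventually.of_forall fun p => hM₀ p.1)
  have n0 : AEStronglyMeasurable ψ (volume.restrict (Ioo 0 T)) :=
    hψ.continuous.aestronglyMeasurable
  have n1 : AEStronglyMeasurable (deriv ψ) (volume.restrict (Ioo 0 T)) :=
    (hψ.continuous_deriv (by simp)).aestronglyMeasurable
  have k1 := Integrable.bdd_mul hF n1 (Eventually.of_forall hM₁)
  have k2 := Integrable.bdd_mul hH n0 (Eventually.of_forall hM₀)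
  have p1 := integral_prod _ j1
  have p2 := integral_prod _ j2
  have q := integral_sub j1 j2
  simp only [Pi.add_apply] at p1 p2 q
  rw [integral_sub k1 k2, cylinder, q, p1, p2]
  simp only [integral_const_mul]

end IsWeakSolution

/-! ### Estimates at a fixed time -/

/-- The volume of the unit ball of `ℝ³`. -/
def unitVol : ℝ := volume.real (Metric.closedBall (0 : E3) 1)

lemma unitVol_nonneg : 0 ≤ unitVol := measureReal_nonneg

lemma unitVol_pos : 0 < unitVol :=
  ENNReal.toReal_pos (Metric.measure_closedBall_pos _ _ one_pos).ne' measure_closedBall_lt_top.ne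

lemma volume_real_closedBall {r : ℝ} (hr : 0 ≤ r) (c : E3) :
    volume.real (Metric.closedBall c r) = r ^ 3 * unitVol := by
  rw [Measure.addHaar_real_closedBall' _ _ hr, finrank_euclideanSpace, Fintype.card_fin, unitVol]

lemma volume_real_ball_three {r : ℝ} (hr : 0 ≤ r) (c : E3) :
    volume.real (Metric.ball c (3 * r)) = 27 * (r ^ 3 * unitVol) := by
  rw [← Measure.addHaar_real_closedBall_eq_addHaar_real_ball,
    volume_real_closedBall (by positivity)]
  ring

/-- The region around the body `n` where the test field is not rigid. -/
def annulus (S : State) (n : Fin S.N) (t : ℝ) : Set E3 :=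
  Metric.ball (S.h n t) (3 * S.r) \ S.body n t

lemma measurableSet_body (S : State) (n : Fin S.N) (t : ℝ) : MeasurableSet (S.body n t) :=
  Metric.isClosed_closedBall.measurableSet

lemma measurableSet_annulus (S : State) (n : Fin S.N) (t : ℝ) : MeasurableSet (annulus S n t) :=
  Metric.isOpen_ball.measurableSet.diff (measurableSet_body S n t)

lemma body_subset_ball {S : State} (hr : 0 < S.r) (n : Fin S.N) (t : ℝ) :
    S.body n t ⊆ Metric.ball (S.h n t) (3 * S.r) :=
  Metric.closedBall_subset_ball (by linarith)

lemma setIntegral_eq_body_add_annulus {Ω : Set E3} {S : State} {n : Fin S.N} {t : ℝ}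
    (hΩ : MeasurableSet Ω) (hr : 0 < S.r) (hsub : Metric.closedBall (S.h n t) (4 * S.r) ⊆ Ω)
    {f : E3 → ℝ} (hf : ∀ x, 3 * S.r ≤ dist x (S.h n t) → f x = 0)
    (hb : IntegrableOn f (S.body n t)) (ha : IntegrableOn f (annulus S n t)) :
    ∫ x in Ω, f x = (∫ x in S.body n t, f x) + ∫ x in annulus S n t, f x := by
  have hs : Metric.ball (S.h n t) (3 * S.r) ⊆ Ω :=
    (Metric.ball_subset_closedBall.trans (Metric.closedBall_subset_closedBall (by linarith))).trans
      hsub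
  have hdisj : Disjoint (S.body n t) (annulus S n t) := disjoint_sdiff_right
  have hunion : S.body n t ∪ annulus S n t = Metric.ball (S.h n t) (3 * S.r) :=
    union_sdiff_cancel (body_subset_ball hr n t)
  rw [setIntegral_eq_of_subset_of_forall_sdiff_eq_zero hΩ hs fun x hx => hf x
      (not_lt.1 fun h => hx.2 h),
    ← setIntegral_union hdisj (measurableSet_annulus S n t) hb ha, hunion]

lemma rescaled_norm_lt {r : ℝ} (hr : 0 < r) {c x : E3} (h : dist x c ≤ r) :
    ‖r⁻¹ • (x - c)‖ < 2 := by
  rw [norm_smul, norm_inv, Real.norm_of_nonneg hr.le, inv_mul_lt_iff₀ hr, ← dist_eq_norm]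
  linarith

lemma le_rescaled_norm {r : ℝ} (hr : 0 < r) {c x : E3} (h : 3 * r ≤ dist x c) :
    3 ≤ ‖r⁻¹ • (x - c)‖ := by
  rw [norm_smul, norm_inv, Real.norm_of_nonneg hr.le, le_inv_mul_iff₀ hr, ← dist_eq_norm]
  linarith

lemma pow_three_mul_inv_mul_sqrt {r : ℝ} (hr : 0 < r) : r ^ 3 * (r * √r)⁻¹ = r * √r := by
  have hs : 0 < √r := Real.sqrt_pos.2 hr
  have h : r * √r * (r * √r) = r ^ 3 := by
    calc r * √r * (r * √r) = r ^ 2 * (√r * √r) := by ring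
      _ = r ^ 3 := by rw [Real.mul_self_sqrt hr.le]; ring
  rw [← h]; field_simp

section Densities

variable {S : State} {n : Fin S.N} {t : ℝ} {V : E3 → E3} {K κ : ℝ} {A : Set E3}

lemma integrableOn_momDensity (hV : ContDiff ℝ 1 V) (hK : ∀ y, ‖V y‖ ≤ K)
    (hu : MemLp (S.u t) 2 volume) (hA : MeasurableSet A) (hAfin : volume A ≠ ∞)
    (hρ : ∀ x ∈ A, S.rho t x = κ) (c : E3) : IntegrableOn (fun x => momDensity S V t x c) A := by
  have hfin : IsFiniteMeasure (volume.restrict A) := ⟨by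
    rw [Measure.restrict_apply_univ]; exact hAfin.lt_top⟩
  have huA := hu.restrict A
  have hy : Continuous fun x : E3 => S.r⁻¹ • (x - c) := by fun_prop
  have hm : AEStronglyMeasurable (fun x => momDensity S V t x c) (volume.restrict A) := by
    refine AEStronglyMeasurable.congr
      (f := fun x => κ * inner ℝ (S.u t x) (rescale V S.r c x)) ?_ ?_
    · exact (huA.1.inner (hV.continuous.comp hy).aestronglyMeasurable).const_mul _
    · filter_upwards [ae_restrict_mem hA] with x hx
      rw [momDensity, hρ x hx]
  refine ((huA.integrable (by norm_num)).norm.const_mul (|κ| * K)).mono' hm ?_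
  filter_upwards [ae_restrict_mem hA] with x hx
  exact abs_momDensity_le hK (by rw [hρ x hx]) c

lemma integrableOn_inertiaDensity (hr : 0 < S.r) (hV : ContDiff ℝ 1 V)
    (hK : ∀ y, ‖fderiv ℝ V y‖ ≤ K)
    (hu : MemLp (S.u t) 2 volume) (hA : MeasurableSet A) (hAfin : volume A ≠ ∞)
    (hρ : ∀ x ∈ A, S.rho t x = κ) (c w : E3) :
    IntegrableOn (fun x => inertiaDensity S V t x c w) A := by
  have hfin : IsFiniteMeasure (volume.restrict A) := ⟨by
    rw [Measure.restrict_apply_univ]; exact hAfin.lt_top⟩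
  have huA := hu.restrict A
  have hy : Continuous fun x : E3 => S.r⁻¹ • (x - c) := by fun_prop
  have hD : Continuous fun x : E3 => fderiv ℝ V (S.r⁻¹ • (x - c)) :=
    (hV.continuous_fderiv (by simp)).comp hy
  have happ : ∀ {z : E3 → E3}, AEStronglyMeasurable z (volume.restrict A) → AEStronglyMeasurable
      (fun x => fderiv ℝ V (S.r⁻¹ • (x - c)) (z x)) (volume.restrict A) := fun hz =>
    isBoundedBilinearMap_apply.continuous.comp_aestronglyMeasurable
      (hD.aestronglyMeasurable.prodMk hz)
  have hm : AEStronglyMeasurable (fun x => inertiaDensity S V t x c w) (volume.restrict A) := by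
    refine AEStronglyMeasurable.congr (f := fun x => S.r⁻¹ * (κ *
      (inner ℝ (S.u t x) (fderiv ℝ V (S.r⁻¹ • (x - c)) w)
        - inner ℝ (S.u t x) (fderiv ℝ V (S.r⁻¹ • (x - c)) (S.u t x))))) ?_ ?_
    · exact (((huA.1.inner (happ aestronglyMeasurable_const)).sub
        (huA.1.inner (happ huA.1))).const_mul _).const_mul _
    · filter_upwards [ae_restrict_mem hA] with x hx
      rw [inertiaDensity, hρ x hx]
  have hI : Integrable (fun x => S.r⁻¹ * (|κ| * (K * (‖S.u t x‖ * ‖w‖ + ‖S.u t x‖ ^ 2))))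
      (volume.restrict A) :=
    (((((huA.integrable (by norm_num)).norm.mul_const _).add
      ((memLp_two_iff_integrable_sq_norm huA.1).1 huA)).const_mul _).const_mul _).const_mul _
  refine hI.mono' hm ?_
  filter_upwards [ae_restrict_mem hA] with x hx
  exact abs_inertiaDensity_le hr hK (by rw [hρ x hx]) c w

end Densities

section Slice

variable {Ω : Set E3} {T τ : ℝ} {S : State} {n : Fin S.N} {t : ℝ}
  {a b : E3} {V : E3 → E3} {K C₀ D E : ℝ}

lemma rho_eq_of_mem_body (hS : IsWeakSolution Ω T S) (htT : t ∈ Icc 0 T) {x : E3}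
    (hx : x ∈ S.body n t) : S.rho t x = S.rhoS := by
  rw [hS.rho_eq t htT, if_pos ⟨n, hx⟩]

lemma rho_eq_of_mem_annulus (hS : IsWeakSolution Ω T S) (htT : t ∈ Icc 0 T)
    (hiso : IsIsolated Ω S n τ) (ht : t ∈ Icc 0 τ) {x : E3} (hx : x ∈ annulus S n t) :
    S.rho t x = 1 := by
  rw [hS.rho_eq t htT, if_neg]
  rintro ⟨j, hj⟩
  by_cases hjn : j = n
  · subst hjn; exact hx.2 hj
  · have h1 := hiso.dist t ht j hjn
    have h2 : dist x (S.h n t) < 3 * S.r := hx.1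
    have h3 : dist x (S.h j t) ≤ S.r := hj
    have h4 := dist_triangle_left (S.h j t) (S.h n t) x
    linarith [hS.r_pos]

lemma volume_body_ne_top : volume (S.body n t) ≠ ∞ := measure_closedBall_lt_top.ne

lemma volume_annulus_ne_top : volume (annulus S n t) ≠ ∞ :=
  ((measure_mono sdiff_subset).trans_lt measure_ball_lt_top).ne

/-- The momentum seen by the profile is the momentum of the body, up to the contribution of the
fluid in the annulus, which the energy controls. -/
lemma abs_integral_momDensity_sub_le (hΩ : MeasurableSet Ω) (hS : IsWeakSolution Ω T S)
    (htT : t ∈ Icc 0 T) (hiso : IsIsolated Ω S n τ) (ht : t ∈ Icc 0 τ)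
    (hV : IsRigidProfile a b V) (hK : ∀ y, ‖V y‖ ≤ K)
    (hu : MemLp (S.u t) 2 volume)
    (hrigid : ∀ᵐ x ∂(volume.restrict (S.body n t)), S.u t x = S.rigidVel n t x)
    (hE : ∫ x in Ω, S.rho t x * ‖S.u t x‖ ^ 2 ≤ E)
    (hEi : IntegrableOn (fun x => S.rho t x * ‖S.u t x‖ ^ 2) Ω) :
    |(∫ x in Ω, momDensity S V t x (S.h n t))
      - (S.mass n * inner ℝ (deriv (S.h n) t) a
        + S.rhoS * ballInertia S.r * S.r⁻¹ * inner ℝ (S.ω n t) b)|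
      ≤ K * (S.r * √S.r) * (E + 27 * unitVol) / 2 := by
  have hr := hS.r_pos
  have hK0 : 0 ≤ K := (norm_nonneg _).trans (hK 0)
  have ib := integrableOn_momDensity hV.contDiff hK hu (measurableSet_body S n t)
    volume_body_ne_top (fun x hx => rho_eq_of_mem_body hS htT hx) (S.h n t)
  have ia := integrableOn_momDensity hV.contDiff hK hu (measurableSet_annulus S n t)
    volume_annulus_ne_top (fun x hx => rho_eq_of_mem_annulus hS htT hiso ht hx) (S.h n t)
  rw [setIntegral_eq_body_add_annulus hΩ hr (hiso.subset t ht) (fun x hx => by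
    rw [momDensity, rescale, hV.eq_zero_of_le (le_rescaled_norm hr hx), inner_zero_right,
      mul_zero]) ib ia]
  have hbody : ∫ x in S.body n t, momDensity S V t x (S.h n t)
      = S.mass n * inner ℝ (deriv (S.h n) t) a
        + S.rhoS * ballInertia S.r * S.r⁻¹ * inner ℝ (S.ω n t) b := by
    have h1 : ∫ x in S.body n t, momDensity S V t x (S.h n t)
        = ∫ x in S.body n t, S.rhoS * inner ℝ (deriv (S.h n) t + cross (S.ω n t) (x - S.h n t))
          (a + cross (S.r⁻¹ • b) (x - S.h n t)) := by
      refine integral_congr_ae ?_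
      filter_upwards [hrigid, ae_restrict_mem (measurableSet_body S n t)] with x hx hxb
      rw [momDensity, hx, rho_eq_of_mem_body hS htT hxb, rescale,
        hV.eq_rigid _ (rescaled_norm_lt hr hxb), State.rigidVel, cross_smul, smul_cross]
    rw [h1, integral_const_mul, State.body, setIntegral_inner_rigid, State.mass,
      inner_smul_right]
    ring
  rw [hbody, add_sub_cancel_left]
  have hsr : 0 < √S.r := Real.sqrt_pos.2 hr
  -- the weight `r^{3/2}` in Young's inequality balances the `L²` norm and the volume `≈ r³`
  set l := S.r * √S.r with hl
  have hl0 : 0 < l := by positivity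
  have hann : annulus S n t ⊆ Ω := fun x hx => hiso.subset t ht
    (Metric.closedBall_subset_closedBall (by linarith) (Metric.ball_subset_closedBall hx.1))
  have hu2 : IntegrableOn (fun x => ‖S.u t x‖ ^ 2) (annulus S n t) :=
    ((memLp_two_iff_integrable_sq_norm hu.1).1 hu).integrableOn
  have hEa : ∫ x in annulus S n t, ‖S.u t x‖ ^ 2 ≤ E := by
    have h1 : ∫ x in annulus S n t, ‖S.u t x‖ ^ 2
        = ∫ x in annulus S n t, S.rho t x * ‖S.u t x‖ ^ 2 :=
      setIntegral_congr_fun (measurableSet_annulus S n t) fun x hx => by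
        show _ = S.rho t x * ‖S.u t x‖ ^ 2
        rw [rho_eq_of_mem_annulus hS htT hiso ht hx, one_mul]
    rw [h1]
    refine (setIntegral_mono_set hEi (Eventually.of_forall fun x => ?_)
      hann.eventuallyLE).trans hE
    exact mul_nonneg (hS.rho_pos t htT x).le (sq_nonneg _)
  have hvol : volume.real (annulus S n t) ≤ 27 * (S.r ^ 3 * unitVol) := by
    rw [← volume_real_ball_three hr.le (S.h n t)]
    exact measureReal_mono sdiff_subset measure_ball_lt_top.ne
  have hpt : ∀ x ∈ annulus S n t,
      ‖momDensity S V t x (S.h n t)‖ ≤ K / 2 * (l * ‖S.u t x‖ ^ 2 + l⁻¹) := by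
    intro x hx
    have h1 := abs_momDensity_le hK (t := t) (x := x)
      (R := 1) (by rw [rho_eq_of_mem_annulus hS htT hiso ht hx, abs_one]) (S.h n t)
    rw [Real.norm_eq_abs]
    refine h1.trans ?_
    have h2 : 2 * ‖S.u t x‖ ≤ l * ‖S.u t x‖ ^ 2 + l⁻¹ := by
      have h3 : 0 ≤ l⁻¹ * (l * ‖S.u t x‖ - 1) ^ 2 := by positivity
      have h4 : l⁻¹ * (l * ‖S.u t x‖ - 1) ^ 2
          = l * ‖S.u t x‖ ^ 2 + l⁻¹ - 2 * ‖S.u t x‖ := by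
        field_simp; ring
      linarith
    nlinarith
  have hci : IntegrableOn (fun _ : E3 => l⁻¹) (annulus S n t) :=
    integrableOn_const volume_annulus_ne_top
  have hI := norm_integral_le_of_norm_le (((hu2.const_mul l).add hci).const_mul (K / 2))
    (ae_restrict_of_forall_mem (measurableSet_annulus S n t) hpt)
  rw [Real.norm_eq_abs] at hI
  refine hI.trans ?_
  rw [integral_const_mul]
  simp only [Pi.add_apply]
  rw [integral_add (hu2.const_mul l) hci, integral_const_mul, setIntegral_const, smul_eq_mul]
  have hlr : S.r ^ 3 * l⁻¹ = l := pow_three_mul_inv_mul_sqrt hr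
  have h5 : volume.real (annulus S n t) * l⁻¹ ≤ 27 * unitVol * l := by
    calc _ ≤ 27 * (S.r ^ 3 * unitVol) * l⁻¹ := by gcongr
      _ = 27 * unitVol * (S.r ^ 3 * l⁻¹) := by ring
      _ = _ := by rw [hlr]
  have h6 : l * ∫ x in annulus S n t, ‖S.u t x‖ ^ 2 ≤ l * E := by gcongr
  calc K / 2 * (l * (∫ x in annulus S n t, ‖S.u t x‖ ^ 2) + volume.real (annulus S n t) * l⁻¹)
      ≤ K / 2 * (l * E + 27 * unitVol * l) := by gcongr
    _ = _ := by ring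

/-- The translational velocity of a body is controlled by the dissipation, since it is the mean of
the fluid velocity over the body. -/
lemma volume_mul_norm_deriv_sq_le (hr : 0 < S.r)
    (hu : MemLp (S.u t) 2 volume)
    (hrigid : ∀ᵐ x ∂(volume.restrict (S.body n t)), S.u t x = S.rigidVel n t x)
    (hsob : ∫ x in Metric.ball (S.h n t) (3 * S.r), ‖S.u t x‖ ^ 2 ≤ C₀ * S.r ^ 2 * D) :
    S.r ^ 3 * unitVol * ‖deriv (S.h n) t‖ ^ 2 ≤ C₀ * S.r ^ 2 * D := by
  refine le_trans ?_ hsob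
  have hi : Integrable (fun x => ‖S.u t x‖ ^ 2) := (memLp_two_iff_integrable_sq_norm hu.1).1 hu
  refine le_trans ?_ (setIntegral_mono_set hi.integrableOn
    (Eventually.of_forall fun x => sq_nonneg _) (body_subset_ball hr n t).eventuallyLE)
  have h1 : ∫ x in S.body n t, ‖S.u t x‖ ^ 2
      = ∫ x in S.body n t, inner ℝ (deriv (S.h n) t + cross (S.ω n t) (x - S.h n t))
          (deriv (S.h n) t + cross (S.ω n t) (x - S.h n t)) := by
    refine integral_congr_ae ?_
    filter_upwards [hrigid] with x hx
    rw [hx, real_inner_self_eq_norm_sq, State.rigidVel]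
  obtain ⟨c, hc, hJ⟩ := exists_ballInertia_eq
  rw [h1, State.body, setIntegral_inner_rigid, volume_real_closedBall hr.le,
    real_inner_self_eq_norm_sq, real_inner_self_eq_norm_sq, hJ _ hr]
  have : 0 ≤ c * S.r ^ 2 * volume.real (Metric.closedBall (0 : E3) S.r) * ‖S.ω n t‖ ^ 2 := by
    have := measureReal_nonneg (μ := (volume : Measure E3)) (s := Metric.closedBall (0 : E3) S.r)
    positivity
  linarith

/-- The inertial force acts only in the annulus: on the body its translational part is a multiple of
`h' · (b ∧ h') = 0` and its convective part is `u · (b ∧ u) = 0`. -/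
lemma abs_integral_inertiaDensity_le (hΩ : MeasurableSet Ω) (hS : IsWeakSolution Ω T S)
    (htT : t ∈ Icc 0 T) (hiso : IsIsolated Ω S n τ) (ht : t ∈ Icc 0 τ)
    (hV : IsRigidProfile a b V) (hK : ∀ y, ‖fderiv ℝ V y‖ ≤ K)
    (hu : MemLp (S.u t) 2 volume)
    (hrigid : ∀ᵐ x ∂(volume.restrict (S.body n t)), S.u t x = S.rigidVel n t x)
    (hsob : ∫ x in Metric.ball (S.h n t) (3 * S.r), ‖S.u t x‖ ^ 2 ≤ C₀ * S.r ^ 2 * D) :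
    IntegrableOn (fun x => inertiaDensity S V t x (S.h n t) (deriv (S.h n) t)) Ω ∧
    |∫ x in Ω, inertiaDensity S V t x (S.h n t) (deriv (S.h n) t)| ≤ 29 * K * C₀ * S.r * D := by
  have hr := hS.r_pos
  have hK0 : 0 ≤ K := (norm_nonneg _).trans (hK 0)
  set h' := deriv (S.h n) t
  have ib := integrableOn_inertiaDensity hr hV.contDiff hK hu (measurableSet_body S n t)
    volume_body_ne_top (fun x hx => rho_eq_of_mem_body hS htT hx) (S.h n t) h'
  have ia := integrableOn_inertiaDensity hr hV.contDiff hK hu (measurableSet_annulus S n t)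
    volume_annulus_ne_top (fun x hx => rho_eq_of_mem_annulus hS htT hiso ht hx) (S.h n t) h'
  have hz : ∀ x, 3 * S.r ≤ dist x (S.h n t) → inertiaDensity S V t x (S.h n t) h' = 0 :=
    fun x hx => by
    rw [inertiaDensity, hV.fderiv_eq_zero (le_rescaled_norm hr hx)]
    simp
  constructor
  · have hball := ib.union ia
    rw [annulus, union_sdiff_cancel (body_subset_ball hr n t)] at hball
    refine (hball.integrable_of_forall_notMem_eq_zero fun x hx => ?_).integrableOn
    exact hz x (not_lt.1 hx)
  rw [setIntegral_eq_body_add_annulus hΩ hr (hiso.subset t ht) hz ib ia]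
  have hbody : ∫ x in S.body n t, inertiaDensity S V t x (S.h n t) h' = 0 := by
    have h1 : ∫ x in S.body n t, inertiaDensity S V t x (S.h n t) h'
        = ∫ x in S.body n t, S.r⁻¹ * S.rhoS * inner ℝ (h' + cross (S.ω n t) (x - S.h n t))
          (cross b h' + cross 0 (x - S.h n t)) := by
      refine integral_congr_ae ?_
      filter_upwards [hrigid, ae_restrict_mem (measurableSet_body S n t)] with x hx hxb
      rw [inertiaDensity, rho_eq_of_mem_body hS htT hxb,
        hV.fderiv_eq_crossL (rescaled_norm_lt hr hxb), crossL_apply, crossL_apply,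
        inner_cross_self, hx, State.rigidVel, zero_cross, add_zero]
      ring
    rw [h1, integral_const_mul, State.body, setIntegral_inner_rigid, inner_cross_self,
      inner_zero_right]
    ring
  rw [hbody, zero_add]
  have hu2 : IntegrableOn (fun x => ‖S.u t x‖ ^ 2) (annulus S n t) :=
    ((memLp_two_iff_integrable_sq_norm hu.1).1 hu).integrableOn
  have hci : IntegrableOn (fun _ : E3 => ‖h'‖ ^ 2) (annulus S n t) :=
    integrableOn_const volume_annulus_ne_top
  have hpt : ∀ x ∈ annulus S n t, ‖inertiaDensity S V t x (S.h n t) h'‖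
      ≤ S.r⁻¹ * K * (2 * ‖S.u t x‖ ^ 2 + ‖h'‖ ^ 2) := by
    intro x hx
    have h1 := abs_inertiaDensity_le hr hK (t := t) (x := x)
      (R := 1) (by rw [rho_eq_of_mem_annulus hS htT hiso ht hx, abs_one]) (S.h n t) h'
    rw [Real.norm_eq_abs]
    refine h1.trans ?_
    rw [one_mul, ← mul_assoc]
    refine mul_le_mul_of_nonneg_left ?_ (by positivity)
    nlinarith [sq_nonneg (‖S.u t x‖ - ‖h'‖), sq_nonneg ‖S.u t x‖, sq_nonneg ‖h'‖]
  have hI := norm_integral_le_of_norm_le (((hu2.const_mul 2).add hci).const_mul (S.r⁻¹ * K))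
    (ae_restrict_of_forall_mem (measurableSet_annulus S n t) hpt)
  rw [Real.norm_eq_abs] at hI
  refine hI.trans ?_
  rw [integral_const_mul]
  simp only [Pi.add_apply]
  rw [integral_add (hu2.const_mul 2) hci, integral_const_mul, setIntegral_const, smul_eq_mul]
  have hu3 : ∫ x in annulus S n t, ‖S.u t x‖ ^ 2 ≤ C₀ * S.r ^ 2 * D := by
    refine (setIntegral_mono_set ?_ (Eventually.of_forall fun x => sq_nonneg _)
      sdiff_subset.eventuallyLE).trans hsob
    exact ((memLp_two_iff_integrable_sq_norm hu.1).1 hu).integrableOn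
  have hvol : volume.real (annulus S n t) * ‖h'‖ ^ 2 ≤ 27 * (C₀ * S.r ^ 2 * D) := by
    have h1 : volume.real (annulus S n t) ≤ 27 * (S.r ^ 3 * unitVol) := by
      rw [← volume_real_ball_three hr.le (S.h n t)]
      exact measureReal_mono sdiff_subset measure_ball_lt_top.ne
    have h2 := volume_mul_norm_deriv_sq_le hr hu hrigid hsob
    calc _ ≤ 27 * (S.r ^ 3 * unitVol) * ‖h'‖ ^ 2 := by gcongr
      _ ≤ _ := by linarith
  calc S.r⁻¹ * K * (2 * (∫ x in annulus S n t, ‖S.u t x‖ ^ 2)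
        + volume.real (annulus S n t) * ‖h'‖ ^ 2)
      ≤ S.r⁻¹ * K * (2 * (C₀ * S.r ^ 2 * D) + 27 * (C₀ * S.r ^ 2 * D)) := by gcongr
    _ = _ := by field_simp; ring

/-- The viscous force, estimated by Young's inequality on a ball of volume `≈ r³`,
against a test field with gradient `≈ 1/r`. -/
lemma abs_integral_stressDensity_le (hΩ : MeasurableSet Ω) (hr : 0 < S.r)
    (hsub : Metric.closedBall (S.h n t) (4 * S.r) ⊆ Ω)
    (hV : IsRigidProfile a b V) (hK : ∀ y, ‖fderiv ℝ V y‖ ≤ K)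
    (hG : ∀ i j, MemLp (fun x => S.gradU t x i j) 2 volume)
    (hD : ∫ x in Ω, contract (symPart (S.gradU t x)) (symPart (S.gradU t x)) = D) :
    IntegrableOn (fun x => stressDensity S V t x (S.h n t)) Ω ∧
    |∫ x in Ω, stressDensity S V t x (S.h n t)| ≤ K * √S.r * (D + 243 * unitVol) / 2 := by
  have hK0 : 0 ≤ K := (norm_nonneg _).trans (hK 0)
  have hsr : 0 < √S.r := Real.sqrt_pos.2 hr
  set B := Metric.ball (S.h n t) (3 * S.r) with hB
  have hBm : MeasurableSet B := Metric.isOpen_ball.measurableSet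
  have hBΩ : B ⊆ Ω :=
    (Metric.ball_subset_closedBall.trans (Metric.closedBall_subset_closedBall (by linarith))).trans
      hsub
  have hz : ∀ x, x ∉ B → stressDensity S V t x (S.h n t) = 0 := fun x hx => by
    rw [stressDensity, hV.symPart_grad_eq_zero (Or.inr (le_rescaled_norm hr (not_lt.1 hx)))]
    simp [contract]
  have hsG : ∀ i j, MemLp (fun x => symPart (S.gradU t x) i j) 2 volume := fun i j => by
    simp only [symPart_apply]
    exact ((hG i j).add (hG j i)).const_mul _
  have hcon : Integrable fun x => contract (symPart (S.gradU t x)) (symPart (S.gradU t x)) := by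
    refine integrable_finsetSum _ fun i _ => integrable_finsetSum _ fun j _ => ?_
    exact (hsG i j).integrable_mul (hsG i j)
  have hcnn : ∀ x, 0 ≤ contract (symPart (S.gradU t x)) (symPart (S.gradU t x)) := fun x =>
    Finset.sum_nonneg fun i _ => Finset.sum_nonneg fun j _ => mul_self_nonneg _
  -- the weight `r^{3/2}` in Young's inequality balances the `L²` norm and the volume `≈ r³`
  set l := S.r * √S.r with hl
  have hl0 : 0 < l := by positivity
  have hpt : ∀ x ∈ B, ‖stressDensity S V t x (S.h n t)‖ ≤ S.r⁻¹ * K / 2 *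
      (l * contract (symPart (S.gradU t x)) (symPart (S.gradU t x)) + 9 * l⁻¹) := by
    intro x _
    rw [Real.norm_eq_abs]
    refine (abs_stressDensity_le hr hK t x _).trans ?_
    have h1 : ∀ s : ℝ, |s| ≤ (l * (s * s) + l⁻¹) / 2 := by
      intro s
      have h3 : 0 ≤ l⁻¹ * (l * |s| - 1) ^ 2 := by positivity
      have h4 : l⁻¹ * (l * |s| - 1) ^ 2 = l * (|s| * |s|) + l⁻¹ - 2 * |s| := by
        field_simp; ring
      rw [abs_mul_abs_self] at h4
      linarith
    have h2 : ∑ i, ∑ j, |symPart (S.gradU t x) i j|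
        ≤ (l * contract (symPart (S.gradU t x)) (symPart (S.gradU t x)) + 9 * l⁻¹) / 2 := by
      calc _ ≤ ∑ i : Fin 3, ∑ j : Fin 3, (l * (symPart (S.gradU t x) i j
            * symPart (S.gradU t x) i j) + l⁻¹) / 2 :=
            Finset.sum_le_sum fun i _ => Finset.sum_le_sum fun j _ => h1 _
        _ = _ := by simp only [contract, Fin.sum_univ_three]; ring
    calc S.r⁻¹ * (K * ∑ i, ∑ j, |symPart (S.gradU t x) i j|)
        ≤ S.r⁻¹ * (K * ((l * contract (symPart (S.gradU t x)) (symPart (S.gradU t x))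
          + 9 * l⁻¹) / 2)) := by gcongr
      _ = _ := by ring
  have hci : IntegrableOn (fun _ : E3 => 9 * l⁻¹) B := integrableOn_const measure_ball_lt_top.ne
  have hmaj : IntegrableOn (fun x => S.r⁻¹ * K / 2 *
      (l * contract (symPart (S.gradU t x)) (symPart (S.gradU t x)) + 9 * l⁻¹)) B :=
    ((hcon.integrableOn.const_mul l).add hci).const_mul _
  have hmeas : AEStronglyMeasurable (fun x => stressDensity S V t x (S.h n t))
      (volume.restrict B) := by
    have hy : Continuous fun x : E3 => S.r⁻¹ • (x - S.h n t) := by fun_prop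
    refine AEStronglyMeasurable.const_mul ?_ _
    refine Finset.aestronglyMeasurable_fun_sum _ fun i _ =>
      Finset.aestronglyMeasurable_fun_sum _ fun j _ => ?_
    simp only [symPart_apply (grad V _)]
    have hc : ∀ i j, Continuous fun x => grad V (S.r⁻¹ • (x - S.h n t)) i j := fun i j =>
      (continuous_grad_apply hV.contDiff i j).comp hy
    exact ((hsG i j).1.mul (continuous_const.mul
      ((hc i j).add (hc j i))).aestronglyMeasurable).restrict
  have hiB : IntegrableOn (fun x => stressDensity S V t x (S.h n t)) B :=
    Integrable.mono' hmaj hmeas (ae_restrict_of_forall_mem hBm hpt)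
  refine ⟨(hiB.integrable_of_forall_notMem_eq_zero hz).integrableOn, ?_⟩
  rw [setIntegral_eq_of_subset_of_forall_sdiff_eq_zero hΩ hBΩ fun x hx => hz x hx.2]
  have hI := norm_integral_le_of_norm_le hmaj (ae_restrict_of_forall_mem hBm hpt)
  rw [Real.norm_eq_abs] at hI
  refine hI.trans ?_
  rw [integral_const_mul, integral_add (hcon.integrableOn.const_mul l) hci, integral_const_mul,
    setIntegral_const, smul_eq_mul, hB, volume_real_ball_three hr.le]
  have hDB : ∫ x in Metric.ball (S.h n t) (3 * S.r),
      contract (symPart (S.gradU t x)) (symPart (S.gradU t x)) ≤ D := by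
    rw [← hD]
    exact setIntegral_mono_set hcon.integrableOn (Eventually.of_forall hcnn) hBΩ.eventuallyLE
  have hlr : S.r ^ 3 * l⁻¹ = l := pow_three_mul_inv_mul_sqrt hr
  have hl1 : S.r⁻¹ * l = √S.r := by rw [hl]; field_simp
  calc _ ≤ S.r⁻¹ * K / 2 * (l * D + 27 * (S.r ^ 3 * unitVol) * (9 * l⁻¹)) := by gcongr
    _ = S.r⁻¹ * K / 2 * (l * D + 243 * unitVol * (S.r ^ 3 * l⁻¹)) := by ring
    _ = (S.r⁻¹ * l) * K / 2 * (D + 243 * unitVol) := by rw [hlr]; ring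
    _ = _ := by rw [hl1]; ring

end Slice

/-! ### The velocities of an isolated body -/

/-- The dissipation rate `∫_Ω |𝔻u|²` at time `t`. -/
def dissipation (Ω : Set E3) (S : State) (t : ℝ) : ℝ :=
  ∫ x in Ω, contract (symPart (S.gradU t x)) (symPart (S.gradU t x))

lemma contract_self_nonneg (A : M3) : 0 ≤ contract A A :=
  Finset.sum_nonneg fun _ _ => Finset.sum_nonneg fun _ _ => mul_self_nonneg _

lemma dissipation_nonneg (Ω : Set E3) (S : State) (t : ℝ) : 0 ≤ dissipation Ω S t :=
  integral_nonneg fun _ => contract_self_nonneg _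

lemma IsWeakSolution.integrableOn_dissipation {Ω : Set E3} {T : ℝ} {S : State}
    (hS : IsWeakSolution Ω T S) : IntegrableOn (dissipation Ω S) (Ioo 0 T) := by
  have h : Integrable (fun p : ℝ × E3 => contract (symPart (S.gradU p.1 p.2))
      (symPart (S.gradU p.1 p.2))) (cylinder Ω T) := by
    refine integrable_finsetSum _ fun i _ => integrable_finsetSum _ fun j _ => ?_
    exact (hS.memLp_symGrad_cylinder i j).integrable_mul (hS.memLp_symGrad_cylinder i j)
  exact Integrable.integral_prod_left h

/-- The tested momentum of an isolated body is constant in time up to an error of order `√r`, with a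
constant that depends on the solution only through the bound on its initial energy. -/
lemma exists_momentum_bound {a b : E3} {V : E3 → E3} (hV : IsRigidProfile a b V) (T E₀ : ℝ)
    (hT : 0 < T) : ∃ C : ℝ, 0 ≤ C ∧ ∀ (Ω : Set E3), IsOpen Ω → Bornology.IsBounded Ω →
    ∀ S : State, IsWeakSolution Ω T S → S.initEnergy Ω ≤ E₀ → S.r ≤ 1 →
    ∀ (n : Fin S.N) (τ : ℝ), 0 < τ → τ ≤ T → IsIsolated Ω S n τ →
    ∃ A : ℝ, ∀ᵐ t ∂(volume.restrict (Ioo 0 τ)),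
      |S.mass n * inner ℝ (deriv (S.h n) t) a
        + S.rhoS * ballInertia S.r * S.r⁻¹ * inner ℝ (S.ω n t) b - A| ≤ C * √S.r := by
  obtain ⟨C₀, hC₀, hSob⟩ := exists_setIntegral_sq_le_symGrad
  obtain ⟨K, hK0, hK⟩ := hV.exists_bound
  have hv := unitVol_nonneg
  set C₁ : ℝ := 29 * K * C₀ + K * (1 + 243 * unitVol) with hC₁
  have hC₁0 : 0 ≤ C₁ := by positivity
  refine ⟨K * (|E₀| + 27 * unitVol) + C₁ * (T + |E₀|), by positivity,
    fun Ω hΩ hΩb S hS hE hr1 n τ hτ0 hτ hiso => ?_⟩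
  obtain ⟨hH, hF⟩ := hS.ae_integral_momDensity_eq hΩb hT hτ0 hτ hiso hV
  have hr := hS.r_pos
  have hsr : 0 < √S.r := Real.sqrt_pos.2 hr
  have hss : √S.r * √S.r = S.r := Real.mul_self_sqrt hr.le
  have hs1 : √S.r ≤ 1 := Real.sqrt_le_one.2 hr1
  have hrs : S.r ≤ √S.r := by nlinarith
  have hsub : Ioo 0 τ ⊆ Ioo 0 T := Ioo_subset_Ioo_right hτ
  have hbound : ∀ᵐ t ∂(volume.restrict (Ioo 0 τ)),
      ‖∫ x in Ω, (inertiaDensity S V t x (S.h n t) (deriv (S.h n) t)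
        + stressDensity S V t x (S.h n t))‖ ≤ C₁ * √S.r * (1 + dissipation Ω S t) := by
    filter_upwards [ae_restrict_of_ae_restrict_of_subset hsub hS.u_sobolev,
      ae_restrict_of_ae_restrict_of_subset hsub hS.u_rigid, ae_restrict_mem measurableSet_Ioo]
      with t hW hrig ht
    have htτ := Ioo_subset_Icc_self ht
    have htT := Ioo_subset_Icc_self (hsub ht)
    have hD0 := dissipation_nonneg Ω S t
    obtain ⟨i1, e1⟩ := abs_integral_inertiaDensity_le hΩ.measurableSet hS htT hiso htτ hV
      (fun y => (hK y).2) hW.memLp (hrig n) (hSob Ω _ _ hΩ hW (S.h n t) S.r hr)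
    obtain ⟨i2, e2⟩ := abs_integral_stressDensity_le hΩ.measurableSet hr (hiso.subset t htτ) hV
      (fun y => (hK y).2) hW.memLp_grad rfl
    rw [integral_add i1 i2, Real.norm_eq_abs]
    refine (abs_add_le _ _).trans ((add_le_add e1 e2).trans ?_)
    change 29 * K * C₀ * S.r * dissipation Ω S t
      + K * √S.r * (dissipation Ω S t + 243 * unitVol) / 2 ≤ _
    have k1 : 29 * K * C₀ * S.r * dissipation Ω S t ≤ 29 * K * C₀ * √S.r * dissipation Ω S t := by
      gcongr
    have k2 : 0 ≤ K * √S.r * (dissipation Ω S t + 243 * unitVol) := by positivity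
    have k3 : 0 ≤ 29 * K * C₀ * √S.r := by positivity
    have k4 : 0 ≤ K * √S.r * (1 + 243 * unitVol * dissipation Ω S t) := by positivity
    rw [hC₁]
    linarith
  refine ⟨∫ x in Ω, S.rho 0 x * inner ℝ (S.u0 x) (rescale V S.r (S.h n 0) x), ?_⟩
  filter_upwards [hF, ae_restrict_of_ae_restrict_of_subset hsub hS.energy,
    ae_restrict_of_ae_restrict_of_subset hsub hS.u_sobolev,
    ae_restrict_of_ae_restrict_of_subset hsub hS.u_rigid, ae_restrict_mem measurableSet_Ioo]
    with t hFt hen hW hrig ht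
  have htτ := Ioo_subset_Icc_self ht
  have htT := Ioo_subset_Icc_self (hsub ht)
  have hkin0 : 0 ≤ ∫ x in Ω, S.rho t x * ‖S.u t x‖ ^ 2 :=
    integral_nonneg fun x => mul_nonneg (hS.rho_pos t htT x).le (sq_nonneg _)
  have hE' : E₀ ≤ |E₀| := le_abs_self _
  have hdis0 : 0 ≤ ∫ s in Ioo 0 t, dissipation Ω S s :=
    integral_nonneg fun s => dissipation_nonneg Ω S s
  change 1 / 2 * (∫ x in Ω, S.rho t x * ‖S.u t x‖ ^ 2) + (∫ s in Ioo 0 t, dissipation Ω S s)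
    ≤ 1 / 2 * S.initEnergy Ω at hen
  have hkin : ∫ x in Ω, S.rho t x * ‖S.u t x‖ ^ 2 ≤ |E₀| := by linarith
  have hdis : ∫ s in Ioo 0 t, dissipation Ω S s ≤ |E₀| := by linarith
  have hkini : IntegrableOn (fun x => S.rho t x * ‖S.u t x‖ ^ 2) Ω := by
    have h1 : IntegrableOn (fun x => ‖S.u t x‖ ^ 2) Ω :=
      ((memLp_two_iff_integrable_sq_norm hW.memLp.1).1 hW.memLp).integrableOn
    exact Integrable.bdd_mul h1 (hS.rho_integrable t htT).1
      (Eventually.of_forall fun x => hS.abs_rho_le htT x)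
  have e1 := abs_integral_momDensity_sub_le hΩ.measurableSet hS htT hiso htτ hV
    (fun y => (hK y).1) hW.memLp (hrig n) hkin hkini
  have e2 : ‖∫ s in (0 : ℝ)..t, ∫ x in Ω, (inertiaDensity S V s x (S.h n s) (deriv (S.h n) s)
      + stressDensity S V s x (S.h n s))‖ ≤ C₁ * √S.r * (T + |E₀|) := by
    have hDt : IntegrableOn (dissipation Ω S) (Ioo 0 t) :=
      hS.integrableOn_dissipation.mono_set (Ioo_subset_Ioo_right htT.2)
    have h1t : IntegrableOn (fun _ : ℝ => (1 : ℝ)) (Ioo 0 t) := integrableOn_const (by simp)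
    rw [intervalIntegral.integral_of_le ht.1.le, integral_Ioc_eq_integral_Ioo]
    refine (norm_integral_le_of_norm_le ((h1t.add hDt).const_mul (C₁ * √S.r))
      (ae_restrict_of_ae_restrict_of_subset (Ioo_subset_Ioo_right ht.2.le) hbound)).trans ?_
    rw [integral_const_mul]
    simp only [Pi.add_apply]
    rw [integral_add h1t hDt]
    simp only [integral_const, MeasurableSet.univ, measureReal_restrict_apply, univ_inter,
      Real.volume_real_Ioo_of_le ht.1.le, smul_eq_mul, mul_one, sub_zero]
    have := htT.2
    gcongr
  rw [hFt] at e1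
  rw [Real.norm_eq_abs] at e2
  have k1 : K * (S.r * √S.r) * (|E₀| + 27 * unitVol) / 2 ≤ K * (|E₀| + 27 * unitVol) * √S.r := by
    have h1 : S.r * √S.r ≤ √S.r := mul_le_of_le_one_left hsr.le hr1
    have h2 : 0 ≤ K * (|E₀| + 27 * unitVol) := by positivity
    have h3 := mul_le_mul_of_nonneg_left h1 h2
    have h4 : 0 ≤ K * (|E₀| + 27 * unitVol) * √S.r := by positivity
    linarith
  rw [abs_le] at e1 e2 ⊢
  constructor <;> linarith [e1.1, e1.2, e2.1, e2.2]

lemma norm_le_sum_abs (x : E3) : ‖x‖ ≤ |x 0| + |x 1| + |x 2| := by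
  rw [EuclideanSpace.norm_eq, Fin.sum_univ_three]
  refine Real.sqrt_le_iff.2 ⟨by positivity, ?_⟩
  simp only [Real.norm_eq_abs]
  nlinarith [abs_nonneg (x 0), abs_nonneg (x 1), abs_nonneg (x 2),
    mul_nonneg (abs_nonneg (x 0)) (abs_nonneg (x 1)),
    mul_nonneg (abs_nonneg (x 0)) (abs_nonneg (x 2)),
    mul_nonneg (abs_nonneg (x 1)) (abs_nonneg (x 2))]

lemma norm_le_of_forall_abs_le {x : E3} {M : ℝ} (h : ∀ i, |x i| ≤ M) : ‖x‖ ≤ 3 * M :=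
  (norm_le_sum_abs x).trans (by linarith [h 0, h 1, h 2])

/-- A property that holds almost everywhere on `(0,τ)` holds at points arbitrarily close to `0`. -/
lemma frequently_nhdsGT_of_ae_Ioo {p : ℝ → Prop} {τ : ℝ} (hτ : 0 < τ)
    (h : ∀ᵐ t ∂(volume.restrict (Ioo 0 τ)), p t) : ∃ᶠ t in 𝓝[>] 0, p t := by
  intro hev
  obtain ⟨u, hu, hsub⟩ := mem_nhdsGT_iff_exists_Ioo_subset.1 hev
  have hu : 0 < u := hu
  have hne : (ae (volume.restrict (Ioo 0 (min u τ)))).NeBot := by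
    rw [ae_neBot, Ne, Measure.restrict_eq_zero, Real.volume_Ioo]
    simp [hu, hτ]
  have h1 : ∀ᵐ t ∂(volume.restrict (Ioo 0 (min u τ))), p t :=
    ae_restrict_of_ae_restrict_of_subset (Ioo_subset_Ioo_right (min_le_right _ _)) h
  obtain ⟨t, ht, htm⟩ := (h1.and (ae_restrict_mem measurableSet_Ioo)).exists
  exact hsub ⟨htm.1, htm.2.trans_le (min_le_left _ _)⟩ ht

lemma mass_pos {Ω : Set E3} {T : ℝ} {S : State} (hS : IsWeakSolution Ω T S) (n : Fin S.N) :
    0 < S.mass n := by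
  have h1 := hS.r_pos
  have h2 := hS.rhoS_pos
  have h3 := unitVol_pos
  rw [State.mass, volume_real_closedBall h1.le]
  positivity

/-- The velocities of an isolated body stay close to their initial values. -/
lemma exists_velocity_bound (T E₀ : ℝ) (hT : 0 < T) :
    ∃ C : ℝ, 0 ≤ C ∧ ∀ (Ω : Set E3), IsOpen Ω → Bornology.IsBounded Ω →
    ∀ S : State, IsWeakSolution Ω T S → S.initEnergy Ω ≤ E₀ → S.r ≤ 1 →
    ∀ (n : Fin S.N), DifferentiableWithinAt ℝ (S.h n) (Icc 0 T) 0 →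
    ∀ τ : ℝ, 0 < τ → τ ≤ T → IsIsolated Ω S n τ →
    ∀ᵐ t ∂(volume.restrict (Ioo 0 τ)),
      ‖deriv (S.h n) t - S.initVel T n‖ ≤ C * (√S.r / S.mass n) ∧
      S.r * ‖S.ω n t - S.ω n 0‖ ≤ C * (√S.r / S.mass n) := by
  obtain ⟨c, hc, hJ⟩ := exists_ballInertia_eq
  have htr : ∀ i : Fin 3, ∃ V, IsRigidProfile (EuclideanSpace.single i 1) 0 V := fun i =>
    exists_translation_profile _
  have hro : ∀ i : Fin 3, ∃ V, IsRigidProfile 0 (EuclideanSpace.single i 1) V := fun i =>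
    exists_rotation_profile _
  choose V hV using htr
  choose W hW using hro
  choose CV hCV0 hCV using fun i => exists_momentum_bound (hV i) T E₀ hT
  choose CW hCW0 hCW using fun i => exists_momentum_bound (hW i) T E₀ hT
  set C₁ := ∑ i, (CV i + CW i) with hC₁
  have hle : ∀ i, CV i + CW i ≤ C₁ := fun i =>
    Finset.single_le_sum (f := fun i => CV i + CW i)
      (fun j _ => add_nonneg (hCV0 j) (hCW0 j)) (Finset.mem_univ i)
  have hC₁0 : 0 ≤ C₁ := Finset.sum_nonneg fun j _ => add_nonneg (hCV0 j) (hCW0 j)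
  refine ⟨6 * C₁ + 6 * C₁ / c, by positivity,
    fun Ω hΩ hΩb S hS hE hr1 n hdiff τ hτ0 hτ hiso => ?_⟩
  have hr := hS.r_pos
  have hm := mass_pos hS n
  set δ := √S.r / S.mass n with hδ
  have hδ0 : 0 ≤ δ := by positivity
  choose A hA using fun i => hCV i Ω hΩ hΩb S hS hE hr1 n τ hτ0 hτ hiso
  choose B hB using fun i => hCW i Ω hΩ hΩb S hS hE hr1 n τ hτ0 hτ hiso
  -- translational velocities: `h'` is close to the constant `v`, hence so are the difference
  -- quotients at `0` and their limit `h'(0)`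
  set v : E3 := WithLp.toLp 2 fun i => A i / S.mass n with hv
  have h1 : ∀ᵐ t ∂(volume.restrict (Ioo 0 τ)), ‖deriv (S.h n) t - v‖ ≤ 3 * (C₁ * δ) := by
    filter_upwards [ae_all_iff.2 hA] with t ht
    refine norm_le_of_forall_abs_le fun i => ?_
    have h2 := ht i
    rw [inner_zero_right, mul_zero, add_zero, EuclideanSpace.inner_single_right] at h2
    have h3 : (deriv (S.h n) t - v) i = (S.mass n * deriv (S.h n) t i - A i) / S.mass n := by
      simp only [hv, PiLp.sub_apply]
      field_simp
    rw [h3, abs_div, abs_of_pos hm, hδ, ← mul_div_assoc]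
    gcongr
    refine le_trans (by simpa using h2) ?_
    gcongr
    linarith [hle i, hCW0 i]
  obtain ⟨L, hL⟩ := hS.h_lipschitz n
  have h2 : ‖S.initVel T n - v‖ ≤ 3 * (C₁ * δ) := by
    have hd : HasDerivWithinAt (S.h n) (S.initVel T n) (Ioi 0) 0 := by
      have h3 := hdiff.hasDerivWithinAt
      have h4 : Icc (0 : ℝ) T ∈ 𝓝[>] 0 :=
        mem_of_superset (Ioo_mem_nhdsGT hT) Ioo_subset_Icc_self
      exact h3.mono_of_mem_nhdsWithin h4
    have hs := (hasDerivWithinAt_iff_tendsto_slope' (by simp)).1 hd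
    refine le_of_tendsto ((hs.sub_const v).norm) ?_
    filter_upwards [Ioo_mem_nhdsGT hτ0] with t ht
    have h5 := norm_sub_sub_smul_le_of_ae_deriv (hL.mono (Icc_subset_Icc_right hτ)) h1
      (Ioo_subset_Icc_self ht)
    have h6 : slope (S.h n) 0 t - v = t⁻¹ • (S.h n t - S.h n 0 - t • v) := by
      rw [slope_def_module, sub_zero, smul_sub _ _ (t • v), smul_smul,
        inv_mul_cancel₀ ht.1.ne', one_smul]
    rw [h6, norm_smul, norm_inv, Real.norm_of_nonneg ht.1.le, inv_mul_le_iff₀ ht.1]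
    linarith
  -- angular velocities: `ω` is continuous, so the bound passes to `t = 0`
  have hJm : S.rhoS * ballInertia S.r * S.r⁻¹ = c * S.r * S.mass n := by
    rw [hJ _ hr, State.mass]
    field_simp
  have h3 : ∀ i, ∀ᵐ t ∂(volume.restrict (Ioo 0 τ)),
      |c * S.r * S.mass n * S.ω n t i - B i| ≤ C₁ * √S.r := by
    intro i
    filter_upwards [hB i] with t ht
    rw [inner_zero_right, mul_zero, zero_add, EuclideanSpace.inner_single_right, hJm] at ht
    refine le_trans (by simpa using ht) ?_
    gcongr
    linarith [hle i, hCV0 i]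
  have h4 : ∀ i, |c * S.r * S.mass n * S.ω n 0 i - B i| ≤ C₁ * √S.r := by
    intro i
    obtain ⟨L', hL'⟩ := hS.ω_lipschitz n
    have hcont : Tendsto (S.ω n) (𝓝[>] 0) (𝓝 (S.ω n 0)) :=
      (hL'.continuousOn 0 (left_mem_Icc.2 hT.le)).mono_left
        (nhdsWithin_le_of_mem (mem_of_superset (Ioo_mem_nhdsGT hT) Ioo_subset_Icc_self))
    have hci : Tendsto (fun t => S.ω n t i) (𝓝[>] 0) (𝓝 (S.ω n 0 i)) :=
      ((EuclideanSpace.proj (𝕜 := ℝ) i).continuous.tendsto _).comp hcont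
    exact le_of_tendsto_of_frequently ((hci.const_mul _).sub_const _).abs
      (frequently_nhdsGT_of_ae_Ioo hτ0 (h3 i))
  filter_upwards [h1, ae_all_iff.2 h3] with t ht1 ht3
  constructor
  · have h5 : deriv (S.h n) t - S.initVel T n
        = (deriv (S.h n) t - v) - (S.initVel T n - v) := by abel
    rw [h5]
    refine (norm_sub_le _ _).trans ?_
    have : 0 ≤ 6 * C₁ / c * δ := by positivity
    linarith
  · have h5 : ‖S.ω n t - S.ω n 0‖ ≤ 3 * (2 * (C₁ * √S.r) / (c * S.r * S.mass n)) := by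
      refine norm_le_of_forall_abs_le fun i => ?_
      rw [le_div_iff₀ (by positivity)]
      have h6 : |c * S.r * S.mass n * (S.ω n t - S.ω n 0) i| ≤ 2 * (C₁ * √S.r) := by
        have e : c * S.r * S.mass n * (S.ω n t - S.ω n 0) i
          = (c * S.r * S.mass n * S.ω n t i - B i) - (c * S.r * S.mass n * S.ω n 0 i - B i) := by
          simp only [PiLp.sub_apply]; ring
        rw [e]
        refine (abs_sub _ _).trans ?_
        linarith [ht3 i, h4 i]
      rw [abs_mul, abs_of_pos (by positivity)] at h6
      linarith
    have h6 : S.r * (3 * (2 * (C₁ * √S.r) / (c * S.r * S.mass n))) = 6 * C₁ / c * δ := by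
      rw [hδ]; field_simp; ring
    have h7 : 0 ≤ 6 * C₁ * δ := by positivity
    calc S.r * ‖S.ω n t - S.ω n 0‖
        ≤ S.r * (3 * (2 * (C₁ * √S.r) / (c * S.r * S.mass n))) := by gcongr
      _ = 6 * C₁ / c * δ := h6
      _ ≤ _ := by linarith

/-! ### Absence of collisions -/

lemma ball_subset_of_lt_infDist_frontier {Ω : Set E3} (hΩ : IsOpen Ω) {c : E3} (hc : c ∈ Ω) {ε : ℝ}
    (hε : 0 < ε) (hd : ε < Metric.infDist c (frontier Ω)) : Metric.ball c ε ⊆ Ω := by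
  refine ((convex_ball c ε).isPreconnected).subset_left_of_subset_union hΩ
    (isClosed_closure (s := Ω)).isOpen_compl
    (disjoint_compl_right.mono_left subset_closure) (fun x hx => ?_)
    ⟨c, Metric.mem_ball_self hε, hc⟩
  by_contra hcon
  rw [mem_union, not_or, notMem_compl_iff] at hcon
  have hfr : x ∈ frontier Ω := by
    rw [hΩ.frontier_eq]; exact ⟨hcon.2, hcon.1⟩
  have h1 := Metric.infDist_le_dist_of_mem (x := c) hfr
  rw [Metric.mem_ball, dist_comm] at hx
  linarith

/-- Small displacements of an `ε`-separated configuration keep all bodies isolated. -/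
lemma isIsolated_of_displacement_le {Ω : Set E3} (hΩ : IsOpen Ω) {S : State} {ε τ : ℝ} (hε : 0 < ε)
    (hr : 20 * S.r ≤ ε) (hr0 : 0 < S.r) (hsep : IsSeparated Ω ε S)
    (hdisp : ∀ t ∈ Icc 0 τ, ∀ j, ‖S.h j t - S.h j 0‖ ≤ ε / 4) (n : Fin S.N) :
    IsIsolated Ω S n τ := by
  constructor
  · intro t ht x hx
    obtain ⟨hmem, hdist⟩ := hsep.1 n
    refine ball_subset_of_lt_infDist_frontier hΩ hmem hε hdist ?_
    have h1 := hdisp t ht n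
    rw [← dist_eq_norm] at h1
    rw [Metric.mem_closedBall] at hx
    rw [Metric.mem_ball]
    linarith [dist_triangle x (S.h n t) (S.h n 0)]
  · intro t ht j hj
    have h1 := hdisp t ht n
    have h2 := hdisp t ht j
    rw [← dist_eq_norm] at h1 h2
    rw [dist_comm] at h2
    have h3 := hsep.2 j n hj
    linarith [dist_triangle4 (S.h j 0) (S.h j t) (S.h n t) (S.h n 0)]

/-- The continuation argument: if, as long as the displacements are at most `ε/4`, the velocities
obey a bound that limits the displacements to `ε/8`, then the displacements never exceed `ε/4`.
-/
lemma displacement_le_of_velocity_bound {S : State} {T ε M : ℝ} (hε : 0 < ε)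
    (hlip : ∀ n, ∃ K : ℝ≥0, LipschitzOnWith K (S.h n) (Icc 0 T))
    (hM : M * T ≤ ε / 8)
    (hvel : ∀ τ, 0 < τ → τ ≤ T → (∀ t ∈ Icc 0 τ, ∀ j, ‖S.h j t - S.h j 0‖ ≤ ε / 4) →
      ∀ n, ∀ᵐ t ∂(volume.restrict (Ioo 0 τ)), ‖deriv (S.h n) t‖ ≤ M) :
    ∀ t ∈ Icc 0 T, ∀ j, ‖S.h j t - S.h j 0‖ ≤ ε / 4 := by
  have hcont : ∀ j, ContinuousOn (fun t => ‖S.h j t - S.h j 0‖) (Icc 0 T) := fun j => by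
    obtain ⟨K, hK⟩ := hlip j
    exact (hK.continuousOn.sub continuousOn_const).norm
  by_contra hcon
  push Not at hcon
  obtain ⟨t₁, ht₁, j₁, hj₁⟩ := hcon
  set Q : Set ℝ := ⋃ j, (Icc 0 T ∩ (fun t => ‖S.h j t - S.h j 0‖) ⁻¹' Ici (ε / 4)) with hQ
  have hQc : IsCompact Q := isCompact_iUnion fun j =>
    isCompact_Icc.of_isClosed_subset
      ((hcont j).preimage_isClosed_of_isClosed isClosed_Icc isClosed_Ici) inter_subset_left
  -- `t₀` is the first time at which some displacement reaches `ε/4`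
  obtain ⟨t₀, ht₀, hmin⟩ := hQc.exists_isLeast ⟨t₁, mem_iUnion.2 ⟨j₁, ht₁, hj₁.le⟩⟩
  obtain ⟨j, ht₀T, hj⟩ := mem_iUnion.1 ht₀
  have hj : ε / 4 ≤ ‖S.h j t₀ - S.h j 0‖ := hj
  have hpos : 0 < t₀ := by
    refine ht₀T.1.lt_of_ne fun h => ?_
    rw [← h, sub_self, norm_zero] at hj
    linarith
  have hbefore : ∀ τ ∈ Ioo 0 t₀, ‖S.h j τ - S.h j 0‖ ≤ ε / 8 := by
    intro τ hτ
    have hτT : τ ≤ T := hτ.2.le.trans ht₀T.2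
    have hgood : ∀ t ∈ Icc 0 τ, ∀ i, ‖S.h i t - S.h i 0‖ ≤ ε / 4 := by
      intro t ht i
      by_contra hlt
      have : t₀ ≤ t := hmin (mem_iUnion.2 ⟨i, ⟨ht.1, ht.2.trans hτT⟩, (not_le.1 hlt).le⟩)
      linarith [ht.2, hτ.2]
    have hv := hvel τ hτ.1 hτT hgood j
    obtain ⟨K, hK⟩ := hlip j
    have h1 := norm_sub_sub_smul_le_of_ae_deriv (c := 0) (hK.mono (Icc_subset_Icc_right hτT))
      (by simpa using hv) (right_mem_Icc.2 hτ.1.le)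
    rw [smul_zero, sub_zero] at h1
    have hM0 : 0 ≤ M := by
      have h2 := (norm_nonneg _).trans h1
      exact nonneg_of_mul_nonneg_left h2 hτ.1
    exact h1.trans ((mul_le_mul_of_nonneg_left hτT hM0).trans hM)
  have hlim : Tendsto (fun t => ‖S.h j t - S.h j 0‖) (𝓝[<] t₀) (𝓝 ‖S.h j t₀ - S.h j 0‖) := by
    have h1 := hcont j t₀ ht₀T
    refine (h1.mono fun t (ht : t ∈ Ioo 0 t₀) => ⟨ht.1.le, ht.2.le.trans ht₀T.2⟩).mono_left ?_
    exact nhdsWithin_le_of_mem (Ioo_mem_nhdsLT hpos)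
  have := le_of_tendsto hlim (mem_of_superset (Ioo_mem_nhdsLT hpos) hbefore)
  linarith

lemma noCollision_of_isIsolated {Ω : Set E3} {S : State} {T : ℝ} (hr : 0 < S.r)
    (h : ∀ n, IsIsolated Ω S n T) : NoCollision Ω T S := by
  refine fun t ht => ⟨fun n => (Metric.closedBall_subset_closedBall (by linarith)).trans
    ((h n).subset t ht), fun i j hij => Metric.closedBall_disjoint_closedBall ?_⟩
  linarith [(h j).dist t ht i hij]

end FSI

end

theorem proposition2p3
    (Ω : Set FSI.E3) (hΩ : IsOpen Ω) (hΩb : Bornology.IsBounded Ω)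
    (T : ℝ) (hT : 0 < T)
    (ε₀ : ℝ) (hε₀ : 0 < ε₀)
    (S : ℝ → FSI.State)
    -- the radii are small compared with `ε`, and the initial configuration is `ε`-separated
    (hr : Tendsto (fun ε => (S ε).r / ε) (𝓝[>] 0) (𝓝 0))
    (hsep : ∀ ε ∈ Ioo 0 ε₀, FSI.IsSeparated Ω ε (S ε))
    -- weak solutions with bounded initial energy
    (hsol : ∀ ε ∈ Ioo 0 ε₀, FSI.IsWeakSolution Ω T (S ε))
    (henergy : ∃ E₀ : ℝ, ∀ ε ∈ Ioo 0 ε₀, (S ε).initEnergy Ω ≤ E₀)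
    -- the initial translational velocities exist
    (hdiff : ∀ ε ∈ Ioo 0 ε₀, ∀ n, DifferentiableWithinAt ℝ ((S ε).h n) (Icc 0 T) 0)
    (hvel : Tendsto (fun ε => ⨆ n, ‖(S ε).initVel T n‖ / ε) (𝓝[>] 0) (𝓝 0))
    (hmass : Tendsto (fun ε => ⨆ n, Real.sqrt (S ε).r / (ε * (S ε).mass n)) (𝓝[>] 0) (𝓝 0)) :
    ∃ εbar > 0, ∃ C : ℝ, ∀ ε ∈ Ioo 0 εbar,
      (∀ n,
        eLpNorm (fun t => deriv ((S ε).h n) t - (S ε).initVel T n) ∞ (volume.restrict (Ioo 0 T))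
          + ENNReal.ofReal (S ε).r *
            eLpNorm (fun t => (S ε).ω n t - (S ε).ω n 0) ∞ (volume.restrict (Ioo 0 T))
        ≤ ENNReal.ofReal (C * (Real.sqrt (S ε).r / (S ε).mass n))) ∧
      FSI.NoCollision Ω T (S ε) := by
  obtain ⟨E₀, hE₀⟩ := henergy
  obtain ⟨C, hC0, hC⟩ := FSI.exists_velocity_bound T E₀ hT
  obtain ⟨εbar, hεbar, hsmall⟩ := mem_nhdsGT_iff_exists_Ioo_subset.1
    (((hr.eventually_lt_const (show (0 : ℝ) < 1 / 20 by norm_num)).and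
      (hvel.eventually_lt_const (show (0 : ℝ) < 1 / (16 * T) by positivity))).and
      ((hmass.eventually_lt_const (show (0 : ℝ) < 1 / (16 * T * (C + 1)) by positivity)).and
        (Ioo_mem_nhdsGT (lt_min hε₀ one_pos))))
  refine ⟨εbar, hεbar, 2 * C, fun ε hε => ?_⟩
  obtain ⟨⟨h1, h2⟩, h3, hε1⟩ := hsmall hε
  have hεpos : 0 < ε := hε.1
  have hεmem : ε ∈ Ioo 0 ε₀ := ⟨hεpos, hε1.2.trans_le (min_le_left _ _)⟩
  have hε_one : ε < 1 := hε1.2.trans_le (min_le_right _ _)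
  have hS := hsol ε hεmem
  have hr0 := hS.r_pos
  have hr20 : 20 * (S ε).r ≤ ε := by
    have : (S ε).r / ε < 1 / 20 := h1
    rw [div_lt_iff₀ hεpos] at this
    linarith
  have hv : ∀ n, ‖(S ε).initVel T n‖ ≤ ε / (16 * T) := by
    intro n
    have h4 : ‖(S ε).initVel T n‖ / ε ≤ 1 / (16 * T) :=
      (le_ciSup (f := fun n => ‖(S ε).initVel T n‖ / ε) (finite_range _).bddAbove n).trans
        (le_of_lt h2)
    rw [div_le_iff₀ hεpos] at h4
    exact h4.trans (le_of_eq (by ring))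
  have hm : ∀ n, C * (√(S ε).r / (S ε).mass n) ≤ ε / (16 * T) := by
    intro n
    have hmn := FSI.mass_pos hS n
    have h4 : √(S ε).r / (ε * (S ε).mass n) ≤ 1 / (16 * T * (C + 1)) :=
      (le_ciSup (f := fun n => √(S ε).r / (ε * (S ε).mass n)) (finite_range _).bddAbove n).trans
        (le_of_lt h3)
    have h5 : C * (√(S ε).r / (S ε).mass n)
        = C * ε * (√(S ε).r / (ε * (S ε).mass n)) := by field_simp
    rw [h5]
    calc C * ε * (√(S ε).r / (ε * (S ε).mass n))
        ≤ (C + 1) * ε * (1 / (16 * T * (C + 1))) := by gcongr; linarith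
      _ = ε / (16 * T) := by field_simp
  have hdisp : ∀ t ∈ Icc 0 T, ∀ j, ‖(S ε).h j t - (S ε).h j 0‖ ≤ ε / 4 := by
    refine FSI.displacement_le_of_velocity_bound (M := ε / (8 * T)) hεpos hS.h_lipschitz
      (le_of_eq (by field_simp)) fun τ hτ0 hτ hgood n => ?_
    have hiso := FSI.isIsolated_of_displacement_le hΩ hεpos hr20 hr0 (hsep ε hεmem) hgood n
    filter_upwards [hC Ω hΩ hΩb (S ε) hS (hE₀ ε hεmem) (by linarith) n (hdiff ε hεmem n) τ hτ0 hτ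
      hiso] with t ht
    calc ‖deriv ((S ε).h n) t‖
        = ‖(deriv ((S ε).h n) t - (S ε).initVel T n) + (S ε).initVel T n‖ := by
          rw [sub_add_cancel]
      _ ≤ ε / (16 * T) + ε / (16 * T) :=
          (norm_add_le _ _).trans (add_le_add (ht.1.trans (hm n)) (hv n))
      _ = ε / (8 * T) := by ring
  have hiso := FSI.isIsolated_of_displacement_le hΩ hεpos hr20 hr0 (hsep ε hεmem) hdisp
  refine ⟨fun n => ?_, FSI.noCollision_of_isIsolated hr0 hiso⟩
  have hae := hC Ω hΩ hΩb (S ε) hS (hE₀ ε hεmem) (by linarith) n (hdiff ε hεmem n) T hT le_rfl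
    (hiso n)
  set δ := √(S ε).r / (S ε).mass n
  have hδ0 : 0 ≤ δ := div_nonneg (Real.sqrt_nonneg _) (FSI.mass_pos hS n).le
  rw [two_mul, add_mul, ENNReal.ofReal_add (mul_nonneg hC0 hδ0) (mul_nonneg hC0 hδ0),
    eLpNorm_exponent_top, eLpNorm_exponent_top]
  refine add_le_add (eLpNormEssSup_le_of_ae_bound (hae.mono fun t ht => ht.1)) ?_
  have hω : eLpNormEssSup (fun t => (S ε).ω n t - (S ε).ω n 0) (volume.restrict (Ioo 0 T))
      ≤ ENNReal.ofReal (C * δ / (S ε).r) := by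
    refine eLpNormEssSup_le_of_ae_bound (hae.mono fun t ht => ?_)
    rw [le_div_iff₀ hr0, mul_comm]
    exact ht.2
  refine (mul_le_mul_right hω _).trans (le_of_eq ?_)
  rw [← ENNReal.ofReal_mul hr0.le]
  congr 1
  field_simp
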